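/- **System.** There are $N\ge 1$ blockchain nodes with equal stake, of which a fixed set of fewer than $N/3$ is malicious; the others are honest. *Ledger.* The blockchain state holds, for every native stablecoin $c$ (currency unit), the balances of all accounts, the pool of collected fees, and administrative data: a whitelist (the committee that manages $c$), a blacklist, a committee size, a quorum size, the net amount issued, and the list of management proposals with the votes cast. It also holds account nonces, the EVM world state, the exchange rates in an on-chain contract updated by the oracle, and the exchange rates stored by the nodes, which every $K\ge 1$ blocks are set to those of the contract. A transaction is a message signed by the owner of the sending account (nonce, base fee, tip, gas limit, payload) together with a currency unit. Its payload is an EVM call, a rate update, a management proposal (mint, burn, change of whitelist, blacklist, committee size or quorum size), or a vote on a proposal. It is valid in a state if the nonce is right, the sender is not blacklisted for the currency unit and can pay for the gas limit in it, the base fee equals $\lceil b_0\,\rho\rceil$, where $b_0$ is a fixed reference base fee and $\rho$ the stored exchange rate of the currency unit, and the payload is permissible: only the oracle updates rates, only whitelisted members propose and vote, and a member votes at most once on a proposal, while it is pending. The EVM, an arbitrary deterministic function, sees and changes only balances in the transaction's currency unit. A proposal on $c$ is executed (if permissible, otherwise it fails) by the approving vote with which the approvals by current committee members reach the quorum size.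 The fee, (base fee + tip) times the gas used, is paid in the transaction's currency unit into the fee pool of the nodes. A block is a list of transactions; it is valid if they are valid in succession. *Services.* RPC nodes are honest: there is one type for each currency unit; the RPC of type $c$ appends $c$ to each signed transaction submitted to it by a user and broadcasts it, otherwise unchanged, to the nodes. The oracle is honest: the rates it submits are the external rates of that moment. *Consensus.* Honest nodes run Tendermint with round-robin proposers, quorums of more than $2N/3$ nodes, round skipping on messages from more than $N/3$ nodes, and timeouts that grow linearly with the round with positive slope. A node acts on a proposed block only once it has received each transaction of the block, in exactly this version, from the RPC nodes; validity of a block is judged on the state reached by the node's decided chain. An honest proposer without a previously validated block proposes a valid block of transactions received from RPC nodes, picking each time one of highest real fee value $(\text{base fee}+\text{tip})/\rho$. Malicious nodes behave arbitrarily, but cannot forge signatures. The network is partially synchronous: there are $\mathrm{GST}\in\mathbb R$ and $\Delta>0$, unknown to the protocol, such that whatever an honest node sends or receives (and hence relays), or an RPC node broadcasts, at time $t$ is received by all honest nodes before $\max(t,\mathrm{GST})+\Delta$. Local computation takes no time, and only finitely many events occur in bounded time. **Theorem.** If the proportion of malicious blockchain nodes is less than $1/3$, every execution of MStableChain is secure,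 that is: 1. *(Safety)* Of any two chains decided by honest nodes at any times, one is a prefix of the other; the chain of an honest node is only ever extended; it is valid, and executing it from the genesis state yields the state that the node maintains. 2. *(Liveness)* Every honest node eventually decides a block at every height. 3. *(Currency units cannot be tampered with)* Every transaction on the chain of an honest node, or in a block for which an honest node has prevoted or precommitted, was earlier submitted in exactly this form, by the owner of the sending account, to the RPC of exactly this currency unit. For every transaction on the chain of an honest node, the fee is paid for an amount of gas within its gas limit into the fee pool of its currency unit and no other fee pool is affected; the state of every stablecoin that is neither this currency unit nor managed by the transaction is unchanged. 4. *(Base fees cannot be tampered with)* The base fee of every transaction in block number $n$ (counted from $0$) of the chain of an honest node is $\lceil b_0\,\rho\rceil$, where $\rho$ is the rate of its currency unit in the last rate update within the first $K\lfloor n/K\rfloor$ blocks of the chain (the genesis rate if there is none). Every rate update on the chain comes from the oracle and gives the external rates of the time at which it was submitted. 5. *(Stablecoin management is valid)* On the chain of an honest node: every management transaction for a stablecoin $c$ comes from a member of the committee of $c$ at that moment, and every vote is on an existing pending proposal on which its sender has not voted before; every recorded proposal was made by a transaction on the chain sent by its proposer, and if it has been executed, this was brought about by a transaction on the chain; whenever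 a proposal on $c$ is executed, at least as many members of the committee of that moment as the quorum size have approved it by voting transactions on the chain up to that point, and the administrative data and the balances in $c$ change as the action prescribes (apart from the transaction fee); a transaction that does not bring about the execution of a proposal on $c$ leaves the administrative data (whitelist, blacklist, committee size, quorum size, amount issued) of $c$ unchanged and, unless it is an EVM call, changes the balances in $c$ by at most the transaction fee of its sender. -/

import Mathlib

namespace MStableChain

/-! ## Ledger: accounts with one balance per native stablecoin -/

/-- Exchange rates: units of a stablecoin per unit of the reference currency. -/
abbrev Rate : Type := {q : ℚ // 0 < q}

/-- The management actions available for a native stablecoin. -/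
inductive Action (Addr : Type*) where
  | mint (recipient : Addr) (amount : ℕ)
  | burn (holder : Addr) (amount : ℕ)
  | whitelistAdd (a : Addr)
  | whitelistRemove (a : Addr)
  | blacklistAdd (a : Addr)
  | blacklistRemove (a : Addr)
  | setCommitteeSize (n : ℕ)
  | setQuorumSize (n : ℕ)

inductive ProposalStatus where
  | pending
  | executed
  | failed
  deriving DecidableEq

/-- A management proposal as recorded on the chain, with the votes cast so far. -/
structure Proposal (Addr : Type*) where
  proposer : Addr
  action : Action Addr
  approvals : Finset Addr
  rejections : Finset Addr
  status : ProposalStatus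

/-- The administrative data of one stablecoin. `whitelist` is the committee managing the coin,
`blacklist` the accounts barred from using it, and `issued` the net amount minted. -/
structure Admin (Addr : Type*) where
  whitelist : Finset Addr
  blacklist : Finset Addr
  committeeSize : ℕ
  quorumSize : ℕ
  issued : ℤ

/-- The part of the blockchain state that belongs to one stablecoin. `feePool` holds the
collected transaction fees, which belong to the blockchain nodes. -/
structure CoinState (Addr : Type*) where
  balance : Addr → ℕ
  admin : Admin Addr
  proposals : List (Proposal Addr)
  feePool : ℕ

/-- What a transaction does: an EVM call, an update of the exchange-rate contract by the oracle,
or one of the native management transactions (a proposal, or a vote on proposal number `idx`). -/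
inductive Payload (Addr Cur Call : Type*) where
  | evmCall (call : Call)
  | oracleUpdate (rates : Cur → Rate)
  | propose (coin : Cur) (action : Action Addr)
  | vote (coin : Cur) (idx : ℕ) (approve : Bool)

/-- A transaction as signed by the user. It carries the base fee quoted to the wallet, but no
currency unit. -/
structure SignedTx (Addr Cur Call : Type*) where
  sender : Addr
  nonce : ℕ
  baseFee : ℕ
  tip : ℕ
  gasLimit : ℕ
  payload : Payload Addr Cur Call

/-- A transaction as processed by the blockchain nodes: the signed transaction together with the
currency unit appended by the RPC node. -/
structure Tx (Addr Cur Call : Type*) where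
  body : SignedTx Addr Cur Call
  currency : Cur

/-- A block is a list of transactions. -/
abbrev Block (Addr Cur Call : Type*) := List (Tx Addr Cur Call)

/-- The blockchain state. `contractRates` is what the exchange-rate contract holds,
`storedRates` what the nodes last fetched from it. -/
structure ChainState (Addr Cur World : Type*) where
  height : ℕ
  world : World
  nonce : Addr → ℕ
  coins : Cur → CoinState Addr
  contractRates : Cur → Rate
  storedRates : Cur → Rate

/-- The parameters of a deployment. `evm` is the unmodified EVM: it is handed the world state, the
account nonces, the balances of a single token, the sender, the call and the gas limit, and returns
the new world state, the new balances of that token and the gas used. -/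
structure Params (Addr Cur World Call : Type*) where
  evm : World → (Addr → ℕ) → (Addr → ℕ) → Addr → Call → ℕ → World × (Addr → ℕ) × ℕ
  oracle : Addr
  /-- base fee in the reference currency -/
  refBaseFee : ℕ
  /-- gas used by a transaction that is not an EVM call -/
  nativeGas : ℕ
  /-- the nodes fetch the exchange rates every `syncPeriod` blocks -/
  syncPeriod : ℕ
  syncPeriod_pos : 0 < syncPeriod
  genesisWorld : World
  genesisRates : Cur → Rate
  genesisBalance : Cur → Addr → ℕ
  genesisAdmin : Cur → Admin Addr
  initPropose : ℝ
  initPropose_pos : 0 < initPropose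
  initPrevote : ℝ
  initPrevote_pos : 0 < initPrevote
  initPrecommit : ℝ
  initPrecommit_pos : 0 < initPrecommit
  timeoutDelta : ℝ
  timeoutDelta_pos : 0 < timeoutDelta

section Ledger

variable {Addr Cur World Call : Type*}

def genesis (P : Params Addr Cur World Call) : ChainState Addr Cur World where
  height := 0
  world := P.genesisWorld
  nonce := fun _ => 0
  coins := fun c =>
    { balance := P.genesisBalance c, admin := P.genesisAdmin c, proposals := [], feePool := 0 }
  contractRates := P.genesisRates
  storedRates := P.genesisRates

/-- The base fee prescribed at exchange rate `r`. -/
def baseFeeAt (P : Params Addr Cur World Call) (r : Rate) : ℕ :=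
  ⌈(P.refBaseFee : ℚ) * r.1⌉₊

/-- Base fee plus tip, per unit of gas. -/
def Tx.gasPrice (tx : Tx Addr Cur Call) : ℕ := tx.body.baseFee + tx.body.tip

/-- The real monetary value of the fee per unit of gas. -/
def feeValue (σ : ChainState Addr Cur World) (tx : Tx Addr Cur Call) : ℚ :=
  (tx.gasPrice : ℚ) / (σ.storedRates tx.currency).1

variable [DecidableEq Addr] [DecidableEq Cur]

/-- The effect of an action on the administrative data, `none` if it is not permissible. -/
def Action.applyAdmin (ad : Admin Addr) : Action Addr → Option (Admin Addr)
  | .mint _ n => some { ad with issued := ad.issued + n }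
  | .burn _ n => some { ad with issued := ad.issued - n }
  | .whitelistAdd a =>
      if (insert a ad.whitelist).card ≤ ad.committeeSize then
        some { ad with whitelist := insert a ad.whitelist }
      else none
  | .whitelistRemove a => some { ad with whitelist := ad.whitelist.erase a }
  | .blacklistAdd a => some { ad with blacklist := insert a ad.blacklist }
  | .blacklistRemove a => some { ad with blacklist := ad.blacklist.erase a }
  | .setCommitteeSize n =>
      if ad.whitelist.card ≤ n ∧ ad.quorumSize ≤ n then some { ad with committeeSize := n }
      else none
  | .setQuorumSize n =>
      if 1 ≤ n ∧ n ≤ ad.committeeSize then some { ad with quorumSize := n } else none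

/-- The effect of an action on the balances, `none` if more is burned than there is. -/
def Action.applyBalance (bal : Addr → ℕ) : Action Addr → Option (Addr → ℕ)
  | .mint a n => some (Function.update bal a (bal a + n))
  | .burn a n => if n ≤ bal a then some (Function.update bal a (bal a - n)) else none
  | _ => some bal

/-- Carry out an action. -/
def Action.apply (a : Action Addr) (cs : CoinState Addr) : Option (CoinState Addr) :=
  match a.applyAdmin cs.admin, a.applyBalance cs.balance with
  | some ad, some bal => some { cs with admin := ad, balance := bal }
  | _, _ => none

/-- A proposal transaction: only members of the committee may propose. -/
def CoinState.propose (cs : CoinState Addr) (sender : Addr) (a : Action Addr) :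
    Option (CoinState Addr) :=
  if sender ∈ cs.admin.whitelist then
    some { cs with proposals := cs.proposals ++
      [{ proposer := sender, action := a, approvals := ∅, rejections := ∅, status := .pending }] }
  else none

/-- A voting transaction: a committee member votes, at most once, on a pending proposal. When the
approvals by current committee members reach the quorum size, the action is carried out (the
proposal fails if the action is not permissible). -/
def CoinState.vote (cs : CoinState Addr) (sender : Addr) (idx : ℕ) (approve : Bool) :
    Option (CoinState Addr) :=
  match cs.proposals[idx]? with
  | none => none
  | some pr =>
    if sender ∈ cs.admin.whitelist ∧ pr.status = .pending ∧
        sender ∉ pr.approvals ∧ sender ∉ pr.rejections then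
      if approve = true then
        let pr' : Proposal Addr := { pr with approvals := insert sender pr.approvals }
        if cs.admin.quorumSize ≤ (pr'.approvals ∩ cs.admin.whitelist).card then
          match pr.action.apply cs with
          | some cs' =>
              some { cs' with proposals := cs.proposals.set idx { pr' with status := .executed } }
          | none => some { cs with proposals := cs.proposals.set idx { pr' with status := .failed } }
        else some { cs with proposals := cs.proposals.set idx pr' }
      else
        some { cs with proposals :=
          cs.proposals.set idx { pr with rejections := insert sender pr.rejections } }
    else none

/-- Execute the payload of a transaction; also returns the gas used. An EVM call sees, and can
change, only the balances of the stablecoin selected by the transaction. -/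
def runPayload (P : Params Addr Cur World Call) (tx : Tx Addr Cur Call)
    (σ : ChainState Addr Cur World) : Option (ChainState Addr Cur World × ℕ) :=
  match tx.body.payload with
  | .evmCall call =>
      let cs := σ.coins tx.currency
      let res := P.evm σ.world σ.nonce cs.balance tx.body.sender call tx.body.gasLimit
      some ({ σ with
        world := res.1
        coins := Function.update σ.coins tx.currency { cs with balance := res.2.1 } },
        min res.2.2 tx.body.gasLimit)
  | .oracleUpdate rates =>
      if tx.body.sender = P.oracle ∧ P.nativeGas ≤ tx.body.gasLimit then
        some ({ σ with contractRates := rates }, P.nativeGas)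
      else none
  | .propose coin a =>
      if P.nativeGas ≤ tx.body.gasLimit then
        ((σ.coins coin).propose tx.body.sender a).map fun cs =>
          ({ σ with coins := Function.update σ.coins coin cs }, P.nativeGas)
      else none
  | .vote coin idx approve =>
      if P.nativeGas ≤ tx.body.gasLimit then
        ((σ.coins coin).vote tx.body.sender idx approve).map fun cs =>
          ({ σ with coins := Function.update σ.coins coin cs }, P.nativeGas)
      else none

/-- Buy the gas limit in the currency of the transaction, and count the transaction. -/
def prepay (tx : Tx Addr Cur Call) (σ : ChainState Addr Cur World) : ChainState Addr Cur World :=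
  let cs := σ.coins tx.currency
  let a := tx.body.sender
  { σ with
    nonce := Function.update σ.nonce a (σ.nonce a + 1)
    coins := Function.update σ.coins tx.currency
      { cs with balance :=
          Function.update cs.balance a (cs.balance a - tx.gasPrice * tx.body.gasLimit) } }

/-- Refund the unused gas and credit the fee for the used gas to the blockchain nodes. -/
def settle (tx : Tx Addr Cur Call) (used : ℕ) (σ : ChainState Addr Cur World) :
    ChainState Addr Cur World :=
  let cs := σ.coins tx.currency
  let a := tx.body.sender
  { σ with
    coins := Function.update σ.coins tx.currency
      { cs with
        balance :=
          Function.update cs.balance a (cs.balance a + tx.gasPrice * (tx.body.gasLimit - used))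
        feePool := cs.feePool + tx.gasPrice * used } }

/-- Validate and execute a transaction; `none` if it is invalid. The check that the base fee
corresponds to the exchange rate of the currency unit is part of the validation. -/
def applyTx (P : Params Addr Cur World Call) (σ : ChainState Addr Cur World)
    (tx : Tx Addr Cur Call) : Option (ChainState Addr Cur World) :=
  if tx.body.nonce = σ.nonce tx.body.sender ∧
      tx.body.sender ∉ (σ.coins tx.currency).admin.blacklist ∧
      tx.body.baseFee = baseFeeAt P (σ.storedRates tx.currency) ∧
      tx.gasPrice * tx.body.gasLimit ≤ (σ.coins tx.currency).balance tx.body.sender then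
    (runPayload P tx (prepay tx σ)).map fun res => settle tx res.2 res.1
  else none

def applyTxs (P : Params Addr Cur World Call) (σ : ChainState Addr Cur World)
    (txs : List (Tx Addr Cur Call)) : Option (ChainState Addr Cur World) :=
  txs.foldlM (applyTx P) σ

/-- At the end of a block the height is increased; every `syncPeriod` blocks the nodes fetch the
exchange rates from the contract. -/
def endBlock (P : Params Addr Cur World Call) (σ : ChainState Addr Cur World) :
    ChainState Addr Cur World :=
  { σ with
    height := σ.height + 1
    storedRates := if (σ.height + 1) % P.syncPeriod = 0 then σ.contractRates else σ.storedRates }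

/-- Validate and execute a block; `none` if it contains an invalid transaction. -/
def execBlock (P : Params Addr Cur World Call) (σ : ChainState Addr Cur World)
    (b : Block Addr Cur Call) : Option (ChainState Addr Cur World) :=
  (applyTxs P σ b).map (endBlock P)

/-- Execute a chain of blocks from the genesis state. -/
def replay (P : Params Addr Cur World Call) (chain : List (Block Addr Cur Call)) :
    Option (ChainState Addr Cur World) :=
  chain.foldlM (execBlock P) (genesis P)

/-- The blocks an honest proposer may assemble from the transactions `pool` it has received:
valid ones in which each next transaction has the highest real fee value among the transactions
that are valid at that point. The block may stop at any point. -/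
inductive FeeOrdered (P : Params Addr Cur World Call) (pool : Set (Tx Addr Cur Call)) :
    ChainState Addr Cur World → List (Tx Addr Cur Call) → Prop
  | nil (σ : ChainState Addr Cur World) : FeeOrdered P pool σ []
  | cons (σ σ' : ChainState Addr Cur World) (tx : Tx Addr Cur Call)
      (rest : List (Tx Addr Cur Call)) (hpool : tx ∈ pool) (hvalid : applyTx P σ tx = some σ')
      (hmax : ∀ tx' ∈ pool, (applyTx P σ tx').isSome → feeValue σ tx' ≤ feeValue σ tx)
      (hrest : FeeOrdered P pool σ' rest) : FeeOrdered P pool σ (tx :: rest)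

end Ledger

/-! ## Consensus: the Tendermint protocol -/

/-- Contents of consensus messages; the first two arguments are height and round. Block
identifiers are the blocks themselves, and `none` stands for nil and for valid round `-1`. -/
inductive MsgBody (Addr Cur Call : Type*) where
  | proposal (h r : ℕ) (v : Block Addr Cur Call) (vr : Option ℕ)
  | prevote (h r : ℕ) (v : Option (Block Addr Cur Call))
  | precommit (h r : ℕ) (v : Option (Block Addr Cur Call))

/-- A message signed by node `sender`. -/
structure Msg (N : ℕ) (Addr Cur Call : Type*) where
  sender : Fin N
  body : MsgBody Addr Cur Call

def MsgBody.height {Addr Cur Call : Type*} : MsgBody Addr Cur Call → ℕ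
  | .proposal h _ _ _ => h
  | .prevote h _ _ => h
  | .precommit h _ _ => h

def MsgBody.round {Addr Cur Call : Type*} : MsgBody Addr Cur Call → ℕ
  | .proposal _ r _ _ => r
  | .prevote _ r _ => r
  | .precommit _ r _ => r

inductive Phase where
  | propose
  | prevote
  | precommit
  deriving DecidableEq

/-- A scheduled timeout of the given phase, for the given height and round. -/
structure Timer where
  phase : Phase
  height : ℕ
  round : ℕ
  deadline : ℝ

/-- The local state of a node. `decided` lists the decided blocks, so that its length is the
current height, and `ledger` is the state after executing them. `pool` holds the transactions
received from the RPC nodes and `inbox` the consensus messages received. `locked` and `lastValid`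
combine the locked (valid) round and value. The three flags record whether the corresponding
"for the first time" rules have been executed in the current round. -/
structure NodeState (N : ℕ) (Addr Cur World Call : Type*) where
  ledger : ChainState Addr Cur World
  decided : List (Block Addr Cur Call)
  pool : Set (Tx Addr Cur Call)
  inbox : Set (Msg N Addr Cur Call)
  round : ℕ
  phase : Phase
  locked : Option (ℕ × Block Addr Cur Call)
  lastValid : Option (ℕ × Block Addr Cur Call)
  timers : Set Timer
  prevoteTimerSet : Bool
  polkaSeen : Bool
  precommitTimerSet : Bool

section Consensus

variable {N : ℕ} {Addr Cur World Call : Type*}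

def NodeState.height (st : NodeState N Addr Cur World Call) : ℕ := st.decided.length

/-- Round-robin proposers (all stakes are equal). -/
def proposer (N : ℕ) [NeZero N] (h r : ℕ) : Fin N := Fin.ofNat N (h + r)

/-- More than two thirds of the nodes. -/
def IsQuorum (S : Set (Fin N)) : Prop := 2 * N < 3 * S.ncard

/-- More than one third of the nodes. -/
def IsThird (S : Set (Fin N)) : Prop := N < 3 * S.ncard

/-- The nodes from which a message with contents `b` has been received. -/
def NodeState.senders (st : NodeState N Addr Cur World Call) (b : MsgBody Addr Cur Call) :
    Set (Fin N) :=
  {q | (⟨q, b⟩ : Msg N Addr Cur Call) ∈ st.inbox}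

/-- The proposal of `v` for round `r` of the current height has been received from the proposer of
that round, and each of its transactions, in exactly this version, from the RPC nodes. -/
def NodeState.HasProposal [NeZero N] (st : NodeState N Addr Cur World Call) (r : ℕ)
    (v : Block Addr Cur Call) (vr : Option ℕ) : Prop :=
  (⟨proposer N st.height r, .proposal st.height r v vr⟩ : Msg N Addr Cur Call) ∈ st.inbox ∧
    ∀ tx ∈ v, tx ∈ st.pool

def Params.timeout (P : Params Addr Cur World Call) : Phase → ℕ → ℝ
  | .propose, r => P.initPropose + r * P.timeoutDelta
  | .prevote, r => P.initPrevote + r * P.timeoutDelta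
  | .precommit, r => P.initPrecommit + r * P.timeoutDelta

/-- Schedule the timeout of phase `ph` for the current height and round at time `t`. -/
def NodeState.schedule (P : Params Addr Cur World Call) (t : ℝ) (ph : Phase)
    (st : NodeState N Addr Cur World Call) : NodeState N Addr Cur World Call :=
  { st with timers := insert ⟨ph, st.height, st.round, t + P.timeout ph st.round⟩ st.timers }

/-- The timeout of phase `ph` for the current height and round has expired at time `t`. -/
def NodeState.Expired (t : ℝ) (ph : Phase) (st : NodeState N Addr Cur World Call) : Prop :=
  ∃ d ≤ t, (⟨ph, st.height, st.round, d⟩ : Timer) ∈ st.timers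

/-- Enter round `r` of the current height. -/
def NodeState.enterRound (r : ℕ) (st : NodeState N Addr Cur World Call) :
    NodeState N Addr Cur World Call :=
  { st with
    round := r
    phase := .propose
    prevoteTimerSet := false
    polkaSeen := false
    precommitTimerSet := false }

variable [DecidableEq Addr] [DecidableEq Cur]

/-- The block `v` is valid on top of the decided chain. -/
def NodeState.Valid (P : Params Addr Cur World Call) (st : NodeState N Addr Cur World Call)
    (v : Block Addr Cur Call) : Prop :=
  ∃ σ, execBlock P st.ledger v = some σ

/-- `StartRound P p t st r st' out`: by executing the function `StartRound(r)` at time `t`, node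
`p` passes from `st` to `st'` and broadcasts the messages `out`. -/
inductive StartRound [NeZero N] (P : Params Addr Cur World Call) (p : Fin N) (t : ℝ)
    (st : NodeState N Addr Cur World Call) (r : ℕ) :
    NodeState N Addr Cur World Call → Set (Msg N Addr Cur Call) → Prop
  | proposeValid (k : ℕ) (v : Block Addr Cur Call) (hp : proposer N st.height r = p)
      (hv : st.lastValid = some (k, v)) :
      StartRound P p t st r (st.enterRound r) {⟨p, .proposal st.height r v (some k)⟩}
  | proposeNew (v : Block Addr Cur Call) (hp : proposer N st.height r = p)
      (hv : st.lastValid = none) (hnew : FeeOrdered P st.pool st.ledger v) :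
      StartRound P p t st r (st.enterRound r) {⟨p, .proposal st.height r v none⟩}
  | follow (hp : proposer N st.height r ≠ p) :
      StartRound P p t st r ((st.enterRound r).schedule P t .propose) ∅

/-- Vote for `v` if `ok` holds, and for nil otherwise. -/
def VoteIf (ok : Prop) (v : Block Addr Cur Call) (vote : Option (Block Addr Cur Call)) : Prop :=
  (ok ∧ vote = some v) ∨ (¬ ok ∧ vote = none)

/-- `Rule P p t st st' out`: the rules of the Tendermint protocol. At time `t` node `p` can pass
from `st` to `st'` while broadcasting the messages `out`. -/
inductive Rule [NeZero N] (P : Params Addr Cur World Call) (p : Fin N) (t : ℝ)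
    (st : NodeState N Addr Cur World Call) :
    NodeState N Addr Cur World Call → Set (Msg N Addr Cur Call) → Prop
  /-- a fresh proposal -/
  | prevoteNew (v : Block Addr Cur Call) (vote : Option (Block Addr Cur Call))
      (hphase : st.phase = .propose) (hprop : st.HasProposal st.round v none)
      (hvote : VoteIf (st.Valid P v ∧ ∀ k b, st.locked = some (k, b) → b = v) v vote) :
      Rule P p t st { st with phase := .prevote } {⟨p, .prevote st.height st.round vote⟩}
  /-- a proposal of a block that gathered a quorum of prevotes in an earlier round `vr` -/
  | prevoteOld (v : Block Addr Cur Call) (vr : ℕ) (vote : Option (Block Addr Cur Call))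
      (hphase : st.phase = .propose) (hprop : st.HasProposal st.round v (some vr))
      (hvr : vr < st.round) (hpolka : IsQuorum (st.senders (.prevote st.height vr (some v))))
      (hvote : VoteIf (st.Valid P v ∧ ∀ k b, st.locked = some (k, b) → k ≤ vr ∨ b = v) v vote) :
      Rule P p t st { st with phase := .prevote } {⟨p, .prevote st.height st.round vote⟩}
  /-- a quorum of arbitrary prevotes -/
  | prevoteWait (hphase : st.phase = .prevote) (hfirst : st.prevoteTimerSet = false)
      (hquorum : IsQuorum {q | ∃ x, q ∈ st.senders (.prevote st.height st.round x)}) :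
      Rule P p t st { st.schedule P t .prevote with prevoteTimerSet := true } ∅
  /-- a quorum of prevotes for the proposal, in the phase `prevote`: lock and precommit -/
  | lock (v : Block Addr Cur Call) (vr : Option ℕ) (hphase : st.phase = .prevote)
      (hfirst : st.polkaSeen = false) (hprop : st.HasProposal st.round v vr)
      (hpolka : IsQuorum (st.senders (.prevote st.height st.round (some v))))
      (hvalid : st.Valid P v) :
      Rule P p t st
        { st with
          locked := some (st.round, v)
          lastValid := some (st.round, v)
          phase := .precommit
          polkaSeen := true }
        {⟨p, .precommit st.height st.round (some v)⟩}
  /-- a quorum of prevotes for the proposal, in the phase `precommit` -/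
  | markValid (v : Block Addr Cur Call) (vr : Option ℕ) (hphase : st.phase = .precommit)
      (hfirst : st.polkaSeen = false) (hprop : st.HasProposal st.round v vr)
      (hpolka : IsQuorum (st.senders (.prevote st.height st.round (some v))))
      (hvalid : st.Valid P v) :
      Rule P p t st { st with lastValid := some (st.round, v), polkaSeen := true } ∅
  /-- a quorum of prevotes for nil -/
  | precommitNil (hphase : st.phase = .prevote)
      (hquorum : IsQuorum (st.senders (.prevote st.height st.round none))) :
      Rule P p t st { st with phase := .precommit } {⟨p, .precommit st.height st.round none⟩}
  /-- a quorum of arbitrary precommits -/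
  | precommitWait (hfirst : st.precommitTimerSet = false)
      (hquorum : IsQuorum {q | ∃ x, q ∈ st.senders (.precommit st.height st.round x)}) :
      Rule P p t st { st.schedule P t .precommit with precommitTimerSet := true } ∅
  /-- a quorum of precommits for a proposal of any round: decide and start the next height -/
  | decide (r : ℕ) (v : Block Addr Cur Call) (vr : Option ℕ) (σ : ChainState Addr Cur World)
      (st' : NodeState N Addr Cur World Call) (out : Set (Msg N Addr Cur Call))
      (hprop : st.HasProposal r v vr)
      (hquorum : IsQuorum (st.senders (.precommit st.height r (some v))))
      (hvalid : execBlock P st.ledger v = some σ)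
      (hstart : StartRound P p t
        { st with ledger := σ, decided := st.decided ++ [v], locked := none, lastValid := none }
        0 st' out) :
      Rule P p t st st' out
  /-- messages of a later round from more than one third of the nodes -/
  | skip (r : ℕ) (st' : NodeState N Addr Cur World Call) (out : Set (Msg N Addr Cur Call))
      (hr : st.round < r)
      (hthird : IsThird {q | ∃ b, q ∈ st.senders b ∧ b.height = st.height ∧ b.round = r})
      (hstart : StartRound P p t st r st' out) :
      Rule P p t st st' out
  | timeoutPropose (hphase : st.phase = .propose) (htimer : st.Expired t .propose) :
      Rule P p t st { st with phase := .prevote } {⟨p, .prevote st.height st.round none⟩}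
  | timeoutPrevote (hphase : st.phase = .prevote) (htimer : st.Expired t .prevote) :
      Rule P p t st { st with phase := .precommit } {⟨p, .precommit st.height st.round none⟩}
  | timeoutPrecommit (st' : NodeState N Addr Cur World Call) (out : Set (Msg N Addr Cur Call))
      (htimer : st.Expired t .precommit)
      (hstart : StartRound P p t st (st.round + 1) st' out) :
      Rule P p t st st' out

/-- The state of a node before it starts the protocol. -/
def blank (P : Params Addr Cur World Call) : NodeState N Addr Cur World Call where
  ledger := genesis P
  decided := []
  pool := ∅
  inbox := ∅
  round := 0
  phase := .propose
  locked := none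
  lastValid := none
  timers := ∅
  prevoteTimerSet := false
  polkaSeen := false
  precommitTimerSet := false

end Consensus

/-! ## Executions of the whole system -/

/-- A global configuration: the states of the nodes (those of malicious nodes play no role), the
messages broadcast so far by honest nodes, and the transactions broadcast so far by RPC nodes. -/
structure Config (N : ℕ) (Addr Cur World Call : Type*) where
  node : Fin N → NodeState N Addr Cur World Call
  sent : Set (Msg N Addr Cur Call)
  rpcLog : Set (Tx Addr Cur Call)

/-- Replace the state of node `p`. -/
def Config.setNode {N : ℕ} {Addr Cur World Call : Type*} (cfg : Config N Addr Cur World Call)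
    (p : Fin N) (st : NodeState N Addr Cur World Call) : Config N Addr Cur World Call :=
  { cfg with node := Function.update cfg.node p st }

/-- Events: the owner of an account signs `s` and submits it to the RPC of currency `c`; a node
receives a consensus message, or a transaction from an RPC node; an honest node executes a rule of
the protocol; nothing happens. -/
inductive Event (N : ℕ) (Addr Cur Call : Type*) where
  | submit (s : SignedTx Addr Cur Call) (c : Cur)
  | deliver (p : Fin N) (m : Msg N Addr Cur Call)
  | deliverTx (p : Fin N) (tx : Tx Addr Cur Call)
  | act (p : Fin N)
  | wait

section Execution

variable {N : ℕ} [NeZero N] {Addr Cur World Call : Type*} [DecidableEq Addr] [DecidableEq Cur]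

/-- `Step P byz ext t cfg e cfg'`: the event `e` can occur at time `t` and changes `cfg` to `cfg'`.
Nodes in `byz` are malicious: a message signed by one of them may be received by any node at any
time, while messages of honest nodes cannot be forged. RPC nodes are honest: they broadcast exactly
the submitted transactions, with their own currency unit appended. The oracle is honest: the rates
it submits are the external rates `ext t` of that moment. -/
inductive Step (P : Params Addr Cur World Call) (byz : Finset (Fin N)) (ext : ℝ → Cur → Rate)
    (t : ℝ) (cfg : Config N Addr Cur World Call) :
    Event N Addr Cur Call → Config N Addr Cur World Call → Prop
  | submit (s : SignedTx Addr Cur Call) (c : Cur)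
      (horacle : ∀ rates, s.sender = P.oracle → s.payload = .oracleUpdate rates → rates = ext t) :
      Step P byz ext t cfg (.submit s c) { cfg with rpcLog := insert ⟨s, c⟩ cfg.rpcLog }
  | deliver (p : Fin N) (m : Msg N Addr Cur Call) (hp : p ∉ byz)
      (hm : m.sender ∈ byz ∨ m ∈ cfg.sent) :
      Step P byz ext t cfg (.deliver p m)
        (cfg.setNode p { cfg.node p with inbox := insert m (cfg.node p).inbox })
  | deliverTx (p : Fin N) (tx : Tx Addr Cur Call) (hp : p ∉ byz) (htx : tx ∈ cfg.rpcLog) :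
      Step P byz ext t cfg (.deliverTx p tx)
        (cfg.setNode p { cfg.node p with pool := insert tx (cfg.node p).pool })
  | act (p : Fin N) (st' : NodeState N Addr Cur World Call) (out : Set (Msg N Addr Cur Call))
      (hp : p ∉ byz) (hrule : Rule P p t (cfg.node p) st' out) :
      Step P byz ext t cfg (.act p)
        { cfg.setNode p st' with sent := cfg.sent ∪ out }
  | wait : Step P byz ext t cfg .wait cfg

/-- A timed execution with malicious nodes `byz`, over a partially synchronous network. Event number
`i` takes place at time `time i` and leads from `cfg i` to `cfg (i + 1)`. -/
structure Execution (P : Params Addr Cur World Call) (byz : Finset (Fin N)) where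
  time : ℕ → ℝ
  cfg : ℕ → Config N Addr Cur World Call
  event : ℕ → Event N Addr Cur Call
  /-- the global stabilization time -/
  gst : ℝ
  /-- the bound on the message delay after the global stabilization time -/
  delay : ℝ
  /-- the external exchange rates as functions of time -/
  externalRates : ℝ → Cur → Rate
  delay_pos : 0 < delay
  time_mono : Monotone time
  time_unbounded : Filter.Tendsto time Filter.atTop Filter.atTop
  /-- initially, every honest node has just started round `0` of height `0` -/
  init : ∃ out : Fin N → Set (Msg N Addr Cur Call),
    (∀ p ∉ byz, StartRound P p (time 0) (blank P) 0 ((cfg 0).node p) (out p)) ∧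
    (cfg 0).sent = {m | ∃ p ∉ byz, m ∈ out p} ∧ (cfg 0).rpcLog = ∅
  step : ∀ i, Step P byz externalRates (time i) (cfg i) (event i) (cfg (i + 1))
  /-- honest nodes execute enabled rules without delay -/
  prompt : ∀ i, ∀ p ∉ byz, ∀ t, time i ≤ t → t < time (i + 1) →
    ¬ ∃ st' out, Rule P p t ((cfg (i + 1)).node p) st' out
  /-- what an honest node sends reaches all honest nodes -/
  sent_delivered : ∀ i j m, m ∈ (cfg (i + 1)).sent → max (time i) gst + delay ≤ time j →
    ∀ q ∉ byz, m ∈ ((cfg j).node q).inbox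
  /-- what an honest node receives is relayed and reaches all honest nodes -/
  relayed : ∀ i j m, ∀ p ∉ byz, m ∈ ((cfg (i + 1)).node p).inbox →
    max (time i) gst + delay ≤ time j → ∀ q ∉ byz, m ∈ ((cfg j).node q).inbox
  /-- what an RPC node broadcasts reaches all honest nodes -/
  tx_delivered : ∀ i j tx, tx ∈ (cfg (i + 1)).rpcLog → max (time i) gst + delay ≤ time j →
    ∀ q ∉ byz, tx ∈ ((cfg j).node q).pool

namespace Execution

variable {P : Params Addr Cur World Call} {byz : Finset (Fin N)}

/-- The chain decided by node `p` before event number `i`. -/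
def chain (ex : Execution P byz) (i : ℕ) (p : Fin N) : List (Block Addr Cur Call) :=
  ((ex.cfg i).node p).decided

/-- The blockchain state maintained by node `p` before event number `i`. -/
def ledger (ex : Execution P byz) (i : ℕ) (p : Fin N) : ChainState Addr Cur World :=
  ((ex.cfg i).node p).ledger

end Execution

/-! ## Security -/

/-- `ExecutedAt P chain n prior σ tx σ'`: block number `n` of `chain` contains the transaction
`tx`, which is executed on `σ` with result `σ'`, after the transactions `prior`. -/
def ExecutedAt (P : Params Addr Cur World Call) (chain : List (Block Addr Cur Call)) (n : ℕ)
    (prior : List (Tx Addr Cur Call)) (σ : ChainState Addr Cur World) (tx : Tx Addr Cur Call)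
    (σ' : ChainState Addr Cur World) : Prop :=
  ∃ (pre post : List (Block Addr Cur Call)) (b₁ b₂ : List (Tx Addr Cur Call))
    (σ₀ : ChainState Addr Cur World),
    chain = pre ++ (b₁ ++ tx :: b₂) :: post ∧ pre.length = n ∧ prior = pre.flatten ++ b₁ ∧
    replay P pre = some σ₀ ∧ applyTxs P σ₀ b₁ = some σ ∧ applyTx P σ tx = some σ'

/-- The rates most recently reported by the oracle within a list of transactions. -/
def reportedRates (r₀ : Cur → Rate) (txs : List (Tx Addr Cur Call)) : Cur → Rate :=
  txs.foldl (fun r tx => match tx.body.payload with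
    | .oracleUpdate r' => r'
    | _ => r) r₀

/-- The transaction concerns the management of the stablecoin `c`. -/
def Tx.Manages (tx : Tx Addr Cur Call) (c : Cur) : Prop :=
  (∃ a, tx.body.payload = .propose c a) ∨ ∃ k b, tx.body.payload = .vote c k b

/-- The transaction `tx`, leading from `σ` to `σ'`, brings about the execution of the pending
proposal `pr`, number `k` of the stablecoin `c`. -/
def Executes (σ σ' : ChainState Addr Cur World) (tx : Tx Addr Cur Call) (c : Cur) (k : ℕ)
    (pr : Proposal Addr) : Prop :=
  tx.body.payload = .vote c k true ∧ (σ.coins c).proposals[k]? = some pr ∧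
    pr.status = .pending ∧
    ∃ pr', (σ'.coins c).proposals[k]? = some pr' ∧ pr'.status = .executed

/-- The change of the balance of `x` prescribed by an action. -/
def Action.balanceChange (x : Addr) : Action Addr → ℤ
  | .mint a n => if x = a then n else 0
  | .burn a n => if x = a then -n else 0
  | _ => 0

/-- The fee in stablecoin `c` that account `x` owes for the transaction `tx` if `gas` is used. -/
def feeDue (tx : Tx Addr Cur Call) (gas : ℕ) (c : Cur) (x : Addr) : ℤ :=
  if c = tx.currency ∧ x = tx.body.sender then ((tx.gasPrice * gas : ℕ) : ℤ) else 0

namespace Execution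

variable {P : Params Addr Cur World Call} {byz : Finset (Fin N)}

/-- Consensus safety: honest nodes never decide different blocks at the same height, never revoke a
decision, and decide only valid chains, whose execution yields the state they maintain. -/
def Safety (ex : Execution P byz) : Prop :=
  (∀ i j, ∀ p ∉ byz, ∀ q ∉ byz,
    ex.chain i p <+: ex.chain j q ∨ ex.chain j q <+: ex.chain i p) ∧
  (∀ i j, i ≤ j → ∀ p ∉ byz, ex.chain i p <+: ex.chain j p) ∧
  (∀ i, ∀ p ∉ byz, replay P (ex.chain i p) = some (ex.ledger i p))

/-- Consensus liveness: every honest node eventually decides a block at every height. -/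
def Liveness (ex : Execution P byz) : Prop :=
  ∀ p ∉ byz, ∀ h, ∃ i, h < (ex.chain i p).length

/-- Tampering with transactions is rejected: a transaction on the chain of an honest node was
submitted in exactly this form, by the owner of the sending account, to the RPC of exactly this
currency unit; and honest nodes do not vote for blocks with other transactions. -/
def TransactionsAuthentic (ex : Execution P byz) : Prop :=
  (∀ i, ∀ p ∉ byz, ∀ tx ∈ (ex.chain i p).flatten,
    ∃ k < i, ex.event k = .submit tx.body tx.currency) ∧
  (∀ i, ∀ m ∈ (ex.cfg i).sent, ∀ h r v,
    m.body = .prevote h r (some v) ∨ m.body = .precommit h r (some v) →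
    ∀ tx ∈ v, ∃ k < i, ex.event k = .submit tx.body tx.currency)

/-- The fee of an accepted transaction is paid to the nodes in the currency unit of the transaction,
and a stablecoin that is neither this currency nor managed by the transaction is not affected. -/
def SettledInCurrency (ex : Execution P byz) : Prop :=
  ∀ i, ∀ p ∉ byz, ∀ n prior σ tx σ', ExecutedAt P (ex.chain i p) n prior σ tx σ' →
    (∃ gas ≤ tx.body.gasLimit, ∀ c, (σ'.coins c).feePool =
      (σ.coins c).feePool + if c = tx.currency then tx.gasPrice * gas else 0) ∧
    ∀ c, c ≠ tx.currency → ¬ tx.Manages c → σ'.coins c = σ.coins c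

/-- Tampering with base fees is rejected: the base fee of an accepted transaction is the one
prescribed by the exchange rate, for its currency unit, that the oracle had reported on the chain
at the last synchronization; and all reports on the chain come from the oracle and give the
external rates of the time of their submission. -/
def BaseFeesCorrect (ex : Execution P byz) : Prop :=
  ∀ i, ∀ p ∉ byz,
    (∀ n prior σ tx σ', ExecutedAt P (ex.chain i p) n prior σ tx σ' →
      tx.body.baseFee = baseFeeAt P (reportedRates P.genesisRates
        ((ex.chain i p).take (n / P.syncPeriod * P.syncPeriod)).flatten tx.currency)) ∧
    ∀ tx ∈ (ex.chain i p).flatten, ∀ rates, tx.body.payload = .oracleUpdate rates →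
      tx.body.sender = P.oracle ∧
      ∃ k < i, ex.event k = .submit tx.body tx.currency ∧ rates = ex.externalRates (ex.time k)

/-- Stablecoin management is valid.
(1) Accepted management transactions come from members of the committee of the stablecoin, and
votes are cast on pending proposals by members who have not voted on them.
(2) A recorded proposal was made by an accepted transaction of its proposer; if it has been
executed, then by an accepted transaction that brought about its execution.
(3) Whenever a proposal is executed, a quorum of the committee of that moment has approved it by
accepted transactions, and its action is what happens.
(4) Otherwise the administrative data remain unchanged, and so do the balances, up to EVM calls
in that stablecoin and the transaction fee. -/
def ManagementValid (ex : Execution P byz) : Prop :=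
  ∀ i, ∀ p ∉ byz,
    (∀ n prior σ tx σ', ExecutedAt P (ex.chain i p) n prior σ tx σ' → ∀ c,
      (tx.Manages c → tx.body.sender ∈ (σ.coins c).admin.whitelist) ∧
      (∀ k b, tx.body.payload = .vote c k b → ∃ pr, (σ.coins c).proposals[k]? = some pr ∧
        pr.status = .pending ∧ tx.body.sender ∉ pr.approvals ∪ pr.rejections) ∧
      (∀ k pr, Executes σ σ' tx c k pr →
        (∃ S ⊆ (σ.coins c).admin.whitelist, (σ.coins c).admin.quorumSize ≤ S.card ∧
          ∀ a ∈ S, ∃ tx' ∈ prior ++ [tx], tx'.body.sender = a ∧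
            tx'.body.payload = .vote c k true) ∧
        pr.action.applyAdmin (σ.coins c).admin = some (σ'.coins c).admin ∧
        ∀ x, ((σ'.coins c).balance x : ℤ) = (σ.coins c).balance x
          - feeDue tx P.nativeGas c x + pr.action.balanceChange x) ∧
      ((¬ ∃ k pr, Executes σ σ' tx c k pr) →
        (σ'.coins c).admin = (σ.coins c).admin ∧
        ((∀ call, tx.body.payload ≠ .evmCall call) →
          ∀ x, ((σ'.coins c).balance x : ℤ) =
            (σ.coins c).balance x - feeDue tx P.nativeGas c x))) ∧
    ∀ c k pr, ((ex.ledger i p).coins c).proposals[k]? = some pr →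
      (∃ n prior σ tx σ', ExecutedAt P (ex.chain i p) n prior σ tx σ' ∧
        tx.body.sender = pr.proposer ∧ tx.body.payload = .propose c pr.action ∧
        (σ.coins c).proposals.length = k) ∧
      (pr.status = .executed → ∃ n prior σ tx σ' pr₀,
        ExecutedAt P (ex.chain i p) n prior σ tx σ' ∧ Executes σ σ' tx c k pr₀ ∧
        pr₀.action = pr.action)

end Execution

end Execution

end MStableChain

namespace MStableChain

/-! ### Ledger: what single transactions and whole chains do to the state -/

section LedgerFacts

variable {Addr Cur World Call : Type*}

/-! The theorem splits into a statement about the ledger, which involves no consensus, and the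
safety and liveness of Tendermint.

Ledger. A transaction runs in three stages, `prepay`, `runPayload` and `settle`, and a case
distinction on the payload shows which coins, fee pools, proposals and rates each stage can touch
(`applyTx_settled`, `applyTx_management`, `applyTx_proposals`). `replay_induction` carries such
facts along a chain. This gives the rate governing each block, the transactions behind every
approval, and the origin of every proposal. Authenticity comes from the pools: a node acts on a
block only if all its transactions are in its pool, and pools are fed only by the logs of the RPC
nodes.

Safety. Two sets of more than `2N/3` nodes share more than `N/3`, hence an honest node. Honest nodes
prevote once per round, so two quorums of prevotes of one round agree. A precommit for a block locks
its sender, and a locked node prevotes another block only on evidence of a quorum of prevotes for it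
in a round no older than the lock. By strong induction on the round, a quorum of precommits for `v`
thus prevents any other block from gathering a quorum of prevotes in that round or later
(`prevote_quorum_of_precommit_quorum`). Decisions agree, and so do the ledgers computed from them.

Liveness. Suppose some honest node stops deciding. Since evidence for a decision is relayed, all
honest nodes are eventually at one height `H` forever (`exists_stuck`). The timeouts still drive
them through infinitely many rounds (`Stuck.exists_entered`). The first honest node enters round `r
+ 1` only after its precommit timeout, which a quorum of precommits in round `r` started
(`first_entry`); once this quorum has spread, everybody follows within one delay. As timeouts grow,
honest nodes spend a long common period in every late round. If such a round has an honest proposer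
whose valid block is at least as recent as every honest lock, all prevote, precommit and decide its
block, a contradiction (`Stuck.false_of_good_round`).

It remains to find such a round. A lock acquired in a late round makes every honest node record a
valid block of that round or a later one before entering a later round (`Stuck.lastValid_of_lock`),
so that afterwards any honest proposer is suitable. If no lock is ever acquired in a late round, the
rounds of locks are bounded, and the holder of a most recent lock is a suitable proposer. The
rotation of proposers returns to every node. -/

theorem reportedRates_append_singleton (r₀ : Cur → Rate) (l : List (Tx Addr Cur Call))
    (tx : Tx Addr Cur Call) :
    reportedRates r₀ (l ++ [tx]) = (match tx.body.payload with
      | .oracleUpdate r => r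
      | _ => reportedRates r₀ l) := by
  obtain ⟨⟨_, _, _, _, _, payload⟩, _⟩ := tx
  cases payload <;> simp [reportedRates]

variable [DecidableEq Addr] [DecidableEq Cur] {P : Params Addr Cur World Call}

/-! ## Effects of a single transaction -/

/-- The effect of a transaction on the coins, before its fee is settled. -/
theorem applyTx_spec {σ σ' : ChainState Addr Cur World} {tx : Tx Addr Cur Call}
    (h : applyTx P σ tx = some σ') :
    tx.body.sender ∉ (σ.coins tx.currency).admin.blacklist ∧
    tx.body.baseFee = baseFeeAt P (σ.storedRates tx.currency) ∧
    tx.gasPrice * tx.body.gasLimit ≤ (σ.coins tx.currency).balance tx.body.sender ∧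
    ∃ (σ₁ : ChainState Addr Cur World) (used : ℕ),
      runPayload P tx (prepay tx σ) = some (σ₁, used) ∧ σ' = settle tx used σ₁ := by
  unfold applyTx at h
  split_ifs at h with hc
  obtain ⟨_, h2, h3, h4⟩ := hc
  obtain ⟨⟨σ₁, used⟩, hr, rfl⟩ := Option.map_eq_some_iff.1 h
  exact ⟨h2, h3, h4, σ₁, used, hr, rfl⟩

theorem prepay_coins (tx : Tx Addr Cur Call) (σ : ChainState Addr Cur World) (c : Cur) :
    ((prepay tx σ).coins c).admin = (σ.coins c).admin ∧
    ((prepay tx σ).coins c).proposals = (σ.coins c).proposals ∧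
    ((prepay tx σ).coins c).feePool = (σ.coins c).feePool ∧
    ∀ x, ((prepay tx σ).coins c).balance x = if c = tx.currency ∧ x = tx.body.sender then
      (σ.coins c).balance x - tx.gasPrice * tx.body.gasLimit else (σ.coins c).balance x := by
  by_cases hc : c = tx.currency
  · subst hc
    refine ⟨by simp [prepay], by simp [prepay], by simp [prepay], fun x => ?_⟩
    by_cases hx : x = tx.body.sender
    · subst hx; simp [prepay]
    · simp [prepay, hx]
  · simp [prepay, hc]

theorem prepay_coins_of_ne {tx : Tx Addr Cur Call} {σ : ChainState Addr Cur World} {c : Cur}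
    (hc : c ≠ tx.currency) : (prepay tx σ).coins c = σ.coins c := by
  simp [prepay, hc]

theorem settle_coins (tx : Tx Addr Cur Call) (used : ℕ) (σ : ChainState Addr Cur World) (c : Cur) :
    ((settle tx used σ).coins c).admin = (σ.coins c).admin ∧
    ((settle tx used σ).coins c).proposals = (σ.coins c).proposals ∧
    ((settle tx used σ).coins c).feePool =
      (σ.coins c).feePool + (if c = tx.currency then tx.gasPrice * used else 0) ∧
    ∀ x, ((settle tx used σ).coins c).balance x = if c = tx.currency ∧ x = tx.body.sender then
      (σ.coins c).balance x + tx.gasPrice * (tx.body.gasLimit - used)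
      else (σ.coins c).balance x := by
  by_cases hc : c = tx.currency
  · subst hc
    refine ⟨by simp [settle], by simp [settle], by simp [settle], fun x => ?_⟩
    by_cases hx : x = tx.body.sender
    · subst hx; simp [settle]
    · simp [settle, hx]
  · simp [settle, hc]

theorem settle_coins_of_ne {tx : Tx Addr Cur Call} {used : ℕ} {σ : ChainState Addr Cur World}
    {c : Cur} (hc : c ≠ tx.currency) : (settle tx used σ).coins c = σ.coins c := by
  simp [settle, hc]

/-- A proposal transaction only appends a pending proposal. -/
theorem CoinState.propose_spec {cs cs' : CoinState Addr} {s : Addr} {a : Action Addr}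
    (h : cs.propose s a = some cs') :
    s ∈ cs.admin.whitelist ∧ cs' = { cs with proposals := cs.proposals ++
      [{ proposer := s, action := a, approvals := ∅, rejections := ∅, status := .pending }] } := by
  unfold CoinState.propose at h
  split_ifs at h with hs
  exact ⟨hs, (Option.some.inj h).symm⟩

theorem Action.apply_spec {a : Action Addr} {cs cs' : CoinState Addr} (h : a.apply cs = some cs') :
    a.applyAdmin cs.admin = some cs'.admin ∧ a.applyBalance cs.balance = some cs'.balance ∧
      cs'.feePool = cs.feePool := by
  unfold Action.apply at h
  split at h
  · next ad bal h1 h2 =>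
    obtain rfl := (Option.some.inj h).symm
    exact ⟨h1, h2, rfl⟩
  · cases h

/-- A vote updates the proposal voted on, and either carries it out, or changes nothing else. -/
theorem CoinState.vote_spec {cs cs' : CoinState Addr} {s : Addr} {k : ℕ} {b : Bool}
    (h : cs.vote s k b = some cs') :
    ∃ pr pr' : Proposal Addr, cs.proposals[k]? = some pr ∧ s ∈ cs.admin.whitelist ∧
      pr.status = .pending ∧ s ∉ pr.approvals ∧ s ∉ pr.rejections ∧
      cs'.proposals = cs.proposals.set k pr' ∧ cs'.feePool = cs.feePool ∧
      pr'.proposer = pr.proposer ∧ pr'.action = pr.action ∧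
      (∀ a ∈ pr'.approvals, a ∈ pr.approvals ∨ a = s ∧ b = true) ∧
      ((b = true ∧ pr'.status = .executed ∧
          cs.admin.quorumSize ≤ (insert s pr.approvals ∩ cs.admin.whitelist).card ∧
          pr.action.applyAdmin cs.admin = some cs'.admin ∧
          pr.action.applyBalance cs.balance = some cs'.balance) ∨
        (pr'.status ≠ .executed ∧ cs'.admin = cs.admin ∧ cs'.balance = cs.balance)) := by
  unfold CoinState.vote at h
  split at h
  · cases h
  next pr hpr =>
  split_ifs at h with h1 hb
  · obtain ⟨hs, hst, ha, hr⟩ := h1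
    simp only at h
    split_ifs at h with hq
    · split at h
      · next cs1 hcs1 =>
        obtain ⟨e1, e2, e3⟩ := Action.apply_spec hcs1
        obtain rfl := (Option.some.inj h).symm
        refine ⟨pr, { pr with approvals := insert s pr.approvals, status := .executed },
          hpr, hs, hst, ha, hr, rfl, e3, rfl, rfl, ?_, Or.inl ⟨hb, rfl, hq, e1, e2⟩⟩
        intro a h
        rcases Finset.mem_insert.1 h with h | h
        · exact Or.inr ⟨h, hb⟩
        · exact Or.inl h
      · obtain rfl := (Option.some.inj h).symm
        refine ⟨pr, { pr with approvals := insert s pr.approvals, status := .failed },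
          hpr, hs, hst, ha, hr, rfl, rfl, rfl, rfl, ?_, Or.inr ⟨by simp, rfl, rfl⟩⟩
        intro a h
        rcases Finset.mem_insert.1 h with h | h
        · exact Or.inr ⟨h, hb⟩
        · exact Or.inl h
    · obtain rfl := (Option.some.inj h).symm
      refine ⟨pr, { pr with approvals := insert s pr.approvals },
        hpr, hs, hst, ha, hr, rfl, rfl, rfl, rfl, ?_, Or.inr ⟨by simp [hst], rfl, rfl⟩⟩
      intro a h
      rcases Finset.mem_insert.1 h with h | h
      · exact Or.inr ⟨h, hb⟩
      · exact Or.inl h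
  · obtain ⟨hs, hst, ha, hr⟩ := h1
    obtain rfl := (Option.some.inj h).symm
    exact ⟨pr, { pr with rejections := insert s pr.rejections },
      hpr, hs, hst, ha, hr, rfl, rfl, rfl, rfl, fun a h => Or.inl h,
      Or.inr ⟨by simp [hst], rfl, rfl⟩⟩

/-- The guard of `burn` makes the truncated subtraction exact, so the change can be stated over the
integers. -/
theorem Action.applyBalance_spec {a : Action Addr} {bal bal' : Addr → ℕ}
    (h : a.applyBalance bal = some bal') (x : Addr) :
    (bal' x : ℤ) = bal x + a.balanceChange x := by
  cases a with
  | mint r n =>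
    obtain rfl := (Option.some.inj h).symm
    by_cases hx : x = r
    · subst hx; simp [balanceChange]
    · simp [balanceChange, hx]
  | burn r n =>
    simp only [applyBalance] at h
    split_ifs at h with hn
    obtain rfl := (Option.some.inj h).symm
    by_cases hx : x = r
    · subst hx; simp [balanceChange]; omega
    · simp [balanceChange, hx]
  | _ =>
    obtain rfl := (Option.some.inj h).symm
    simp [balanceChange]

/-- The payload's effect on the coins, given by cases on the payload. -/
theorem runPayload_spec {σ σ₁ : ChainState Addr Cur World} {tx : Tx Addr Cur Call} {used : ℕ}
    (h : runPayload P tx σ = some (σ₁, used)) :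
    used ≤ tx.body.gasLimit ∧ σ₁.storedRates = σ.storedRates ∧ σ₁.height = σ.height ∧
    (((∃ call, tx.body.payload = .evmCall call) ∧ σ₁.contractRates = σ.contractRates ∧
        ∃ bal, σ₁.coins = Function.update σ.coins tx.currency
          { σ.coins tx.currency with balance := bal }) ∨
      (used = P.nativeGas ∧ ∃ rates, tx.body.payload = .oracleUpdate rates ∧
        tx.body.sender = P.oracle ∧ σ₁.contractRates = rates ∧ σ₁.coins = σ.coins) ∨
      (used = P.nativeGas ∧ ∃ coin a cs, tx.body.payload = .propose coin a ∧
        σ₁.contractRates = σ.contractRates ∧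
        (σ.coins coin).propose tx.body.sender a = some cs ∧
        σ₁.coins = Function.update σ.coins coin cs) ∨
      (used = P.nativeGas ∧ ∃ coin k b cs, tx.body.payload = .vote coin k b ∧
        σ₁.contractRates = σ.contractRates ∧
        (σ.coins coin).vote tx.body.sender k b = some cs ∧
        σ₁.coins = Function.update σ.coins coin cs)) := by
  unfold runPayload at h
  split at h
  · next call hp =>
    simp only [Option.some.injEq, Prod.mk.injEq] at h
    obtain ⟨rfl, rfl⟩ := h
    exact ⟨min_le_right _ _, rfl, rfl, Or.inl ⟨⟨call, hp⟩, rfl, _, rfl⟩⟩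
  · next rates hp =>
    split_ifs at h with hc
    simp only [Option.some.injEq, Prod.mk.injEq] at h
    obtain ⟨rfl, rfl⟩ := h
    exact ⟨hc.2, rfl, rfl, Or.inr (Or.inl ⟨rfl, rates, hp, hc.1, rfl, rfl⟩)⟩
  · next coin a hp =>
    split_ifs at h with hc
    obtain ⟨cs, hcs, he⟩ := Option.map_eq_some_iff.1 h
    simp only [Prod.mk.injEq] at he
    obtain ⟨rfl, rfl⟩ := he
    exact ⟨hc, rfl, rfl, Or.inr (Or.inr (Or.inl ⟨rfl, coin, a, cs, hp, rfl, hcs, rfl⟩))⟩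
  · next coin k b hp =>
    split_ifs at h with hc
    obtain ⟨cs, hcs, he⟩ := Option.map_eq_some_iff.1 h
    simp only [Prod.mk.injEq] at he
    obtain ⟨rfl, rfl⟩ := he
    exact ⟨hc, rfl, rfl, Or.inr (Or.inr (Or.inr ⟨rfl, coin, k, b, cs, hp, rfl, hcs, rfl⟩))⟩

theorem applyTx_rates {σ σ' : ChainState Addr Cur World} {tx : Tx Addr Cur Call}
    (h : applyTx P σ tx = some σ') :
    σ'.height = σ.height ∧ σ'.storedRates = σ.storedRates ∧
    σ'.contractRates = (match tx.body.payload with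
      | .oracleUpdate r => r
      | _ => σ.contractRates) ∧
    ∀ rates, tx.body.payload = .oracleUpdate rates → tx.body.sender = P.oracle := by
  obtain ⟨-, -, -, σ₁, used, hr, rfl⟩ := applyTx_spec h
  obtain ⟨-, hs, hh, hcases⟩ := runPayload_spec hr
  refine ⟨hh, hs, ?_, ?_⟩
  · rcases hcases with ⟨⟨call, hp⟩, hc, -⟩ | ⟨-, rates, hp, -, hc, -⟩ | ⟨-, coin, a, cs, hp, hc, -⟩ |
      ⟨-, coin, k, b, cs, hp, hc, -⟩ <;> rw [hp] <;> exact hc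
  · intro rates hp'
    rcases hcases with ⟨⟨call, hp⟩, -⟩ | ⟨-, rates, hp, ho, -⟩ | ⟨-, coin, a, cs, hp, -⟩ |
      ⟨-, coin, k, b, cs, hp, -⟩
    · simp [hp] at hp'
    · exact ho
    · simp [hp] at hp'
    · simp [hp] at hp'

/-- Neither `prepay` nor any payload touches a fee pool; only `settle` does, in the transaction's
currency. Outside that currency the payload can write only to the coin named by a proposal or a
vote. -/
theorem applyTx_settled {σ σ' : ChainState Addr Cur World} {tx : Tx Addr Cur Call}
    (h : applyTx P σ tx = some σ') :
    (∃ gas ≤ tx.body.gasLimit, ∀ c, (σ'.coins c).feePool =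
      (σ.coins c).feePool + if c = tx.currency then tx.gasPrice * gas else 0) ∧
    ∀ c, c ≠ tx.currency → ¬ tx.Manages c → σ'.coins c = σ.coins c := by
  obtain ⟨-, -, -, σ₁, used, hr, rfl⟩ := applyTx_spec h
  obtain ⟨hu, -, -, hcases⟩ := runPayload_spec hr
  constructor
  · refine ⟨used, hu, fun c => ?_⟩
    rw [(settle_coins tx used σ₁ c).2.2.1]
    congr 1
    rw [← (prepay_coins tx σ c).2.2.1]
    rcases hcases with ⟨-, -, bal, hc⟩ | ⟨-, rates, -, -, -, hc⟩ |
      ⟨-, coin, a, cs, -, -, hcs, hc⟩ | ⟨-, coin, k, b, cs, -, -, hcs, hc⟩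
    · rw [hc]
      by_cases e : c = tx.currency
      · subst e; simp
      · simp [e]
    · rw [hc]
    · rw [hc]
      by_cases e : c = coin
      · subst e; rw [(CoinState.propose_spec hcs).2]; simp
      · simp [e]
    · rw [hc]
      by_cases e : c = coin
      · subst e
        obtain ⟨_, _, -, -, -, -, -, -, hf, -⟩ := CoinState.vote_spec hcs
        simp [hf]
      · simp [e]
  · intro c hne hm
    rw [settle_coins_of_ne hne]
    rcases hcases with ⟨-, -, bal, hc⟩ | ⟨-, rates, -, -, -, hc⟩ |
      ⟨-, coin, a, cs, hp, -, hcs, hc⟩ | ⟨-, coin, k, b, cs, hp, -, hcs, hc⟩ <;> rw [hc]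
    · rw [Function.update_of_ne hne, prepay_coins_of_ne hne]
    · rw [prepay_coins_of_ne hne]
    · have : c ≠ coin := by rintro rfl; exact hm (Or.inl ⟨a, hp⟩)
      rw [Function.update_of_ne this, prepay_coins_of_ne hne]
    · have : c ≠ coin := by rintro rfl; exact hm (Or.inr ⟨k, b, hp⟩)
      rw [Function.update_of_ne this, prepay_coins_of_ne hne]

/-- Prepaying and settling together charge exactly the fee due. -/
theorem settle_prepay_balance {σ σ₁ : ChainState Addr Cur World} {tx : Tx Addr Cur Call} {used : ℕ}
    (hpay : tx.gasPrice * tx.body.gasLimit ≤ (σ.coins tx.currency).balance tx.body.sender)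
    (hu : used ≤ tx.body.gasLimit) (c : Cur) (x : Addr) (d : ℤ)
    (h : ((σ₁.coins c).balance x : ℤ) = ((prepay tx σ).coins c).balance x + d) :
    (((settle tx used σ₁).coins c).balance x : ℤ) =
      (σ.coins c).balance x - feeDue tx used c x + d := by
  rw [(settle_coins tx used σ₁ c).2.2.2 x]
  rw [(prepay_coins tx σ c).2.2.2 x] at h
  unfold feeDue
  by_cases hcx : c = tx.currency ∧ x = tx.body.sender
  · rw [if_pos hcx] at h ⊢
    rw [if_pos hcx]
    obtain ⟨rfl, rfl⟩ := hcx
    -- With `gasLimit = used + m` the refund is `gasPrice * m`, and `hpay` makes the truncated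
    -- prepayment exact.
    obtain ⟨m, hm⟩ := Nat.exists_eq_add_of_le hu
    rw [hm] at h hpay ⊢
    rw [Nat.add_sub_cancel_left]
    push_cast [Nat.cast_sub hpay] at h ⊢
    rw [h]
    ring
  · rw [if_neg hcx] at h ⊢
    rw [if_neg hcx, h]
    ring

/-- The effect of a transaction on the management of the stablecoin `c`. -/
theorem applyTx_management {σ σ' : ChainState Addr Cur World} {tx : Tx Addr Cur Call}
    (h : applyTx P σ tx = some σ') (c : Cur) :
    (tx.Manages c → tx.body.sender ∈ (σ.coins c).admin.whitelist) ∧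
    (∀ k b, tx.body.payload = .vote c k b → ∃ pr, (σ.coins c).proposals[k]? = some pr ∧
      pr.status = .pending ∧ tx.body.sender ∉ pr.approvals ∪ pr.rejections) ∧
    (∀ k pr, Executes σ σ' tx c k pr →
      (σ.coins c).admin.quorumSize ≤
        (insert tx.body.sender pr.approvals ∩ (σ.coins c).admin.whitelist).card ∧
      pr.action.applyAdmin (σ.coins c).admin = some (σ'.coins c).admin ∧
      ∀ x, ((σ'.coins c).balance x : ℤ) = (σ.coins c).balance x
        - feeDue tx P.nativeGas c x + pr.action.balanceChange x) ∧
    ((¬ ∃ k pr, Executes σ σ' tx c k pr) →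
      (σ'.coins c).admin = (σ.coins c).admin ∧
      ((∀ call, tx.body.payload ≠ .evmCall call) →
        ∀ x, ((σ'.coins c).balance x : ℤ) =
          (σ.coins c).balance x - feeDue tx P.nativeGas c x)) := by
  obtain ⟨-, -, hpay, σ₁, used, hr, rfl⟩ := applyTx_spec h
  obtain ⟨hu, -, -, hcases⟩ := runPayload_spec hr
  have hpa := (prepay_coins tx σ c).1
  have hpp := (prepay_coins tx σ c).2.1
  have hsa := (settle_coins tx used σ₁ c).1
  have hsp := (settle_coins tx used σ₁ c).2.1
  -- An execution on `c` needs a vote on `c` itself.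
  have noexec : ∀ {c' k b}, tx.body.payload = .vote c' k b → c ≠ c' →
      ¬ ∃ k pr, Executes σ (settle tx used σ₁) tx c k pr := by
    rintro c' k b hp hne ⟨k', pr, hp', -⟩
    rw [hp] at hp'
    simp only [Payload.vote.injEq] at hp'
    exact hne hp'.1.symm
  rcases hcases with ⟨⟨call, hp⟩, -, bal, hc⟩ | ⟨rfl, rates, hp, -, -, hc⟩ |
      ⟨rfl, coin, a, cs, hp, -, hcs, hc⟩ | ⟨rfl, coin, k, b, cs, hp, -, hcs, hc⟩
  · refine ⟨?_, ?_, ?_, ?_⟩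
    · rintro (⟨a, h⟩ | ⟨k, b, h⟩) <;> simp [hp] at h
    · intro k b h; simp [hp] at h
    · intro k pr h; have := h.1; simp [hp] at this
    · intro _
      refine ⟨?_, fun h => absurd hp (h call)⟩
      rw [hsa, ← hpa, hc]
      by_cases e : c = tx.currency
      · subst e; simp
      · simp [e]
  · refine ⟨?_, ?_, ?_, ?_⟩
    · rintro (⟨a, h⟩ | ⟨k, b, h⟩) <;> simp [hp] at h
    · intro k b h; simp [hp] at h
    · intro k pr h; have := h.1; simp [hp] at this
    · intro _
      refine ⟨by rw [hsa, ← hpa, hc], fun _ x => ?_⟩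
      have := settle_prepay_balance (σ₁ := σ₁) hpay hu c x 0 (by rw [hc]; simp)
      simpa using this
  · obtain ⟨hw, rfl⟩ := CoinState.propose_spec hcs
    refine ⟨?_, ?_, ?_, ?_⟩
    · intro hm
      have : c = coin := by
        rcases hm with ⟨a', h⟩ | ⟨k, b, h⟩
        · simp only [hp, Payload.propose.injEq] at h
          exact h.1.symm
        · simp [hp] at h
      subst this
      rwa [hpa] at hw
    · intro k b h; simp [hp] at h
    · intro k pr h; have := h.1; simp [hp] at this
    · intro _
      have hco : (σ₁.coins c).admin = ((prepay tx σ).coins c).admin ∧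
          (σ₁.coins c).balance = ((prepay tx σ).coins c).balance := by
        rw [hc]
        by_cases e : c = coin
        · subst e; simp
        · simp [e]
      refine ⟨by rw [hsa, hco.1, hpa], fun _ x => ?_⟩
      have := settle_prepay_balance (σ₁ := σ₁) hpay hu c x 0 (by rw [hco.2]; simp)
      simpa using this
  · obtain ⟨pr, pr', hpr, hw, hst, hna, hnr, hprops, hf, hpp1, hpp2, happ, hex⟩ :=
      CoinState.vote_spec hcs
    by_cases e : c = coin
    · subst e
      have hcc : σ₁.coins c = cs := by rw [hc]; simp
      rw [hpp] at hpr hprops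
      rw [hpa] at hw hex
      have hlt : k < (σ.coins c).proposals.length := (List.getElem?_eq_some_iff.1 hpr).1
      have hnew : ((settle tx P.nativeGas σ₁).coins c).proposals[k]? = some pr' := by
        rw [hsp, hcc, hprops, List.getElem?_set_self hlt]
      refine ⟨fun _ => hw, ?_, ?_, ?_⟩
      · intro k' b' h
        simp only [hp, Payload.vote.injEq, true_and] at h
        obtain ⟨rfl, rfl⟩ := h
        exact ⟨pr, hpr, hst, by simp [hna, hnr]⟩
      · rintro k' pr1 ⟨h1, h2, h3, pr2, h4, h5⟩
        simp only [hp, Payload.vote.injEq, true_and] at h1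
        obtain ⟨rfl, rfl⟩ := h1
        rw [hpr] at h2
        rw [hnew] at h4
        obtain rfl := Option.some.inj h2
        obtain rfl := Option.some.inj h4
        rcases hex with ⟨-, -, hq, had, hbal⟩ | ⟨hne, -⟩
        · refine ⟨hq, by rw [hsa, hcc, had], fun x => ?_⟩
          exact settle_prepay_balance hpay hu c x _
            (by rw [hcc]; exact Action.applyBalance_spec hbal x)
        · exact absurd h5 hne
      · intro hno
        rcases hex with ⟨hb, hexd, hq, had, hbal⟩ | ⟨hne, had, hbal⟩
        · subst hb
          exact absurd ⟨k, pr, hp, hpr, hst, pr', hnew, hexd⟩ hno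
        · refine ⟨by rw [hsa, hcc, had], fun _ x => ?_⟩
          have := settle_prepay_balance (σ₁ := σ₁) hpay hu c x 0 (by rw [hcc, hbal]; simp)
          simpa using this
    · have hcc : σ₁.coins c = (prepay tx σ).coins c := by rw [hc]; simp [e]
      refine ⟨?_, ?_, ?_, ?_⟩
      · rintro (⟨a, h⟩ | ⟨k, b, h⟩)
        · simp [hp] at h
        · simp only [hp, Payload.vote.injEq] at h; exact absurd h.1.symm e
      · intro k b h
        simp only [hp, Payload.vote.injEq] at h; exact absurd h.1.symm e
      · intro k pr h
        exact absurd ⟨k, pr, h⟩ (noexec hp e)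
      · intro _
        refine ⟨by rw [hsa, hcc, hpa], fun _ x => ?_⟩
        have := settle_prepay_balance (σ₁ := σ₁) hpay hu c x 0 (by rw [hcc]; simp)
        simpa using this

/-- Where a recorded proposal comes from: it was there with at most the voter's approval added, or
the transaction proposes it. -/
theorem applyTx_proposals {σ σ' : ChainState Addr Cur World} {tx : Tx Addr Cur Call}
    (h : applyTx P σ tx = some σ') {c : Cur} {k : ℕ} {pr' : Proposal Addr}
    (hk : (σ'.coins c).proposals[k]? = some pr') :
    (∃ pr, (σ.coins c).proposals[k]? = some pr ∧ pr'.proposer = pr.proposer ∧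
      pr'.action = pr.action ∧
      (∀ a ∈ pr'.approvals, a ∈ pr.approvals ∨
        a = tx.body.sender ∧ tx.body.payload = .vote c k true) ∧
      (pr'.status = .executed → pr.status = .executed ∨ Executes σ σ' tx c k pr)) ∨
    (tx.body.sender = pr'.proposer ∧ tx.body.payload = .propose c pr'.action ∧
      (σ.coins c).proposals.length = k ∧ pr'.approvals = ∅ ∧ pr'.status = .pending) := by
  obtain ⟨-, -, hpay, σ₁, used, hr, rfl⟩ := applyTx_spec h
  obtain ⟨hu, -, -, hcases⟩ := runPayload_spec hr
  have hpp := (prepay_coins tx σ c).2.1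
  have hsp := (settle_coins tx used σ₁ c).2.1
  have hk' := hk
  rw [hsp] at hk'
  have same : (σ₁.coins c).proposals = (σ.coins c).proposals → (∃ pr,
      (σ.coins c).proposals[k]? = some pr ∧ pr'.proposer = pr.proposer ∧
      pr'.action = pr.action ∧
      (∀ a ∈ pr'.approvals, a ∈ pr.approvals ∨
        a = tx.body.sender ∧ tx.body.payload = .vote c k true) ∧
      (pr'.status = .executed → pr.status = .executed ∨
        Executes σ (settle tx used σ₁) tx c k pr)) := by
    intro he
    rw [he] at hk'
    exact ⟨pr', hk', rfl, rfl, fun a h => Or.inl h, fun h => Or.inl h⟩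
  rcases hcases with ⟨-, -, bal, hc⟩ | ⟨rfl, rates, hp, -, -, hc⟩ |
      ⟨rfl, coin, a, cs, hp, -, hcs, hc⟩ | ⟨rfl, coin, j, b, cs, hp, -, hcs, hc⟩
  · refine Or.inl (same ?_)
    rw [← hpp, hc]
    by_cases e : c = tx.currency
    · subst e; simp
    · simp [e]
  · exact Or.inl (same (by rw [hc, hpp]))
  · obtain ⟨hw, rfl⟩ := CoinState.propose_spec hcs
    by_cases e : c = coin
    · subst e
      rw [hc] at hk'
      simp only [Function.update_self] at hk'
      rw [hpp] at hk'
      rcases lt_or_ge k (σ.coins c).proposals.length with hlt | hge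
      · rw [List.getElem?_append_left hlt] at hk'
        exact Or.inl ⟨pr', hk', rfl, rfl, fun a h => Or.inl h, fun h => Or.inl h⟩
      · rw [List.getElem?_append_right hge] at hk'
        -- Only one entry is appended, so its index is the old length.
        have : k - (σ.coins c).proposals.length = 0 := by
          by_contra h0
          rw [List.getElem?_eq_none (by simp; omega)] at hk'
          cases hk'
        rw [this] at hk'
        simp only [List.getElem?_cons_zero, Option.some.injEq] at hk'
        subst hk'
        exact Or.inr ⟨rfl, hp, by omega, rfl, rfl⟩
    · exact Or.inl (same (by rw [hc, Function.update_of_ne e, hpp]))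
  · obtain ⟨pr, pr1, hpr, hw, hst, hna, hnr, hprops, hf, hpp1, hpp2, happ, hex⟩ :=
      CoinState.vote_spec hcs
    by_cases e : c = coin
    · subst e
      have hcc : σ₁.coins c = cs := by rw [hc]; simp
      rw [hpp] at hpr hprops
      have hlt : j < (σ.coins c).proposals.length := (List.getElem?_eq_some_iff.1 hpr).1
      rw [hcc, hprops] at hk'
      by_cases ej : k = j
      · subst ej
        rw [List.getElem?_set_self hlt] at hk'
        obtain rfl := Option.some.inj hk'
        refine Or.inl ⟨pr, hpr, hpp1, hpp2, ?_, ?_⟩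
        · intro a ha
          rcases happ a ha with h | ⟨h, rfl⟩
          · exact Or.inl h
          · exact Or.inr ⟨h, hp⟩
        · intro hexd
          rcases hex with ⟨rfl, -⟩ | ⟨hne, -⟩
          · exact Or.inr ⟨hp, hpr, hst, _, hk, hexd⟩
          · exact absurd hexd hne
      · rw [List.getElem?_set_ne (Ne.symm ej)] at hk'
        exact Or.inl ⟨pr', hk', rfl, rfl, fun a h => Or.inl h, fun h => Or.inl h⟩
    · exact Or.inl (same (by rw [hc, Function.update_of_ne e, hpp]))

/-! ## Replaying a chain -/

theorem applyTxs_append (σ : ChainState Addr Cur World) (l₁ l₂ : List (Tx Addr Cur Call)) :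
    applyTxs P σ (l₁ ++ l₂) = (applyTxs P σ l₁).bind fun σ' => applyTxs P σ' l₂ := by
  simp only [applyTxs, List.foldlM_append]; rfl

theorem applyTxs_cons (σ : ChainState Addr Cur World) (tx : Tx Addr Cur Call)
    (l : List (Tx Addr Cur Call)) :
    applyTxs P σ (tx :: l) = (applyTx P σ tx).bind fun σ' => applyTxs P σ' l := by
  simp only [applyTxs, List.foldlM_cons]; rfl

theorem replay_append_singleton (chain : List (Block Addr Cur Call)) (b : Block Addr Cur Call) :
    replay P (chain ++ [b]) = (replay P chain).bind fun σ => execBlock P σ b := by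
  simp only [replay, List.foldlM_append, List.foldlM_cons, List.foldlM_nil]
  change (Option.bind _ fun s => Option.bind (execBlock P s b) some) = _
  simp

/-- These two properties are what consensus needs of an honest proposer's fresh block. -/
theorem FeeOrdered.isSome_and_mem {pool : Set (Tx Addr Cur Call)} {σ : ChainState Addr Cur World}
    {v : List (Tx Addr Cur Call)} (h : FeeOrdered P pool σ v) :
    (∃ σ', execBlock P σ v = some σ') ∧ ∀ tx ∈ v, tx ∈ pool := by
  suffices (∃ σ', applyTxs P σ v = some σ') ∧ ∀ tx ∈ v, tx ∈ pool by
    obtain ⟨⟨σ', h⟩, hm⟩ := this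
    exact ⟨⟨endBlock P σ', by simp [execBlock, h]⟩, hm⟩
  induction h with
  | nil σ => exact ⟨⟨σ, rfl⟩, by simp⟩
  | cons σ σ' tx rest hpool hvalid _ _ ih =>
    obtain ⟨⟨σ'', h⟩, hm⟩ := ih
    refine ⟨⟨σ'', by rw [applyTxs_cons, hvalid]; exact h⟩, ?_⟩
    intro tx' htx'
    rcases List.mem_cons.1 htx' with rfl | h
    · exact hpool
    · exact hm _ h

/-- Induction along the execution of a chain, transaction by transaction. -/
theorem replay_induction
    (Φ : List (Block Addr Cur Call) → List (Tx Addr Cur Call) → ChainState Addr Cur World → Prop)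
    (h0 : Φ [] [] (genesis P))
    (htx : ∀ pre b σ₀ σ tx σ', replay P pre = some σ₀ → applyTxs P σ₀ b = some σ →
      applyTx P σ tx = some σ' → Φ pre b σ → Φ pre (b ++ [tx]) σ')
    (hblk : ∀ pre b σ₀ σ, replay P pre = some σ₀ → applyTxs P σ₀ b = some σ →
      Φ pre b σ → Φ (pre ++ [b]) [] (endBlock P σ)) :
    ∀ pre b σ₀ σ, replay P pre = some σ₀ → applyTxs P σ₀ b = some σ → Φ pre b σ := by
  have inner : ∀ pre σ₀, replay P pre = some σ₀ → Φ pre [] σ₀ →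
      ∀ b σ, applyTxs P σ₀ b = some σ → Φ pre b σ := by
    intro pre σ₀ hpre hΦ b
    induction b using List.reverseRecOn with
    | nil =>
      intro σ h
      obtain rfl := Option.some.inj h
      exact hΦ
    | append_singleton b tx ih =>
      intro σ h
      rw [applyTxs_append] at h
      obtain ⟨σ₁, h1, h2⟩ := Option.bind_eq_some_iff.1 h
      rw [applyTxs_cons] at h2
      obtain ⟨σ₂, h3, h4⟩ := Option.bind_eq_some_iff.1 h2
      obtain rfl := Option.some.inj h4
      exact htx pre b σ₀ σ₁ tx _ hpre h1 h3 (ih _ h1)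
  intro pre
  suffices ∀ σ₀, replay P pre = some σ₀ → Φ pre [] σ₀ from
    fun b σ₀ σ h1 h2 => inner pre σ₀ h1 (this σ₀ h1) b σ h2
  induction pre using List.reverseRecOn with
  | nil =>
    intro σ₀ h
    obtain rfl := Option.some.inj h
    exact h0
  | append_singleton pre b ih =>
    intro σ₀ h
    rw [replay_append_singleton] at h
    obtain ⟨σ₁, h1, h2⟩ := Option.bind_eq_some_iff.1 h
    obtain ⟨σ₂, h3, rfl⟩ := Option.map_eq_some_iff.1 h2
    exact hblk pre b σ₁ σ₂ h1 h3 (inner pre σ₁ h1 (ih _ h1) b σ₂ h3)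

/-- The contract reflects everything executed so far, including the open block `b`. The stored rates
are refreshed exactly when the number of completed blocks is a multiple of `syncPeriod`, hence
reflect the prefix up to the last multiple. -/
theorem replay_rates {pre : List (Block Addr Cur Call)} {b : List (Tx Addr Cur Call)}
    {σ₀ σ : ChainState Addr Cur World} (h1 : replay P pre = some σ₀)
    (h2 : applyTxs P σ₀ b = some σ) :
    σ.height = pre.length ∧
    σ.contractRates = reportedRates P.genesisRates (pre.flatten ++ b) ∧
    σ.storedRates = reportedRates P.genesisRates
      (pre.take (pre.length / P.syncPeriod * P.syncPeriod)).flatten := by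
  refine replay_induction (P := P) (fun pre b σ => σ.height = pre.length ∧
    σ.contractRates = reportedRates P.genesisRates (pre.flatten ++ b) ∧
    σ.storedRates = reportedRates P.genesisRates
      (pre.take (pre.length / P.syncPeriod * P.syncPeriod)).flatten) ?_ ?_ ?_ pre b σ₀ σ h1 h2
  · simp [genesis, reportedRates]
  · rintro pre b σ₀ σ tx σ' - - h ⟨ih1, ih2, ih3⟩
    obtain ⟨e1, e2, e3, -⟩ := applyTx_rates h
    refine ⟨e1.trans ih1, ?_, e2.trans ih3⟩
    rw [e3, ← List.append_assoc, reportedRates_append_singleton, ih2]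
  · rintro pre b σ₀ σ - - ⟨ih1, ih2, ih3⟩
    refine ⟨by simp [endBlock, ih1], by simp [endBlock, ih2], ?_⟩
    simp only [endBlock, List.length_append, List.length_singleton, ih1]
    split_ifs with hmod
    · rw [ih2, Nat.div_mul_cancel (Nat.dvd_of_mod_eq_zero hmod), List.take_of_length_le (by simp)]
      simp
    -- Away from multiples the quotient does not jump, and the prefix stays inside the old chain.
    · have : (pre.length + 1) / P.syncPeriod = pre.length / P.syncPeriod := by
        rw [Nat.succ_div, if_neg (fun h => hmod (Nat.mod_eq_zero_of_dvd h)), add_zero]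
      rw [this, List.take_append_of_le_length (Nat.div_mul_le_self _ _), ih3]

/-- Approvals of recorded proposals stem from executed voting transactions. -/
theorem replay_approvals {pre : List (Block Addr Cur Call)} {b : List (Tx Addr Cur Call)}
    {σ₀ σ : ChainState Addr Cur World} (h1 : replay P pre = some σ₀)
    (h2 : applyTxs P σ₀ b = some σ) :
    ∀ c k pr, (σ.coins c).proposals[k]? = some pr → ∀ a ∈ pr.approvals,
      ∃ tx ∈ pre.flatten ++ b, tx.body.sender = a ∧ tx.body.payload = .vote c k true := by
  refine replay_induction (P := P) (fun pre b σ => ∀ c k pr,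
    (σ.coins c).proposals[k]? = some pr → ∀ a ∈ pr.approvals,
      ∃ tx ∈ pre.flatten ++ b, tx.body.sender = a ∧ tx.body.payload = .vote c k true)
    ?_ ?_ ?_ pre b σ₀ σ h1 h2
  · intro c k pr h; simp [genesis] at h
  · intro pre b σ₀ σ tx σ' _ _ h ih c k pr hk a ha
    rcases applyTx_proposals h hk with ⟨pr0, h0, -, -, happ, -⟩ | ⟨-, -, -, he, -⟩
    · rcases happ a ha with ha | ⟨rfl, hv⟩
      · obtain ⟨tx', hm, h⟩ := ih c k pr0 h0 a ha
        refine ⟨tx', ?_, h⟩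
        rw [← List.append_assoc]
        exact List.mem_append_left _ hm
      · exact ⟨tx, by simp, rfl, hv⟩
    · simp [he] at ha
  · intro pre b σ₀ σ _ _ ih c k pr hk a ha
    obtain ⟨tx', hm, h⟩ := ih c k pr hk a ha
    exact ⟨tx', by simpa using hm, h⟩

/-- Recorded proposals stem from executed proposal transactions, and their execution from executed
transactions that brought it about. -/
theorem replay_proposals {chain : List (Block Addr Cur Call)} {σ : ChainState Addr Cur World}
    (h : replay P chain = some σ) {c : Cur} {k : ℕ} {pr : Proposal Addr}
    (hk : (σ.coins c).proposals[k]? = some pr) :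
    (∃ n prior σ tx σ', ExecutedAt P chain n prior σ tx σ' ∧
      tx.body.sender = pr.proposer ∧ tx.body.payload = .propose c pr.action ∧
      (σ.coins c).proposals.length = k) ∧
    (pr.status = .executed → ∃ n prior σ tx σ' pr₀,
      ExecutedAt P chain n prior σ tx σ' ∧ Executes σ σ' tx c k pr₀ ∧
      pr₀.action = pr.action) := by
  -- `ExecutedAt` refers to a finished chain, while the induction passes through open blocks;
  -- quantifying over all continuations `s` and `post` makes the claim stable under appending.
  have key := replay_induction (P := P) (fun pre b σ => ∀ c k pr,
    (σ.coins c).proposals[k]? = some pr →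
    (∃ n prior σ tx σ', (∀ s post, ExecutedAt P (pre ++ (b ++ s) :: post) n prior σ tx σ') ∧
      tx.body.sender = pr.proposer ∧ tx.body.payload = .propose c pr.action ∧
      (σ.coins c).proposals.length = k) ∧
    (pr.status = .executed → ∃ n prior σ tx σ' pr₀,
      (∀ s post, ExecutedAt P (pre ++ (b ++ s) :: post) n prior σ tx σ') ∧
      Executes σ σ' tx c k pr₀ ∧ pr₀.action = pr.action)) ?_ ?_ ?_
  · rcases List.eq_nil_or_concat chain with rfl | ⟨pre, b, rfl⟩
    · obtain rfl := Option.some.inj h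
      simp [genesis] at hk
    · rw [List.concat_eq_append, replay_append_singleton] at h
      obtain ⟨σ₁, h1, h2⟩ := Option.bind_eq_some_iff.1 h
      obtain ⟨σ₂, h3, rfl⟩ := Option.map_eq_some_iff.1 h2
      obtain ⟨⟨n, prior, σ, tx, σ', ha, hb⟩, hex⟩ := key pre b σ₁ σ₂ h1 h3 c k pr hk
      refine ⟨⟨n, prior, σ, tx, σ', by simpa using ha [] [], hb⟩, fun hst => ?_⟩
      obtain ⟨n, prior, σ, tx, σ', pr₀, ha, hb⟩ := hex hst
      exact ⟨n, prior, σ, tx, σ', pr₀, by simpa using ha [] [], hb⟩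
  · intro c k pr h; simp [genesis] at h
  · intro pre b σ₀ σ tx σ' hpre hb htx ih c k pr hk
    have hat : ∀ s post, ExecutedAt P (pre ++ ((b ++ [tx]) ++ s) :: post) pre.length
        (pre.flatten ++ b) σ tx σ' := fun s post =>
      ⟨pre, post, b, s, σ₀, by simp, rfl, rfl, hpre, hb, htx⟩
    rcases applyTx_proposals htx hk with ⟨pr0, h0, e1, e2, -, hexd⟩ | ⟨h1, h2, h3, -, hpend⟩
    · obtain ⟨⟨n, prior, σ1, tx1, σ1', ha, hb⟩, hex⟩ := ih c k pr0 h0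
      rw [e1, e2]
      refine ⟨⟨n, prior, σ1, tx1, σ1', fun s post => ?_, hb⟩, fun hst => ?_⟩
      · rw [List.append_assoc]; exact ha _ _
      · rcases hexd hst with hst | hex'
        · obtain ⟨n, prior, σ1, tx1, σ1', pr₀, ha, hb⟩ := hex hst
          refine ⟨n, prior, σ1, tx1, σ1', pr₀, fun s post => ?_, hb⟩
          rw [List.append_assoc]; exact ha _ _
        · exact ⟨_, _, _, _, _, pr0, hat, hex', rfl⟩
    · refine ⟨⟨_, _, _, _, _, hat, h1, h2, h3⟩, fun hst => ?_⟩
      rw [hpend] at hst; cases hst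
  · intro pre b σ₀ σ _ _ ih c k pr hk
    obtain ⟨⟨n, prior, σ1, tx1, σ1', ha, hb⟩, hex⟩ := ih c k pr hk
    refine ⟨⟨n, prior, σ1, tx1, σ1', fun s post => ?_, hb⟩, fun hst => ?_⟩
    · simpa using ha [] (s :: post)
    · obtain ⟨n, prior, σ1, tx1, σ1', pr₀, ha, hb⟩ := hex hst
      refine ⟨n, prior, σ1, tx1, σ1', pr₀, fun s post => ?_, hb⟩
      simpa using ha [] (s :: post)

/-- Every transaction of a replayable chain is executed at some point. -/
theorem exists_executedAt {chain : List (Block Addr Cur Call)} {σ : ChainState Addr Cur World}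
    (h : replay P chain = some σ) {tx : Tx Addr Cur Call} (htx : tx ∈ chain.flatten) :
    ∃ n prior σ σ', ExecutedAt P chain n prior σ tx σ' := by
  obtain ⟨b, hb, htx'⟩ := List.mem_flatten.1 htx
  obtain ⟨pre, post, rfl⟩ := List.append_of_mem hb
  obtain ⟨b₁, b₂, rfl⟩ := List.append_of_mem htx'
  have hsplit : replay P (pre ++ (b₁ ++ tx :: b₂) :: post) = (replay P pre).bind fun σ =>
      (execBlock P σ (b₁ ++ tx :: b₂)).bind fun σ' => post.foldlM (execBlock P) σ' := by
    simp only [replay, List.foldlM_append, List.foldlM_cons]; rfl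
  rw [hsplit] at h
  obtain ⟨σ₀, h1, h2⟩ := Option.bind_eq_some_iff.1 h
  obtain ⟨_, h3, -⟩ := Option.bind_eq_some_iff.1 h2
  obtain ⟨_, h4, -⟩ := Option.map_eq_some_iff.1 h3
  rw [applyTxs_append] at h4
  obtain ⟨σ₁, h5, h6⟩ := Option.bind_eq_some_iff.1 h4
  rw [applyTxs_cons] at h6
  obtain ⟨σ₂, h7, -⟩ := Option.bind_eq_some_iff.1 h6
  exact ⟨_, _, _, _, pre, post, b₁, b₂, σ₀, rfl, rfl, rfl, h1, h5, h7⟩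

end LedgerFacts

end MStableChain

namespace MStableChain

/-! ## Quorums -/

section Quorums

variable {N : ℕ} {byz : Finset (Fin N)}

theorem IsQuorum.mono {A B : Set (Fin N)} (h : IsQuorum A) (hAB : A ⊆ B) : IsQuorum B := by
  have := Set.ncard_le_ncard hAB (Set.toFinite B)
  unfold IsQuorum at *
  omega

theorem IsThird.mono {A B : Set (Fin N)} (h : IsThird A) (hAB : A ⊆ B) : IsThird B := by
  have := Set.ncard_le_ncard hAB (Set.toFinite B)
  unfold IsThird at *
  omega

theorem IsQuorum.isThird {A : Set (Fin N)} (h : IsQuorum A) : IsThird A := by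
  unfold IsQuorum IsThird at *
  omega

/-- More than `N/3` nodes outnumber the malicious ones. -/
theorem IsThird.exists_honest (hbyz : 3 * byz.card < N) {A : Set (Fin N)} (h : IsThird A) :
    ∃ q ∈ A, q ∉ byz := by
  by_contra! hno
  have h1 : A ⊆ (byz : Set (Fin N)) := fun q hq => hno q hq
  have h2 := Set.ncard_le_ncard h1 (Set.toFinite _)
  rw [Set.ncard_coe_finset] at h2
  unfold IsThird at h
  omega

theorem IsQuorum.exists_honest (hbyz : 3 * byz.card < N) {A : Set (Fin N)} (h : IsQuorum A) :
    ∃ q ∈ A, q ∉ byz :=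
  h.isThird.exists_honest hbyz

/-- Two quorums have an honest node in common. -/
theorem IsQuorum.exists_honest_mem_inter (hbyz : 3 * byz.card < N) {A B : Set (Fin N)}
    (hA : IsQuorum A) (hB : IsQuorum B) : ∃ q, q ∈ A ∧ q ∈ B ∧ q ∉ byz := by
  have h1 := Set.ncard_union_add_ncard_inter A B
  have h2 : (A ∪ B).ncard ≤ N := by
    simpa using Set.ncard_le_ncard (Set.subset_univ (A ∪ B))
  -- Inclusion-exclusion: the sizes add up to more than `4N/3`, of which the union accounts for at
  -- most `N`.
  have h3 : IsThird (A ∩ B) := by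
    unfold IsQuorum at hA hB
    unfold IsThird
    omega
  obtain ⟨q, hq, hb⟩ := h3.exists_honest hbyz
  exact ⟨q, hq.1, hq.2, hb⟩

/-- The honest nodes alone exceed `2N/3`, so progress does not depend on any malicious node. -/
theorem isQuorum_of_honest (hbyz : 3 * byz.card < N) {A : Set (Fin N)}
    (h : ∀ q ∉ byz, q ∈ A) : IsQuorum A := by
  have h1 : ((byzᶜ : Finset (Fin N)) : Set (Fin N)) ⊆ A := fun q hq => h q (by simpa using hq)
  have h2 := Set.ncard_le_ncard h1 (Set.toFinite _)
  rw [Set.ncard_coe_finset, Finset.card_compl, Fintype.card_fin] at h2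
  unfold IsQuorum
  omega

theorem three_mul_card_lt [NeZero N] (hbyz : (byz.card : ℝ) / (N : ℝ) < 1 / 3) :
    3 * byz.card < N := by
  have hN : (0 : ℝ) < N := Nat.cast_pos.2 (NeZero.pos N)
  rw [div_lt_iff₀ hN] at hbyz
  have : (3 * byz.card : ℝ) < N := by linarith
  exact_mod_cast this

end Quorums

/-! ## Local invariants of a node -/

section Local

variable {N : ℕ} [NeZero N] {Addr Cur World Call : Type*} [DecidableEq Addr] [DecidableEq Cur]
  {P : Params Addr Cur World Call} {p : Fin N} {t : ℝ}
  {st st' : NodeState N Addr Cur World Call} {out : Set (Msg N Addr Cur Call)}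

/-- The number of a phase within a round. -/
def Phase.num : Phase → ℕ
  | .propose => 0
  | .prevote => 1
  | .precommit => 2

/-- Lexicographic comparison of positions (height, round, phase). -/
abbrev PosLE (h r k h' r' k' : ℕ) : Prop :=
  h < h' ∨ h = h' ∧ (r < r' ∨ r = r' ∧ k ≤ k')

/-- What `StartRound` does to the state, and what it broadcasts. -/
structure StartRound.Spec (P : Params Addr Cur World Call) (p : Fin N) (t : ℝ)
    (st : NodeState N Addr Cur World Call) (r : ℕ) (st' : NodeState N Addr Cur World Call)
    (out : Set (Msg N Addr Cur Call)) : Prop where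
  ledger : st'.ledger = st.ledger
  decided : st'.decided = st.decided
  pool : st'.pool = st.pool
  inbox : st'.inbox = st.inbox
  round : st'.round = r
  phase : st'.phase = .propose
  locked : st'.locked = st.locked
  lastValid : st'.lastValid = st.lastValid
  prevoteTimerSet : st'.prevoteTimerSet = false
  polkaSeen : st'.polkaSeen = false
  precommitTimerSet : st'.precommitTimerSet = false
  out_timers :
    (proposer N st.height r ≠ p ∧ out = ∅ ∧ st'.timers =
      insert ⟨.propose, st.height, r, t + P.timeout .propose r⟩ st.timers) ∨
    (proposer N st.height r = p ∧ st'.timers = st.timers ∧ ∃ v vr,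
      out = {⟨p, .proposal st.height r v vr⟩} ∧
      ((∃ k, vr = some k ∧ st.lastValid = some (k, v)) ∨
        (vr = none ∧ st.lastValid = none ∧ st.Valid P v ∧ ∀ tx ∈ v, tx ∈ st.pool)))

theorem StartRound.spec {r : ℕ} (h : StartRound P p t st r st' out) :
    StartRound.Spec P p t st r st' out := by
  cases h with
  | proposeValid k v hp hv =>
    exact ⟨rfl, rfl, rfl, rfl, rfl, rfl, rfl, rfl, rfl, rfl, rfl,
      Or.inr ⟨hp, rfl, v, some k, rfl, Or.inl ⟨k, rfl, hv⟩⟩⟩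
  | proposeNew v hp hv hnew =>
    exact ⟨rfl, rfl, rfl, rfl, rfl, rfl, rfl, rfl, rfl, rfl, rfl,
      Or.inr ⟨hp, rfl, v, none, rfl, Or.inr ⟨rfl, hv, hnew.isSome_and_mem⟩⟩⟩
  | follow hp =>
    exact ⟨rfl, rfl, rfl, rfl, rfl, rfl, rfl, rfl, rfl, rfl, rfl, Or.inl ⟨hp, rfl, rfl⟩⟩

/-- A proposer is never stuck, since the empty block is always an admissible fresh proposal. Hence a
rule that starts a round is enabled as soon as its guard holds. -/
theorem StartRound.exists (P : Params Addr Cur World Call) (p : Fin N) (t : ℝ)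
    (st : NodeState N Addr Cur World Call) (r : ℕ) : ∃ st' out, StartRound P p t st r st' out := by
  by_cases hp : proposer N st.height r = p
  · rcases hv : st.lastValid with _ | ⟨k, v⟩
    · exact ⟨_, _, .proposeNew [] hp hv (.nil _)⟩
    · exact ⟨_, _, .proposeValid k v hp hv⟩
  · exact ⟨_, _, .follow hp⟩

theorem exists_voteIf {A C K : Type*} (ok : Prop) (v : Block A C K) : ∃ vote, VoteIf ok v vote := by
  by_cases h : ok
  · exact ⟨_, Or.inl ⟨h, rfl⟩⟩
  · exact ⟨_, Or.inr ⟨h, rfl⟩⟩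

/-- Invariants of the state of node `p`, where `past` are the times of the past events, and `sent`
the messages sent so far. -/
structure NodeInv (P : Params Addr Cur World Call) (p : Fin N) (past : Set ℝ)
    (sent : Set (Msg N Addr Cur Call)) (st : NodeState N Addr Cur World Call) : Prop where
  replay_eq : replay P st.decided = some st.ledger
  decided_pool : ∀ tx ∈ st.decided.flatten, tx ∈ st.pool
  decided_quorum : ∀ (h : ℕ) v, st.decided[h]? = some v →
    ∃ r, IsQuorum (st.senders (.precommit h r (some v)))
  prevoteTimer : st.prevoteTimerSet = true → ∃ s ∈ past,
    (⟨.prevote, st.height, st.round, s + P.timeout .prevote st.round⟩ : Timer) ∈ st.timers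
  precommitTimer : st.precommitTimerSet = true → ∃ s ∈ past,
    (⟨.precommit, st.height, st.round, s + P.timeout .precommit st.round⟩ : Timer) ∈ st.timers
  polkaSeen : st.polkaSeen = true → st.phase = .precommit ∧ ∃ v, st.lastValid = some (st.round, v)
  proposeTimer : st.phase = .propose → proposer N st.height st.round ≠ p →
    ∃ d, (⟨.propose, st.height, st.round, d⟩ : Timer) ∈ st.timers
  proposed : proposer N st.height st.round = p → ∃ v vr,
    (⟨p, .proposal st.height st.round v vr⟩ : Msg N Addr Cur Call) ∈ sent ∧
    (∀ tx ∈ v, tx ∈ st.pool) ∧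
    ∀ k, vr = some k → k < st.round ∧ IsQuorum (st.senders (.prevote st.height k (some v)))
  prevoted : st.phase ≠ .propose →
    ∃ x, (⟨p, .prevote st.height st.round x⟩ : Msg N Addr Cur Call) ∈ sent
  precommitted : st.phase = .precommit →
    ∃ x, (⟨p, .precommit st.height st.round x⟩ : Msg N Addr Cur Call) ∈ sent
  locked : ∀ k b, st.locked = some (k, b) → k ≤ st.round ∧ (k = st.round → st.phase = .precommit) ∧
    ∃ k' b', st.lastValid = some (k', b') ∧ k ≤ k'
  lastValid : ∀ k v, st.lastValid = some (k, v) →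
    k ≤ st.round ∧ (k = st.round → st.phase = .precommit) ∧ st.Valid P v ∧
    (∀ tx ∈ v, tx ∈ st.pool) ∧ IsQuorum (st.senders (.prevote st.height k (some v)))

/-- The invariants of a state from which round `r` is about to be started. -/
structure PreRoundInv (P : Params Addr Cur World Call)
    (st : NodeState N Addr Cur World Call) (r : ℕ) : Prop where
  replay_eq : replay P st.decided = some st.ledger
  decided_pool : ∀ tx ∈ st.decided.flatten, tx ∈ st.pool
  decided_quorum : ∀ (h : ℕ) v, st.decided[h]? = some v →
    ∃ r, IsQuorum (st.senders (.precommit h r (some v)))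
  locked : ∀ k b, st.locked = some (k, b) → k < r ∧ ∃ k' b', st.lastValid = some (k', b') ∧ k ≤ k'
  lastValid : ∀ k v, st.lastValid = some (k, v) → k < r ∧ st.Valid P v ∧
    (∀ tx ∈ v, tx ∈ st.pool) ∧ IsQuorum (st.senders (.prevote st.height k (some v)))

/-- All recorded rounds are strictly below `r`, so the clauses about a lock or valid block of the
current round are vacuous. A re-proposed valid block carries a quorum of prevotes from an earlier
round, as its receivers demand. -/
theorem PreRoundInv.nodeInv {r : ℕ} (h : PreRoundInv P st r) (hs : StartRound P p t st r st' out)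
    (past : Set ℝ) {sent : Set (Msg N Addr Cur Call)} (hout : out ⊆ sent) :
    NodeInv P p past sent st' := by
  have hv : ∀ k v, st.lastValid = some (k, v) → k < r ∧ st.Valid P v ∧
    (∀ tx ∈ v, tx ∈ st.pool) ∧ IsQuorum (st.senders (.prevote st.height k (some v))) := h.lastValid
  have hs := hs.spec
  have hse : st'.senders = st.senders := by funext b; simp [NodeState.senders, hs.inbox]
  have hh : st'.height = st.height := by simp [NodeState.height, hs.decided]
  have hva : st'.Valid P = st.Valid P := by funext v; simp [NodeState.Valid, hs.ledger]
  constructor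
  · rw [hs.decided, hs.ledger]; exact h.replay_eq
  · rw [hs.decided, hs.pool]; exact h.decided_pool
  · rw [hs.decided, hse]; exact h.decided_quorum
  · simp [hs.prevoteTimerSet]
  · simp [hs.precommitTimerSet]
  · simp [hs.polkaSeen]
  · intro _ hne
    rw [hh, hs.round] at *
    rcases hs.out_timers with ⟨-, -, ht⟩ | ⟨hp, -⟩
    · exact ⟨_, by rw [ht]; exact Set.mem_insert _ _⟩
    · exact absurd hp hne
  · intro hp
    rw [hh, hs.round, hs.pool, hse] at *
    rcases hs.out_timers with ⟨hne, -⟩ | ⟨-, -, v, vr, ho, hcase⟩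
    · exact absurd hp hne
    · refine ⟨v, vr, hout (by simp [ho]), ?_⟩
      rcases hcase with ⟨k, rfl, hl⟩ | ⟨rfl, -, -, hpool⟩
      · obtain ⟨h1, -, h3, h4⟩ := hv k v hl
        refine ⟨h3, fun k' hk' => ?_⟩
        obtain rfl := Option.some.inj hk'
        exact ⟨h1, h4⟩
      · exact ⟨hpool, fun k hk => by cases hk⟩
  · intro hne; exact absurd hs.phase hne
  · intro hne; rw [hs.phase] at hne; cases hne
  · intro k b hl
    rw [hs.locked] at hl
    rw [hs.round, hs.lastValid]
    obtain ⟨h1, h2⟩ := h.locked k b hl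
    exact ⟨h1.le, fun e => absurd e h1.ne, h2⟩
  · intro k v hl
    rw [hs.lastValid] at hl
    rw [hs.round, hs.pool, hse, hh, hva]
    obtain ⟨h1, h2⟩ := hv k v hl
    exact ⟨h1.le, fun e => absurd e h1.ne, h2⟩

theorem NodeInv.preRoundInv {past : Set ℝ} {sent : Set (Msg N Addr Cur Call)}
    (h : NodeInv P p past sent st) {r : ℕ} (hr : st.round < r) : PreRoundInv P st r where
  replay_eq := h.replay_eq
  decided_pool := h.decided_pool
  decided_quorum := h.decided_quorum
  locked k b hl := ⟨(h.locked k b hl).1.trans_lt hr, (h.locked k b hl).2.2⟩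
  lastValid k v hl := ⟨(h.lastValid k v hl).1.trans_lt hr, (h.lastValid k v hl).2.2⟩

theorem preRoundInv_blank {M : ℕ} (P : Params Addr Cur World Call) :
    PreRoundInv P (blank P : NodeState M Addr Cur World Call) 0 where
  replay_eq := rfl
  decided_pool := by simp [blank]
  decided_quorum := by simp [blank]
  locked := by simp [blank]
  lastValid := by simp [blank]

theorem NodeInv.mono {past past' : Set ℝ} {sent sent' : Set (Msg N Addr Cur Call)}
    (h : NodeInv P p past sent st) (hpast : past ⊆ past') (hsent : sent ⊆ sent') :
    NodeInv P p past' sent' st where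
  replay_eq := h.replay_eq
  decided_pool := h.decided_pool
  decided_quorum := h.decided_quorum
  prevoteTimer hf := let ⟨s, hs, h⟩ := h.prevoteTimer hf; ⟨s, hpast hs, h⟩
  precommitTimer hf := let ⟨s, hs, h⟩ := h.precommitTimer hf; ⟨s, hpast hs, h⟩
  polkaSeen := h.polkaSeen
  proposeTimer := h.proposeTimer
  proposed hp := let ⟨v, vr, hm, h⟩ := h.proposed hp; ⟨v, vr, hsent hm, h⟩
  prevoted hp := let ⟨x, hm⟩ := h.prevoted hp; ⟨x, hsent hm⟩
  precommitted hp := let ⟨x, hm⟩ := h.precommitted hp; ⟨x, hsent hm⟩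
  locked := h.locked
  lastValid := h.lastValid

theorem NodeInv.receive {past : Set ℝ} {sent : Set (Msg N Addr Cur Call)}
    (h : NodeInv P p past sent st) {pool : Set (Tx Addr Cur Call)}
    {inbox : Set (Msg N Addr Cur Call)} (hpool : st.pool ⊆ pool) (hinbox : st.inbox ⊆ inbox) :
    NodeInv P p past sent { st with pool := pool, inbox := inbox } := by
  have hq : ∀ b, st.senders b ⊆
      ({ st with pool := pool, inbox := inbox } : NodeState N Addr Cur World Call).senders b :=
    fun b q hq => hinbox hq
  constructor
  · exact h.replay_eq
  · exact fun tx htx => hpool (h.decided_pool tx htx)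
  · exact fun k v hk => let ⟨r, hr⟩ := h.decided_quorum k v hk; ⟨r, hr.mono (hq _)⟩
  · exact h.prevoteTimer
  · exact h.precommitTimer
  · exact h.polkaSeen
  · exact h.proposeTimer
  · intro hp
    obtain ⟨v, vr, hm, htx, hk⟩ := h.proposed hp
    exact ⟨v, vr, hm, fun tx h => hpool (htx tx h),
      fun k e => ⟨(hk k e).1, (hk k e).2.mono (hq _)⟩⟩
  · exact h.prevoted
  · exact h.precommitted
  · exact h.locked
  · intro k v hl
    obtain ⟨h1, h2, h3, h4, h5⟩ := h.lastValid k v hl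
    exact ⟨h1, h2, h3, fun tx h => hpool (h4 tx h), h5.mono (hq _)⟩

/-- A lock or valid block of the current round is recorded only in the phase `precommit` or on
entering it, which keeps the corresponding clauses true. Rules that start a round go through
`PreRoundInv`. -/
theorem NodeInv.rule {past : Set ℝ} {sent : Set (Msg N Addr Cur Call)}
    (h : NodeInv P p past sent st) (hr : Rule P p t st st' out) :
    NodeInv P p (insert t past) (sent ∪ out) st' := by
  have hm := h.mono (Set.subset_insert t past) (Set.subset_union_left (t := out))
  cases hr with
  | prevoteNew v vote hphase hprop hvote =>
    exact { hm with
      polkaSeen := fun hf => by have := (h.polkaSeen hf).1; simp [hphase] at this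
      proposeTimer := fun h => by cases h
      prevoted := fun _ => ⟨vote, Or.inr rfl⟩
      precommitted := fun h => by cases h
      locked := fun k b hl => ⟨(h.locked k b hl).1, fun e => by
        have := (h.locked k b hl).2.1 e; simp [hphase] at this, (h.locked k b hl).2.2⟩
      lastValid := fun k b hl => ⟨(h.lastValid k b hl).1, fun e => by
        have := (h.lastValid k b hl).2.1 e; simp [hphase] at this, (h.lastValid k b hl).2.2⟩ }
  | prevoteOld v vr vote hphase hprop hvr hpolka hvote =>
    exact { hm with
      polkaSeen := fun hf => by have := (h.polkaSeen hf).1; simp [hphase] at this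
      proposeTimer := fun h => by cases h
      prevoted := fun _ => ⟨vote, Or.inr rfl⟩
      precommitted := fun h => by cases h
      locked := fun k b hl => ⟨(h.locked k b hl).1, fun e => by
        have := (h.locked k b hl).2.1 e; simp [hphase] at this, (h.locked k b hl).2.2⟩
      lastValid := fun k b hl => ⟨(h.lastValid k b hl).1, fun e => by
        have := (h.lastValid k b hl).2.1 e; simp [hphase] at this, (h.lastValid k b hl).2.2⟩ }
  | prevoteWait hphase hfirst hquorum =>
    exact { hm with
      prevoteTimer := fun _ => ⟨t, Set.mem_insert _ _, Set.mem_insert _ _⟩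
      precommitTimer := fun hf => let ⟨s, hs, hd⟩ := hm.precommitTimer hf
        ⟨s, hs, Set.mem_insert_of_mem _ hd⟩
      proposeTimer := fun hf hne => let ⟨d, hd⟩ := hm.proposeTimer hf hne
        ⟨d, Set.mem_insert_of_mem _ hd⟩ }
  | lock v vr hphase hfirst hprop hpolka hvalid =>
    exact { hm with
      polkaSeen := fun _ => ⟨rfl, v, rfl⟩
      proposeTimer := fun h => by cases h
      prevoted := fun _ => hm.prevoted (by simp [hphase])
      precommitted := fun _ => ⟨some v, Or.inr rfl⟩
      locked := fun k b hl => by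
        obtain ⟨rfl, rfl⟩ := Prod.mk.inj (Option.some.inj hl)
        exact ⟨le_rfl, fun _ => rfl, _, _, rfl, le_rfl⟩
      lastValid := fun k b hl => by
        obtain ⟨rfl, rfl⟩ := Prod.mk.inj (Option.some.inj hl)
        exact ⟨le_rfl, fun _ => rfl, hvalid, hprop.2, hpolka⟩ }
  | markValid v vr hphase hfirst hprop hpolka hvalid =>
    exact { hm with
      polkaSeen := fun _ => ⟨hphase, v, rfl⟩
      locked := fun k b hl => ⟨(h.locked k b hl).1, (h.locked k b hl).2.1, _, _, rfl,
        (h.locked k b hl).1⟩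
      lastValid := fun k b hl => by
        obtain ⟨rfl, rfl⟩ := Prod.mk.inj (Option.some.inj hl)
        exact ⟨le_rfl, fun _ => hphase, hvalid, hprop.2, hpolka⟩ }
  | precommitNil hphase hquorum =>
    exact { hm with
      polkaSeen := fun hf => ⟨rfl, (h.polkaSeen hf).2⟩
      proposeTimer := fun h => by cases h
      prevoted := fun _ => hm.prevoted (by simp [hphase])
      precommitted := fun _ => ⟨none, Or.inr rfl⟩
      locked := fun k b hl => ⟨(h.locked k b hl).1, fun _ => rfl, (h.locked k b hl).2.2⟩
      lastValid := fun k b hl =>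
        ⟨(h.lastValid k b hl).1, fun _ => rfl, (h.lastValid k b hl).2.2⟩ }
  | precommitWait hfirst hquorum =>
    exact { hm with
      precommitTimer := fun _ => ⟨t, Set.mem_insert _ _, Set.mem_insert _ _⟩
      prevoteTimer := fun hf => let ⟨s, hs, hd⟩ := hm.prevoteTimer hf
        ⟨s, hs, Set.mem_insert_of_mem _ hd⟩
      proposeTimer := fun hf hne => let ⟨d, hd⟩ := hm.proposeTimer hf hne
        ⟨d, Set.mem_insert_of_mem _ hd⟩ }
  | decide r v vr σ _ _ hprop hquorum hvalid hstart =>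
    refine PreRoundInv.nodeInv ?_ hstart _ Set.subset_union_right
    constructor
    · simp [replay_append_singleton, h.replay_eq, hvalid]
    · intro tx htx
      simp only [List.flatten_append, List.flatten_singleton, List.mem_append] at htx
      rcases htx with htx | htx
      · exact h.decided_pool tx htx
      · exact hprop.2 tx htx
    · intro k w hk
      simp only [List.getElem?_append] at hk
      split_ifs at hk with hlt
      · exact h.decided_quorum k w hk
      · have hk0 : k = st.decided.length := by
          by_contra hne
          rw [List.getElem?_eq_none (by simp; omega)] at hk
          cases hk
        subst hk0
        simp only [Nat.sub_self, List.getElem?_cons_zero, Option.some.injEq] at hk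
        subst hk
        exact ⟨r, hquorum⟩
    · intro k b hl; cases hl
    · intro k b hl; cases hl
  | skip r _ _ hr hthird hstart =>
    exact (h.preRoundInv hr).nodeInv hstart _ Set.subset_union_right
  | timeoutPropose hphase htimer =>
    exact { hm with
      polkaSeen := fun hf => by have := (h.polkaSeen hf).1; simp [hphase] at this
      proposeTimer := fun h => by cases h
      prevoted := fun _ => ⟨none, Or.inr rfl⟩
      precommitted := fun h => by cases h
      locked := fun k b hl => ⟨(h.locked k b hl).1, fun e => by
        have := (h.locked k b hl).2.1 e; simp [hphase] at this, (h.locked k b hl).2.2⟩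
      lastValid := fun k b hl => ⟨(h.lastValid k b hl).1, fun e => by
        have := (h.lastValid k b hl).2.1 e; simp [hphase] at this, (h.lastValid k b hl).2.2⟩ }
  | timeoutPrevote hphase htimer =>
    exact { hm with
      polkaSeen := fun hf => ⟨rfl, (h.polkaSeen hf).2⟩
      proposeTimer := fun h => by cases h
      prevoted := fun _ => hm.prevoted (by simp [hphase])
      precommitted := fun _ => ⟨none, Or.inr rfl⟩
      locked := fun k b hl => ⟨(h.locked k b hl).1, fun _ => rfl, (h.locked k b hl).2.2⟩
      lastValid := fun k b hl =>
        ⟨(h.lastValid k b hl).1, fun _ => rfl, (h.lastValid k b hl).2.2⟩ }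
  | timeoutPrecommit _ _ htimer hstart =>
    exact (h.preRoundInv (Nat.lt_succ_self _)).nodeInv hstart _ Set.subset_union_right

end Local

end MStableChain

namespace MStableChain

/-! ## Effects of a single rule -/

section Rules

variable {N : ℕ} [NeZero N] {Addr Cur World Call : Type*} [DecidableEq Addr] [DecidableEq Cur]
  {P : Params Addr Cur World Call} {p : Fin N} {t : ℝ}
  {st st' : NodeState N Addr Cur World Call} {out : Set (Msg N Addr Cur Call)}

theorem StartRound.Spec.height_eq {r : ℕ} (h : StartRound.Spec P p t st r st' out) :
    st'.height = st.height := by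
  simp [NodeState.height, h.decided]

theorem StartRound.Spec.timers_subset {r : ℕ} (h : StartRound.Spec P p t st r st' out) :
    st.timers ⊆ st'.timers := by
  rcases h.out_timers with ⟨-, -, ht⟩ | ⟨-, ht, -⟩ <;> rw [ht]
  exact Set.subset_insert _ _

/-- The lexicographic position is a clock that never runs back: a decision resets the round but
raises the height. Arguments of the kind "at most once" and "earlier than" reduce to this. -/
theorem Rule.mono (h : Rule P p t st st' out) :
    st.pool ⊆ st'.pool ∧ st.inbox ⊆ st'.inbox ∧ st.timers ⊆ st'.timers ∧
    st.decided <+: st'.decided ∧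
    PosLE st.height st.round st.phase.num st'.height st'.round st'.phase.num := by
  have refl : ∀ s : NodeState N Addr Cur World Call, s.decided <+: s.decided :=
    fun s => List.prefix_refl _
  cases h with
  | prevoteNew v vote hphase hprop hvote =>
    exact ⟨subset_rfl, subset_rfl, subset_rfl, refl _,
      Or.inr ⟨rfl, Or.inr ⟨rfl, by simp [hphase, Phase.num]⟩⟩⟩
  | prevoteOld v vr vote hphase hprop hvr hpolka hvote =>
    exact ⟨subset_rfl, subset_rfl, subset_rfl, refl _,
      Or.inr ⟨rfl, Or.inr ⟨rfl, by simp [hphase, Phase.num]⟩⟩⟩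
  | prevoteWait hphase hfirst hquorum =>
    exact ⟨subset_rfl, subset_rfl, Set.subset_insert _ _, refl _,
      Or.inr ⟨rfl, Or.inr ⟨rfl, le_rfl⟩⟩⟩
  | lock v vr hphase hfirst hprop hpolka hvalid =>
    exact ⟨subset_rfl, subset_rfl, subset_rfl, refl _,
      Or.inr ⟨rfl, Or.inr ⟨rfl, by simp [hphase, Phase.num]⟩⟩⟩
  | markValid v vr hphase hfirst hprop hpolka hvalid =>
    exact ⟨subset_rfl, subset_rfl, subset_rfl, refl _, Or.inr ⟨rfl, Or.inr ⟨rfl, le_rfl⟩⟩⟩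
  | precommitNil hphase hquorum =>
    exact ⟨subset_rfl, subset_rfl, subset_rfl, refl _,
      Or.inr ⟨rfl, Or.inr ⟨rfl, by simp [hphase, Phase.num]⟩⟩⟩
  | precommitWait hfirst hquorum =>
    exact ⟨subset_rfl, subset_rfl, Set.subset_insert _ _, refl _,
      Or.inr ⟨rfl, Or.inr ⟨rfl, le_rfl⟩⟩⟩
  | decide r v vr σ _ _ hprop hquorum hvalid hstart =>
    have hs := hstart.spec
    refine ⟨hs.pool.ge, hs.inbox.ge, hs.timers_subset, ?_, Or.inl ?_⟩
    · rw [hs.decided]; exact List.prefix_append _ _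
    · rw [hs.height_eq]; simp [NodeState.height]
  | skip r _ _ hr hthird hstart =>
    have hs := hstart.spec
    refine ⟨hs.pool.ge, hs.inbox.ge, hs.timers_subset, ?_, Or.inr ⟨hs.height_eq.symm, Or.inl ?_⟩⟩
    · rw [hs.decided]
    · rw [hs.round]; exact hr
  | timeoutPropose hphase htimer =>
    exact ⟨subset_rfl, subset_rfl, subset_rfl, refl _,
      Or.inr ⟨rfl, Or.inr ⟨rfl, by simp [hphase, Phase.num]⟩⟩⟩
  | timeoutPrevote hphase htimer =>
    exact ⟨subset_rfl, subset_rfl, subset_rfl, refl _,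
      Or.inr ⟨rfl, Or.inr ⟨rfl, by simp [hphase, Phase.num]⟩⟩⟩
  | timeoutPrecommit _ _ htimer hstart =>
    have hs := hstart.spec
    refine ⟨hs.pool.ge, hs.inbox.ge, hs.timers_subset, ?_, Or.inr ⟨hs.height_eq.symm, Or.inl ?_⟩⟩
    · rw [hs.decided]
    · rw [hs.round]; exact Nat.lt_succ_self _

theorem Rule.inbox_eq (h : Rule P p t st st' out) : st'.inbox = st.inbox := by
  cases h with
  | decide r v vr σ _ _ hprop hquorum hvalid hstart => exact hstart.spec.inbox
  | skip r _ _ hr hthird hstart => exact hstart.spec.inbox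
  | timeoutPrecommit _ _ htimer hstart => exact hstart.spec.inbox
  | _ => rfl

theorem Rule.pool_eq (h : Rule P p t st st' out) : st'.pool = st.pool := by
  cases h with
  | decide r v vr σ _ _ hprop hquorum hvalid hstart => exact hstart.spec.pool
  | skip r _ _ hr hthird hstart => exact hstart.spec.pool
  | timeoutPrecommit _ _ htimer hstart => exact hstart.spec.pool
  | _ => rfl

theorem Rule.out_subsingleton (h : Rule P p t st st' out) : out.Subsingleton := by
  have start : ∀ {s s' : NodeState N Addr Cur World Call} {r : ℕ}, StartRound P p t s r s' out →
      out.Subsingleton := by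
    intro s s' r hs
    rcases hs.spec.out_timers with ⟨-, rfl, -⟩ | ⟨-, -, v, vr, rfl, -⟩
    · exact Set.subsingleton_empty
    · exact Set.subsingleton_singleton
  cases h with
  | decide r v vr σ _ _ hprop hquorum hvalid hstart => exact start hstart
  | skip r _ _ hr hthird hstart => exact start hstart
  | timeoutPrecommit _ _ htimer hstart => exact start hstart
  | _ => first | exact Set.subsingleton_singleton | exact Set.subsingleton_empty

/-- Within a height, the lock changes only by locking on a block with a quorum of prevotes. -/
theorem Rule.locked_cases (h : Rule P p t st st' out) (hh : st'.height = st.height) :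
    st'.locked = st.locked ∨ ∃ v vr, st.phase = .prevote ∧ st.HasProposal st.round v vr ∧
      IsQuorum (st.senders (.prevote st.height st.round (some v))) ∧ st.Valid P v ∧
      st'.locked = some (st.round, v) := by
  cases h with
  | lock v vr hphase hfirst hprop hpolka hvalid =>
    exact Or.inr ⟨v, vr, hphase, hprop, hpolka, hvalid, rfl⟩
  | decide r v vr σ _ _ hprop hquorum hvalid hstart =>
    rw [hstart.spec.height_eq] at hh; simp [NodeState.height] at hh
  | skip r _ _ hr hthird hstart => exact Or.inl hstart.spec.locked
  | timeoutPrecommit _ _ htimer hstart => exact Or.inl hstart.spec.locked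
  | _ => exact Or.inl rfl

theorem Rule.lastValid_cases (h : Rule P p t st st' out) (hh : st'.height = st.height) :
    st'.lastValid = st.lastValid ∨ ∃ v, st'.lastValid = some (st.round, v) := by
  cases h with
  | lock v vr hphase hfirst hprop hpolka hvalid => exact Or.inr ⟨v, rfl⟩
  | markValid v vr hphase hfirst hprop hpolka hvalid => exact Or.inr ⟨v, rfl⟩
  | decide r v vr σ _ _ hprop hquorum hvalid hstart =>
    rw [hstart.spec.height_eq] at hh; simp [NodeState.height] at hh
  | skip r _ _ hr hthird hstart => exact Or.inl hstart.spec.lastValid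
  | timeoutPrecommit _ _ htimer hstart => exact Or.inl hstart.spec.lastValid
  | _ => exact Or.inl rfl

/-- Why a node in state `st` prevotes `x` in its current round. -/
def PrevoteReason (P : Params Addr Cur World Call) (t : ℝ) (st : NodeState N Addr Cur World Call)
    (x : Option (Block Addr Cur Call)) : Prop :=
  (∃ v vr, st.HasProposal st.round v vr ∧
    (∀ k, vr = some k → k < st.round ∧
      IsQuorum (st.senders (.prevote st.height k (some v)))) ∧
    VoteIf (st.Valid P v ∧ ∀ k b, st.locked = some (k, b) →
      b = v ∨ ∃ k', vr = some k' ∧ k ≤ k') v x) ∨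
  (x = none ∧ st.Expired t .propose)

/-- Why a node in state `st` precommits `x` in its current round, passing to `st'`. -/
def PrecommitReason (P : Params Addr Cur World Call) (t : ℝ)
    (st st' : NodeState N Addr Cur World Call) (x : Option (Block Addr Cur Call)) : Prop :=
  (∃ v vr, x = some v ∧ st.HasProposal st.round v vr ∧
    IsQuorum (st.senders (.prevote st.height st.round (some v))) ∧ st.Valid P v ∧
    st'.locked = some (st.round, v)) ∨
  (x = none ∧ IsQuorum (st.senders (.prevote st.height st.round none))) ∨
  (x = none ∧ st.Expired t .prevote)

theorem StartRound.Spec.out_eq {r : ℕ} (h : StartRound.Spec P p t st r st' out)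
    {m : Msg N Addr Cur Call} (hm : m ∈ out) : proposer N st.height r = p ∧ ∃ v vr,
      out = {m} ∧ m = ⟨p, .proposal st.height r v vr⟩ ∧
      ((∃ k, vr = some k ∧ st.lastValid = some (k, v)) ∨
        (vr = none ∧ st.lastValid = none ∧ st.Valid P v ∧ ∀ tx ∈ v, tx ∈ st.pool)) := by
  rcases h.out_timers with ⟨-, rfl, -⟩ | ⟨hp, -, v, vr, rfl, hcase⟩
  · cases hm
  · obtain rfl := hm
    exact ⟨hp, v, vr, rfl, rfl, hcase⟩

/-- `PrevoteReason` merges both prevote rules on proposals: for `vr = none` the alternative `k ≤ k'`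
is void, which leaves the stricter lock condition of a fresh proposal. -/
theorem Rule.prevote_out (h : Rule P p t st st' out) {q : Fin N} {k r : ℕ}
    {x : Option (Block Addr Cur Call)}
    (hm : (⟨q, .prevote k r x⟩ : Msg N Addr Cur Call) ∈ out) :
    q = p ∧ k = st.height ∧ r = st.round ∧ st.phase = .propose ∧
      st' = { st with phase := .prevote } ∧ PrevoteReason P t st x := by
  cases h with
  | prevoteNew v vote hphase hprop hvote =>
    simp only [Set.mem_singleton_iff, Msg.mk.injEq, MsgBody.prevote.injEq] at hm
    obtain ⟨rfl, rfl, rfl, rfl⟩ := hm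
    refine ⟨rfl, rfl, rfl, hphase, rfl, Or.inl ⟨v, none, hprop, by simp, ?_⟩⟩
    simpa using hvote
  | prevoteOld v vr vote hphase hprop hvr hpolka hvote =>
    simp only [Set.mem_singleton_iff, Msg.mk.injEq, MsgBody.prevote.injEq] at hm
    obtain ⟨rfl, rfl, rfl, rfl⟩ := hm
    refine ⟨rfl, rfl, rfl, hphase, rfl, Or.inl ⟨v, some vr, hprop, ?_, ?_⟩⟩
    · intro k hk
      obtain rfl := Option.some.inj hk
      exact ⟨hvr, hpolka⟩
    · simpa [or_comm] using hvote
  | timeoutPropose hphase htimer =>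
    simp only [Set.mem_singleton_iff, Msg.mk.injEq, MsgBody.prevote.injEq] at hm
    obtain ⟨rfl, rfl, rfl, rfl⟩ := hm
    exact ⟨rfl, rfl, rfl, hphase, rfl, Or.inr ⟨rfl, htimer⟩⟩
  | decide r v vr σ _ _ hprop hquorum hvalid hstart =>
    obtain ⟨-, _, _, -, h, -⟩ := hstart.spec.out_eq hm; simp at h
  | skip r _ _ hr hthird hstart => obtain ⟨-, _, _, -, h, -⟩ := hstart.spec.out_eq hm; simp at h
  | timeoutPrecommit _ _ htimer hstart =>
    obtain ⟨-, _, _, -, h, -⟩ := hstart.spec.out_eq hm; simp at h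
  | _ => simp at hm

theorem Rule.precommit_out (h : Rule P p t st st' out) {q : Fin N} {k r : ℕ}
    {x : Option (Block Addr Cur Call)}
    (hm : (⟨q, .precommit k r x⟩ : Msg N Addr Cur Call) ∈ out) :
    q = p ∧ k = st.height ∧ r = st.round ∧ st.phase = .prevote ∧ st'.height = st.height ∧
      st'.round = st.round ∧ st'.phase = .precommit ∧ PrecommitReason P t st st' x := by
  cases h with
  | lock v vr hphase hfirst hprop hpolka hvalid =>
    simp only [Set.mem_singleton_iff, Msg.mk.injEq, MsgBody.precommit.injEq] at hm
    obtain ⟨rfl, rfl, rfl, rfl⟩ := hm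
    exact ⟨rfl, rfl, rfl, hphase, rfl, rfl, rfl, Or.inl ⟨v, vr, rfl, hprop, hpolka, hvalid, rfl⟩⟩
  | precommitNil hphase hquorum =>
    simp only [Set.mem_singleton_iff, Msg.mk.injEq, MsgBody.precommit.injEq] at hm
    obtain ⟨rfl, rfl, rfl, rfl⟩ := hm
    exact ⟨rfl, rfl, rfl, hphase, rfl, rfl, rfl, Or.inr (Or.inl ⟨rfl, hquorum⟩)⟩
  | timeoutPrevote hphase htimer =>
    simp only [Set.mem_singleton_iff, Msg.mk.injEq, MsgBody.precommit.injEq] at hm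
    obtain ⟨rfl, rfl, rfl, rfl⟩ := hm
    exact ⟨rfl, rfl, rfl, hphase, rfl, rfl, rfl, Or.inr (Or.inr ⟨rfl, htimer⟩)⟩
  | decide r v vr σ _ _ hprop hquorum hvalid hstart =>
    obtain ⟨-, _, _, -, h, -⟩ := hstart.spec.out_eq hm; simp at h
  | skip r _ _ hr hthird hstart => obtain ⟨-, _, _, -, h, -⟩ := hstart.spec.out_eq hm; simp at h
  | timeoutPrecommit _ _ htimer hstart =>
    obtain ⟨-, _, _, -, h, -⟩ := hstart.spec.out_eq hm; simp at h
  | _ => simp at hm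

/-- What holds of the state `st` of a node when it has just proposed `v` with valid round `vr`. -/
def Proposes (P : Params Addr Cur World Call) (st : NodeState N Addr Cur World Call)
    (v : Block Addr Cur Call) (vr : Option ℕ) : Prop :=
  st.phase = .propose ∧ ((∃ k, vr = some k ∧ st.lastValid = some (k, v)) ∨
    (vr = none ∧ st.lastValid = none ∧ st.Valid P v ∧ ∀ tx ∈ v, tx ∈ st.pool))

theorem StartRound.Spec.proposes {r : ℕ} (h : StartRound.Spec P p t st r st' out) {q : Fin N}
    {k r' : ℕ} {v : Block Addr Cur Call} {vr : Option ℕ}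
    (hm : (⟨q, .proposal k r' v vr⟩ : Msg N Addr Cur Call) ∈ out) :
    q = p ∧ st'.height = k ∧ st'.round = r' ∧
      out = {⟨q, .proposal k r' v vr⟩} ∧ Proposes P st' v vr := by
  obtain ⟨hp, v', vr', ho, heq, hcase⟩ := h.out_eq hm
  simp only [Msg.mk.injEq, MsgBody.proposal.injEq] at heq
  obtain ⟨rfl, rfl, rfl, rfl, rfl⟩ := heq
  refine ⟨rfl, h.height_eq, h.round, ho, h.phase, ?_⟩
  simpa [h.lastValid, h.pool, NodeState.Valid, h.ledger] using hcase

/-- A proposal is made only on entering a round, so the node was strictly before that position; this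
is why it cannot propose twice. -/
theorem Rule.proposal_out (h : Rule P p t st st' out) {q : Fin N} {k r : ℕ}
    {v : Block Addr Cur Call} {vr : Option ℕ}
    (hm : (⟨q, .proposal k r v vr⟩ : Msg N Addr Cur Call) ∈ out) :
    q = p ∧ st'.height = k ∧ st'.round = r ∧ ¬ PosLE k r 0 st.height st.round st.phase.num ∧
      out = {⟨q, .proposal k r v vr⟩} ∧ Proposes P st' v vr := by
  cases h with
  | decide r' v' vr' σ _ _ hprop hquorum hvalid hstart =>
    obtain ⟨h1, rfl, rfl, h4⟩ := hstart.spec.proposes hm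
    refine ⟨h1, rfl, rfl, ?_, h4⟩
    rw [hstart.spec.height_eq]
    simp [PosLE, NodeState.height]
  | skip r' _ _ hr hthird hstart =>
    obtain ⟨h1, rfl, rfl, h4⟩ := hstart.spec.proposes hm
    refine ⟨h1, rfl, rfl, ?_, h4⟩
    rw [hstart.spec.height_eq, hstart.spec.round]
    unfold PosLE; omega
  | timeoutPrecommit _ _ htimer hstart =>
    obtain ⟨h1, rfl, rfl, h4⟩ := hstart.spec.proposes hm
    refine ⟨h1, rfl, rfl, ?_, h4⟩
    rw [hstart.spec.height_eq, hstart.spec.round]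
    unfold PosLE; omega
  | _ => simp at hm

/-- The condition under which a timeout is scheduled, in state `st` before and `st'` after. -/
def TimerReason (P : Params Addr Cur World Call) (t : ℝ)
    (st st' : NodeState N Addr Cur World Call) (tm : Timer) : Prop :=
  tm.deadline = t + P.timeout tm.phase tm.round ∧ st'.height = tm.height ∧ st'.round = tm.round ∧
  (tm.phase ≠ .propose → st.height = tm.height ∧ st.round = tm.round) ∧
  (tm.phase = .prevote →
    IsQuorum {q | ∃ x, q ∈ st.senders (.prevote tm.height tm.round x)}) ∧
  (tm.phase = .precommit →
    IsQuorum {q | ∃ x, q ∈ st.senders (.precommit tm.height tm.round x)})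

theorem StartRound.Spec.timerReason {r : ℕ} (h : StartRound.Spec P p t st r st' out)
    {st₀ : NodeState N Addr Cur World Call} {tm : Timer} (hm : tm ∈ st'.timers) :
    tm ∈ st.timers ∨ TimerReason P t st₀ st' tm := by
  rcases h.out_timers with ⟨-, -, ht⟩ | ⟨-, ht, -⟩
  · rw [ht] at hm
    rcases Set.mem_insert_iff.1 hm with rfl | hm
    · exact Or.inr ⟨rfl, h.height_eq, h.round, fun h => absurd rfl h, nofun, nofun⟩
    · exact Or.inl hm
  · rw [ht] at hm; exact Or.inl hm

theorem Rule.timers_cases (h : Rule P p t st st' out) {tm : Timer} (hm : tm ∈ st'.timers) :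
    tm ∈ st.timers ∨ TimerReason P t st st' tm := by
  cases h with
  | prevoteWait hphase hfirst hquorum =>
    rcases Set.mem_insert_iff.1 hm with rfl | hm
    · exact Or.inr ⟨rfl, rfl, rfl, fun _ => ⟨rfl, rfl⟩, fun _ => hquorum, nofun⟩
    · exact Or.inl hm
  | precommitWait hfirst hquorum =>
    rcases Set.mem_insert_iff.1 hm with rfl | hm
    · exact Or.inr ⟨rfl, rfl, rfl, fun _ => ⟨rfl, rfl⟩, nofun, fun _ => hquorum⟩
    · exact Or.inl hm
  | decide r' v' vr' σ _ _ hprop hquorum hvalid hstart => exact hstart.spec.timerReason hm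
  | skip r' _ _ hr hthird hstart => exact hstart.spec.timerReason hm
  | timeoutPrecommit _ _ htimer hstart => exact hstart.spec.timerReason hm
  | _ => exact Or.inl hm

/-- How a node gets to another position. -/
theorem Rule.round_cases (h : Rule P p t st st' out) :
    (st'.height = st.height ∧ st'.round = st.round) ∨
    (st'.height = st.height + 1 ∧ st'.round = 0 ∧ st'.locked = none ∧ ∃ r v vr, st.HasProposal r v vr ∧
      IsQuorum (st.senders (.precommit st.height r (some v))) ∧ st.Valid P v) ∨
    (st'.height = st.height ∧ st.round < st'.round ∧
      IsThird {q | ∃ b, q ∈ st.senders b ∧ b.height = st.height ∧ b.round = st'.round}) ∨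
    (st'.height = st.height ∧ st'.round = st.round + 1 ∧ st.Expired t .precommit) := by
  cases h with
  | decide r' v' vr' σ _ _ hprop hquorum hvalid hstart =>
    refine Or.inr (Or.inl ⟨?_, hstart.spec.round,
      hstart.spec.locked, r', v', vr', hprop, hquorum, σ, hvalid⟩)
    rw [hstart.spec.height_eq]; simp [NodeState.height]
  | skip r' _ _ hr hthird hstart =>
    have hs := hstart.spec
    exact Or.inr (Or.inr (Or.inl ⟨hs.height_eq, by rw [hs.round]; exact hr,
      by rw [hs.round]; exact hthird⟩))
  | timeoutPrecommit _ _ htimer hstart =>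
    have hs := hstart.spec
    exact Or.inr (Or.inr (Or.inr ⟨hs.height_eq, hs.round, htimer⟩))
  | _ => exact Or.inl ⟨rfl, rfl⟩

end Rules

end MStableChain

namespace MStableChain

/-- A property that holds at `j` holds from the start, or starts to hold at some step before. -/
theorem exists_crossing {Q : ℕ → Prop} {j : ℕ} (hj : Q j) :
    Q 0 ∨ ∃ i < j, ¬ Q i ∧ Q (i + 1) := by
  induction j with
  | zero => exact Or.inl hj
  | succ j ih =>
    by_cases h : Q j
    · rcases ih h with h | ⟨i, hi, h⟩
      · exact Or.inl h
      · exact Or.inr ⟨i, by omega, h⟩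
    · exact Or.inr ⟨j, by omega, h, hj⟩

namespace Execution

variable {N : ℕ} [NeZero N] {Addr Cur World Call : Type*} [DecidableEq Addr] [DecidableEq Cur]
  {P : Params Addr Cur World Call} {byz : Finset (Fin N)} (ex : Execution P byz)

/-! ## Steps of an execution -/

/-- The state of node `p` before event number `i`. -/
abbrev st (i : ℕ) (p : Fin N) : NodeState N Addr Cur World Call := (ex.cfg i).node p

/-- Seen from one node, an event is either a growth of its `pool` and `inbox` or one of its own
rules; submissions and events at other nodes count as trivial growth. -/
theorem step_cases (i : ℕ) (p : Fin N) :
    (∃ pool inbox, ex.st (i + 1) p = { ex.st i p with pool := pool, inbox := inbox } ∧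
      (ex.st i p).pool ⊆ pool ∧ (ex.st i p).inbox ⊆ inbox ∧
      pool ⊆ (ex.st i p).pool ∪ (ex.cfg i).rpcLog ∧
      ∀ m ∈ inbox, m ∈ (ex.st i p).inbox ∨ m.sender ∈ byz ∨ m ∈ (ex.cfg i).sent) ∨
    ∃ out, Rule P p (ex.time i) (ex.st i p) (ex.st (i + 1) p) out ∧
      (ex.cfg (i + 1)).sent = (ex.cfg i).sent ∪ out := by
  have hstep := ex.step i
  have same : ∀ c : Config N Addr Cur World Call, c.node p = ex.st i p →
      ∃ pool inbox, c.node p = { ex.st i p with pool := pool, inbox := inbox } ∧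
      (ex.st i p).pool ⊆ pool ∧ (ex.st i p).inbox ⊆ inbox ∧
      pool ⊆ (ex.st i p).pool ∪ (ex.cfg i).rpcLog ∧
      ∀ m ∈ inbox, m ∈ (ex.st i p).inbox ∨ m.sender ∈ byz ∨ m ∈ (ex.cfg i).sent :=
    fun c hc => ⟨(ex.st i p).pool, (ex.st i p).inbox, hc, subset_rfl, subset_rfl,
      Set.subset_union_left, fun m hm => Or.inl hm⟩
  unfold st at *
  generalize ex.cfg (i + 1) = c' at *
  generalize ex.event i = e at hstep
  cases hstep with
  | submit s c _ => exact Or.inl (same _ rfl)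
  | deliver q m hq hm =>
    by_cases hqp : p = q
    · subst hqp
      refine Or.inl ⟨((ex.cfg i).node p).pool, insert m ((ex.cfg i).node p).inbox,
        by simp [Config.setNode], subset_rfl, Set.subset_insert _ _, Set.subset_union_left, ?_⟩
      intro m' hm'
      rcases Set.mem_insert_iff.1 hm' with rfl | hm'
      · exact Or.inr hm
      · exact Or.inl hm'
    · exact Or.inl (same _ (by simp [Config.setNode, hqp]))
  | deliverTx q tx hq htx =>
    by_cases hqp : p = q
    · subst hqp
      refine Or.inl ⟨insert tx ((ex.cfg i).node p).pool, ((ex.cfg i).node p).inbox,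
        by simp [Config.setNode], Set.subset_insert _ _, subset_rfl, ?_, fun m hm => Or.inl hm⟩
      exact Set.insert_subset (Or.inr htx) Set.subset_union_left
    · exact Or.inl (same _ (by simp [Config.setNode, hqp]))
  | act q st' out hq hrule =>
    by_cases hqp : p = q
    · subst hqp
      exact Or.inr ⟨out, by simpa [Config.setNode] using hrule, rfl⟩
    · exact Or.inl (same _ (by simp [Config.setNode, hqp]))
  | wait => exact Or.inl (same _ rfl)

theorem sent_step (i : ℕ) {m : Msg N Addr Cur Call} (hm : m ∈ (ex.cfg (i + 1)).sent) :
    m ∈ (ex.cfg i).sent ∨ ∃ p, p ∉ byz ∧ ∃ out,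
      Rule P p (ex.time i) (ex.st i p) (ex.st (i + 1) p) out ∧ m ∈ out ∧
      (ex.cfg (i + 1)).sent = (ex.cfg i).sent ∪ out := by
  have hstep := ex.step i
  unfold st
  generalize ex.cfg (i + 1) = c' at *
  generalize ex.event i = e at hstep
  cases hstep with
  | act q st' out hq hrule =>
    rcases hm with hm | hm
    · exact Or.inl hm
    · exact Or.inr ⟨q, hq, out, by simpa [Config.setNode] using hrule, hm, rfl⟩
  | _ => exact Or.inl hm

theorem sent_mono {i j : ℕ} (hij : i ≤ j) : (ex.cfg i).sent ⊆ (ex.cfg j).sent := by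
  induction hij with
  | refl => exact subset_rfl
  | @step j _ ih =>
    refine ih.trans ?_
    have hstep := ex.step j
    change _ ⊆ (ex.cfg (j + 1)).sent
    generalize ex.cfg (j + 1) = c' at *
    generalize ex.event j = e at hstep
    cases hstep with
    | act q st' out hq hrule => exact Set.subset_union_left
    | _ => exact subset_rfl

theorem rpcLog_step (i : ℕ) {tx : Tx Addr Cur Call} (h : tx ∈ (ex.cfg (i + 1)).rpcLog) :
    tx ∈ (ex.cfg i).rpcLog ∨ (ex.event i = .submit tx.body tx.currency ∧
      ∀ rates, tx.body.sender = P.oracle → tx.body.payload = .oracleUpdate rates →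
        rates = ex.externalRates (ex.time i)) := by
  have hstep := ex.step i
  generalize ex.cfg (i + 1) = c' at *
  generalize ex.event i = e at hstep
  cases hstep with
  | submit s c ho =>
    rcases h with rfl | h
    · exact Or.inr ⟨rfl, ho⟩
    · exact Or.inl h
  | _ => exact Or.inl h

theorem rpcLog_mono {i j : ℕ} (hij : i ≤ j) : (ex.cfg i).rpcLog ⊆ (ex.cfg j).rpcLog := by
  induction hij with
  | refl => exact subset_rfl
  | @step j _ ih =>
    refine ih.trans ?_
    have hstep := ex.step j
    change _ ⊆ (ex.cfg (j + 1)).rpcLog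
    generalize ex.cfg (j + 1) = c' at *
    generalize ex.event j = e at hstep
    cases hstep with
    | submit s c ho => exact Set.subset_insert _ _
    | _ => exact subset_rfl

theorem step_mono (i : ℕ) (p : Fin N) :
    (ex.st i p).pool ⊆ (ex.st (i + 1) p).pool ∧ (ex.st i p).inbox ⊆ (ex.st (i + 1) p).inbox ∧
    (ex.st i p).timers ⊆ (ex.st (i + 1) p).timers ∧
    (ex.st i p).decided <+: (ex.st (i + 1) p).decided ∧
    PosLE (ex.st i p).height (ex.st i p).round (ex.st i p).phase.num
      (ex.st (i + 1) p).height (ex.st (i + 1) p).round (ex.st (i + 1) p).phase.num := by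
  rcases ex.step_cases i p with ⟨pool, inbox, he, h1, h2, -⟩ | ⟨out, hr, -⟩
  · rw [he]
    exact ⟨h1, h2, subset_rfl, List.prefix_refl _, Or.inr ⟨rfl, Or.inr ⟨rfl, le_rfl⟩⟩⟩
  · exact hr.mono

theorem st_mono {i j : ℕ} (hij : i ≤ j) (p : Fin N) :
    (ex.st i p).pool ⊆ (ex.st j p).pool ∧ (ex.st i p).inbox ⊆ (ex.st j p).inbox ∧
    (ex.st i p).timers ⊆ (ex.st j p).timers ∧
    (ex.st i p).decided <+: (ex.st j p).decided ∧
    PosLE (ex.st i p).height (ex.st i p).round (ex.st i p).phase.num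
      (ex.st j p).height (ex.st j p).round (ex.st j p).phase.num := by
  induction hij with
  | refl =>
    exact ⟨subset_rfl, subset_rfl, subset_rfl, List.prefix_refl _, Or.inr ⟨rfl, Or.inr ⟨rfl, le_rfl⟩⟩⟩
  | @step j _ ih =>
    obtain ⟨h1, h2, h3, h4, h5⟩ := ih
    obtain ⟨g1, g2, g3, g4, g5⟩ := ex.step_mono j p
    refine ⟨h1.trans g1, h2.trans g2, h3.trans g3, h4.trans g4, ?_⟩
    simp only [PosLE, Nat.succ_eq_add_one] at *
    omega

theorem pos_mono {i j : ℕ} (hij : i ≤ j) (p : Fin N) :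
    PosLE (ex.st i p).height (ex.st i p).round (ex.st i p).phase.num
      (ex.st j p).height (ex.st j p).round (ex.st j p).phase.num :=
  (ex.st_mono hij p).2.2.2.2

/-- The nodes of which honest nodes may have received a message with contents `b`. -/
def Cast (i : ℕ) (b : MsgBody Addr Cur Call) : Set (Fin N) :=
  {q | q ∈ byz ∨ (⟨q, b⟩ : Msg N Addr Cur Call) ∈ (ex.cfg i).sent}

/-- Unforgeability: messages enter an inbox only by delivery, which requires a malicious signer or
an earlier broadcast. -/
theorem inbox_sent (i : ℕ) {p : Fin N} (hp : p ∉ byz) {m : Msg N Addr Cur Call}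
    (hm : m ∈ (ex.st i p).inbox) : m.sender ∈ byz ∨ m ∈ (ex.cfg i).sent := by
  induction i with
  | zero =>
    obtain ⟨out, h, -⟩ := ex.init
    have := (h p hp).spec.inbox
    rw [st, this] at hm
    cases hm
  | succ i ih =>
    have hs := ex.sent_mono (Nat.le_succ i)
    rcases ex.step_cases i p with ⟨pool, inbox, he, -, -, -, h⟩ | ⟨out, hr, -⟩
    · rw [he] at hm
      rcases h m hm with h | h | h
      · exact (ih h).imp id fun h => hs h
      · exact Or.inl h
      · exact Or.inr (hs h)
    · rw [hr.inbox_eq] at hm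
      exact (ih hm).imp id fun h => hs h

theorem senders_subset_cast (i : ℕ) {p : Fin N} (hp : p ∉ byz) (b : MsgBody Addr Cur Call) :
    (ex.st i p).senders b ⊆ ex.Cast i b :=
  fun _ h => ex.inbox_sent i hp h

theorem pool_rpcLog (i : ℕ) {p : Fin N} (hp : p ∉ byz) :
    (ex.st i p).pool ⊆ (ex.cfg i).rpcLog := by
  induction i with
  | zero =>
    obtain ⟨out, h, -⟩ := ex.init
    have := (h p hp).spec.pool
    rw [st, this]
    exact Set.empty_subset _
  | succ i ih =>
    have hs := ex.rpcLog_mono (Nat.le_succ i)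
    rcases ex.step_cases i p with ⟨pool, inbox, he, -, -, h, -⟩ | ⟨out, hr, -⟩
    · rw [he]
      exact h.trans (Set.union_subset (ih.trans hs) hs)
    · rw [hr.pool_eq]
      exact ih.trans hs

/-- The log starts empty and grows only by submissions. -/
theorem rpcLog_origin {i : ℕ} {tx : Tx Addr Cur Call} (h : tx ∈ (ex.cfg i).rpcLog) :
    ∃ k < i, ex.event k = .submit tx.body tx.currency ∧
      ∀ rates, tx.body.sender = P.oracle → tx.body.payload = .oracleUpdate rates →
        rates = ex.externalRates (ex.time k) := by
  rcases exists_crossing (Q := fun i => tx ∈ (ex.cfg i).rpcLog) h with h | ⟨k, hk, h1, h2⟩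
  · obtain ⟨out, -, -, h0⟩ := ex.init
    rw [h0] at h; cases h
  · exact ⟨k, hk, (ex.rpcLog_step k h2).resolve_left h1⟩

/-- With `past` the times of earlier events, the deadlines of recorded vote timers are at most the
present plus the duration of the timeout. -/
theorem inv (i : ℕ) {p : Fin N} (hp : p ∉ byz) :
    NodeInv P p {s | ∃ k < i, s = ex.time k} (ex.cfg i).sent (ex.st i p) := by
  induction i with
  | zero =>
    obtain ⟨out, h, hs, -⟩ := ex.init
    refine (preRoundInv_blank P).nodeInv (h p hp) _ ?_
    rw [hs]
    exact fun m hm => ⟨p, hp, hm⟩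
  | succ i ih =>
    have hpast : {s | ∃ k < i, s = ex.time k} ⊆ {s | ∃ k < i + 1, s = ex.time k} :=
      fun s ⟨k, hk, h⟩ => ⟨k, by omega, h⟩
    rcases ex.step_cases i p with ⟨pool, inbox, he, h1, h2, -⟩ | ⟨out, hr, hs⟩
    · rw [he]
      exact (ih.receive h1 h2).mono hpast (ex.sent_mono (Nat.le_succ i))
    · rw [hs]
      refine (ih.rule hr).mono (Set.insert_subset ⟨i, by omega, rfl⟩ hpast) subset_rfl

/-! ## Origins of messages, locks and timeouts -/

/-- The position of node `p` before event number `i`. -/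
abbrev At (i : ℕ) (p : Fin N) (h r : ℕ) (ph : Phase) : Prop :=
  (ex.st i p).height = h ∧ (ex.st i p).round = r ∧ (ex.st i p).phase = ph

/-- Initially only proposals have been sent, so there is an event at which the vote first appears.
Going back to it turns the presence of a message into facts about the sender's state at that moment.
-/
theorem prevote_origin {j : ℕ} {q : Fin N} {h r : ℕ} {x : Option (Block Addr Cur Call)}
    (hm : (⟨q, .prevote h r x⟩ : Msg N Addr Cur Call) ∈ (ex.cfg j).sent) :
    q ∉ byz ∧ ∃ i < j, ex.At i q h r .propose ∧ ex.At (i + 1) q h r .prevote ∧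
      PrevoteReason P (ex.time i) (ex.st i q) x := by
  rcases exists_crossing (Q := fun i => _ ∈ (ex.cfg i).sent) hm with hm | ⟨i, hi, h1, h2⟩
  · obtain ⟨out, hst, hs, -⟩ := ex.init
    rw [hs] at hm
    obtain ⟨p, hp, hm⟩ := hm
    obtain ⟨-, _, _, -, h, -⟩ := (hst p hp).spec.out_eq hm
    simp at h
  · obtain ⟨p, hp, out, hr, hmo, -⟩ := (ex.sent_step i h2).resolve_left h1
    obtain ⟨rfl, rfl, rfl, hph, he, hreason⟩ := hr.prevote_out hmo
    exact ⟨hp, i, hi, ⟨rfl, rfl, hph⟩, by rw [At, he]; exact ⟨rfl, rfl, rfl⟩, hreason⟩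

theorem precommit_origin {j : ℕ} {q : Fin N} {h r : ℕ} {x : Option (Block Addr Cur Call)}
    (hm : (⟨q, .precommit h r x⟩ : Msg N Addr Cur Call) ∈ (ex.cfg j).sent) :
    q ∉ byz ∧ ∃ i < j, ex.At i q h r .prevote ∧ ex.At (i + 1) q h r .precommit ∧
      PrecommitReason P (ex.time i) (ex.st i q) (ex.st (i + 1) q) x := by
  rcases exists_crossing (Q := fun i => _ ∈ (ex.cfg i).sent) hm with hm | ⟨i, hi, h1, h2⟩
  · obtain ⟨out, hst, hs, -⟩ := ex.init
    rw [hs] at hm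
    obtain ⟨p, hp, hm⟩ := hm
    obtain ⟨-, _, _, -, h, -⟩ := (hst p hp).spec.out_eq hm
    simp at h
  · obtain ⟨p, hp, out, hr, hmo, -⟩ := (ex.sent_step i h2).resolve_left h1
    obtain ⟨rfl, rfl, rfl, hph, e1, e2, e3, hreason⟩ := hr.precommit_out hmo
    exact ⟨hp, i, hi, ⟨rfl, rfl, hph⟩, ⟨e1, e2, e3⟩, hreason⟩

/-- The state is the one right after sending, because starting the round creates the proposal;
initial proposals count too, hence `i ≤ j`. -/
theorem proposal_origin {j : ℕ} {q : Fin N} {h r : ℕ} {v : Block Addr Cur Call} {vr : Option ℕ}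
    (hm : (⟨q, .proposal h r v vr⟩ : Msg N Addr Cur Call) ∈ (ex.cfg j).sent) :
    q ∉ byz ∧ ∃ i ≤ j, (ex.st i q).height = h ∧ (ex.st i q).round = r ∧
      Proposes P (ex.st i q) v vr := by
  rcases exists_crossing (Q := fun i => _ ∈ (ex.cfg i).sent) hm with hm | ⟨i, hi, h1, h2⟩
  · obtain ⟨out, hst, hs, -⟩ := ex.init
    rw [hs] at hm
    obtain ⟨p, hp, hm⟩ := hm
    obtain ⟨rfl, e1, e2, -, e3⟩ := (hst p hp).spec.proposes hm
    exact ⟨hp, 0, by omega, e1, e2, e3⟩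
  · obtain ⟨p, hp, out, hr, hmo, -⟩ := (ex.sent_step i h2).resolve_left h1
    obtain ⟨rfl, e1, e2, -, -, e3⟩ := hr.proposal_out hmo
    exact ⟨hp, i + 1, hi, e1, e2, e3⟩

/-- An honest node makes at most one proposal per round. -/
theorem proposal_unique {j : ℕ} {q : Fin N} {h r : ℕ} {v v' : Block Addr Cur Call}
    {vr vr' : Option ℕ}
    (hm : (⟨q, .proposal h r v vr⟩ : Msg N Addr Cur Call) ∈ (ex.cfg j).sent)
    (hm' : (⟨q, .proposal h r v' vr'⟩ : Msg N Addr Cur Call) ∈ (ex.cfg j).sent) :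
    v = v' ∧ vr = vr' := by
  induction j with
  | zero =>
    obtain ⟨out, hst, hs, -⟩ := ex.init
    rw [hs] at hm hm'
    obtain ⟨p, hp, hm⟩ := hm
    obtain ⟨p', hp', hm'⟩ := hm'
    obtain ⟨rfl, -, -, e, -⟩ := (hst p hp).spec.proposes hm
    obtain ⟨rfl, -⟩ := (hst p' hp').spec.proposes hm'
    rw [e] at hm'
    simp only [Set.mem_singleton_iff, Msg.mk.injEq, MsgBody.proposal.injEq, true_and] at hm'
    exact ⟨hm'.1.symm, hm'.2.symm⟩
  | succ j ih =>
    -- A node that has proposed is at or beyond that position, whereas a proposing node comes from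
    -- strictly before it.
    have old : ∀ {v vr}, (⟨q, .proposal h r v vr⟩ : Msg N Addr Cur Call) ∈ (ex.cfg j).sent →
        PosLE h r 0 (ex.st j q).height (ex.st j q).round (ex.st j q).phase.num := by
      intro v vr hm
      obtain ⟨hq, i, hi, e1, e2, -⟩ := ex.proposal_origin hm
      have := ex.pos_mono hi q
      rw [e1, e2] at this
      simp only [PosLE] at *
      omega
    rcases ex.sent_step j hm with hm0 | ⟨p, hp, out, hr, hmo, hs⟩
    · rcases ex.sent_step j hm' with hm0' | ⟨p, hp, out, hr, hmo, hs⟩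
      · exact ih hm0 hm0'
      · obtain ⟨rfl, -, -, hpos, -⟩ := hr.proposal_out hmo
        exact absurd (old hm0) hpos
    · obtain ⟨rfl, -, -, hpos, he, -⟩ := hr.proposal_out hmo
      rw [hs] at hm'
      rcases hm' with hm' | hm'
      · exact absurd (old hm') hpos
      · rw [he] at hm'
        simp only [Set.mem_singleton_iff, Msg.mk.injEq, MsgBody.proposal.injEq, true_and] at hm'
        exact ⟨hm'.1.symm, hm'.2.symm⟩

/-- An honest node prevotes at most once per round. -/
theorem prevote_unique {j j' : ℕ} {q : Fin N} {h r : ℕ} {x x' : Option (Block Addr Cur Call)}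
    (hm : (⟨q, .prevote h r x⟩ : Msg N Addr Cur Call) ∈ (ex.cfg j).sent)
    (hm' : (⟨q, .prevote h r x'⟩ : Msg N Addr Cur Call) ∈ (ex.cfg j').sent) : x = x' := by
  have key : ∀ j, ∀ x x', (⟨q, .prevote h r x⟩ : Msg N Addr Cur Call) ∈ (ex.cfg j).sent →
      (⟨q, .prevote h r x'⟩ : Msg N Addr Cur Call) ∈ (ex.cfg j).sent → x = x' := by
    intro j
    induction j with
    | zero =>
      intro x x' hm
      obtain ⟨-, i, hi, -⟩ := ex.prevote_origin hm
      omega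
    | succ j ih =>
      -- After its prevote the node has left the phase `propose` of that round for good.
      have old : ∀ {x}, (⟨q, .prevote h r x⟩ : Msg N Addr Cur Call) ∈ (ex.cfg j).sent →
          ¬ ((ex.st j q).height = h ∧ (ex.st j q).round = r ∧ (ex.st j q).phase = .propose) := by
        rintro x hm ⟨e1, e2, e3⟩
        obtain ⟨hq, i, hi, -, ⟨f1, f2, f3⟩, -⟩ := ex.prevote_origin hm
        have := ex.pos_mono (Nat.succ_le_of_lt hi) q
        rw [Nat.succ_eq_add_one, e1, e2, e3, f1, f2, f3] at this
        simp [PosLE, Phase.num] at this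
      have two : ∀ x x', (⟨q, .prevote h r x⟩ : Msg N Addr Cur Call) ∈ (ex.cfg j).sent →
          (⟨q, .prevote h r x'⟩ : Msg N Addr Cur Call) ∈ (ex.cfg (j + 1)).sent → x = x' := by
        intro x x' hm0 hm'
        rcases ex.sent_step j hm' with hm0' | ⟨p, hp, out, hr, hmo, hs⟩
        · exact ih _ _ hm0 hm0'
        · obtain ⟨rfl, rfl, rfl, e, -⟩ := hr.prevote_out hmo
          exact absurd ⟨rfl, rfl, e⟩ (old hm0)
      intro x x' hm hm'
      rcases ex.sent_step j hm with hm0 | ⟨p, hp, out, hr, hmo, hs⟩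
      · exact two _ _ hm0 hm'
      · rcases ex.sent_step j hm' with hm0' | ⟨p', hp', out', hr', hmo', hs'⟩
        · exact (two _ _ hm0' hm).symm
        · rw [hs] at hm'
          obtain ⟨rfl, rfl, rfl, e, -⟩ := hr.prevote_out hmo
          rcases hm' with hm0' | hm'
          · exact absurd ⟨rfl, rfl, e⟩ (old hm0')
          · simpa using hr.out_subsingleton hmo hm'
  exact key (max j j') x x' (ex.sent_mono (le_max_left _ _) hm) (ex.sent_mono (le_max_right _ _) hm')

/-- The event number `i` locks node `p` on `v`, in round `r` of height `h`. -/
structure LockEvent (i : ℕ) (p : Fin N) (h r : ℕ) (v : Block Addr Cur Call) : Prop where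
  honest : p ∉ byz
  before : ex.At i p h r .prevote
  proposal : ∃ vr, (ex.st i p).HasProposal r v vr
  polka : IsQuorum ((ex.st i p).senders (.prevote h r (some v)))
  valid : (ex.st i p).Valid P v
  height_eq : (ex.st (i + 1) p).height = h
  locked : (ex.st (i + 1) p).locked = some (r, v)

/-- A decision clears the lock, so a lock was acquired at the height where it is held, at the event
where it first appeared. -/
theorem lock_origin {j : ℕ} {p : Fin N} (hp : p ∉ byz) {k : ℕ} {b : Block Addr Cur Call}
    (hl : (ex.st j p).locked = some (k, b)) :
    ∃ i < j, ex.LockEvent i p (ex.st j p).height k b := by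
  set h := (ex.st j p).height with hh
  have hQ : (ex.st j p).locked = some (k, b) ∧ (ex.st j p).height = h := ⟨hl, hh.symm⟩
  rcases exists_crossing (Q := fun j => (ex.st j p).locked = some (k, b) ∧ (ex.st j p).height = h)
    hQ with ⟨h0, -⟩ | ⟨i, hi, h1, h2, h3⟩
  · obtain ⟨out, hst, -⟩ := ex.init
    rw [st, (hst p hp).spec.locked] at h0
    cases h0
  · refine ⟨i, hi, ?_⟩
    rcases ex.step_cases i p with ⟨pool, inbox, he, -⟩ | ⟨out, hr, -⟩
    · rw [he] at h2 h3
      exact absurd ⟨h2, h3⟩ h1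
    · have hheight : (ex.st i p).height = h := by
        rcases hr.round_cases with ⟨e, -⟩ | ⟨-, -, e, -⟩ | ⟨e, -⟩ | ⟨e, -⟩
        · rw [← e]; exact h3
        · rw [h2] at e; cases e
        · rw [← e]; exact h3
        · rw [← e]; exact h3
      rcases hr.locked_cases (h3.trans hheight.symm) with e | ⟨v, vr, hph, hprop, hpolka, hval, e⟩
      · rw [e] at h2; exact absurd ⟨h2, hheight⟩ h1
      · rw [h2] at e
        simp only [Option.some.injEq, Prod.mk.injEq] at e
        obtain ⟨rfl, rfl⟩ := e
        rw [hheight] at hpolka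
        exact ⟨hp, ⟨hheight, rfl, hph⟩, ⟨vr, hprop⟩, hpolka, hval, h3, h2⟩

/-- Within a height, the locked round and the valid round of a node do not decrease. -/
theorem lock_mono {i j : ℕ} (hij : i ≤ j) {p : Fin N} (hp : p ∉ byz)
    (hh : (ex.st i p).height = (ex.st j p).height) :
    (∀ k b, (ex.st i p).locked = some (k, b) →
      ∃ k' b', (ex.st j p).locked = some (k', b') ∧ k ≤ k') ∧
    (∀ k b, (ex.st i p).lastValid = some (k, b) →
      ∃ k' b', (ex.st j p).lastValid = some (k', b') ∧ k ≤ k') := by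
  induction hij with
  | refl => exact ⟨fun k b h => ⟨k, b, h, le_rfl⟩, fun k b h => ⟨k, b, h, le_rfl⟩⟩
  | @step j hij ih =>
    have p1 := ex.pos_mono hij p
    have p2 := ex.pos_mono (Nat.le_succ j) p
    rw [Nat.succ_eq_add_one] at *
    have hh1 : (ex.st i p).height = (ex.st j p).height := by
      simp only [PosLE] at p1 p2; omega
    obtain ⟨ih1, ih2⟩ := ih hh1
    rcases ex.step_cases j p with ⟨pool, inbox, he, -⟩ | ⟨out, hr, -⟩
    · rw [he]; exact ⟨ih1, ih2⟩
    · have hj : (ex.st (j + 1) p).height = (ex.st j p).height := hh.symm.trans hh1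
      constructor
      · intro k b hl
        obtain ⟨k', b', hl', hle⟩ := ih1 k b hl
        rcases hr.locked_cases hj with e | ⟨v, vr, -, -, -, -, e⟩
        · exact ⟨k', b', e.trans hl', hle⟩
        · exact ⟨_, v, e, hle.trans ((ex.inv j hp).locked k' b' hl').1⟩
      · intro k b hl
        obtain ⟨k', b', hl', hle⟩ := ih2 k b hl
        rcases hr.lastValid_cases hj with e | ⟨v, e⟩
        · exact ⟨k', b', e.trans hl', hle⟩
        · exact ⟨_, v, e, hle.trans ((ex.inv j hp).lastValid k' b' hl').1⟩

/-- The second alternative covers the timers scheduled at the very start, before event `0`; these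
are of the phase `propose` only. -/
theorem timer_origin {j : ℕ} {p : Fin N} (hp : p ∉ byz) {tm : Timer}
    (htm : tm ∈ (ex.st j p).timers) :
    (∃ i < j, TimerReason P (ex.time i) (ex.st i p) (ex.st (i + 1) p) tm) ∨
    (tm.deadline = ex.time 0 + P.timeout tm.phase tm.round ∧ tm.phase = .propose ∧
      (ex.st 0 p).height = tm.height ∧ (ex.st 0 p).round = tm.round) := by
  rcases exists_crossing (Q := fun i => tm ∈ (ex.st i p).timers) htm with h | ⟨i, hi, h1, h2⟩
  · obtain ⟨out, hst, -⟩ := ex.init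
    have hs := (hst p hp).spec
    rcases hs.out_timers with ⟨-, -, ht⟩ | ⟨-, ht, -⟩
    · rw [st, ht] at h
      rcases h with rfl | h
      · exact Or.inr ⟨rfl, rfl, hs.height_eq, hs.round⟩
      · cases h
    · rw [st, ht] at h; cases h
  · rcases ex.step_cases i p with ⟨pool, inbox, he, -⟩ | ⟨out, hr, -⟩
    · rw [he] at h2; exact absurd h2 h1
    · exact Or.inl ⟨i, hi, (hr.timers_cases h2).resolve_left h1⟩

end Execution

end MStableChain

namespace MStableChain

namespace Execution

variable {N : ℕ} [NeZero N] {Addr Cur World Call : Type*} [DecidableEq Addr] [DecidableEq Cur]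
  {P : Params Addr Cur World Call} {byz : Finset (Fin N)} (ex : Execution P byz)

/-! ## Safety -/

/-- Two quorums of prevotes of the same round agree. -/
theorem prevote_quorum_unique (hbyz : 3 * byz.card < N) {j j' : ℕ} {h r : ℕ}
    {x x' : Option (Block Addr Cur Call)} (hq : IsQuorum (ex.Cast j (.prevote h r x)))
    (hq' : IsQuorum (ex.Cast j' (.prevote h r x'))) : x = x' := by
  obtain ⟨q, h1, h2, hb⟩ := hq.exists_honest_mem_inter hbyz hq'
  exact ex.prevote_unique (h1.resolve_left hb) (h2.resolve_left hb)

/-- Of the rules that emit precommits, only `lock` precommits a block. -/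
theorem precommit_some_origin {j : ℕ} {q : Fin N} {h r : ℕ} {v : Block Addr Cur Call}
    (hm : (⟨q, .precommit h r (some v)⟩ : Msg N Addr Cur Call) ∈ (ex.cfg j).sent) :
    ∃ i < j, ex.LockEvent i q h r v := by
  obtain ⟨hq, i, hi, ⟨rfl, rfl, hph⟩, ⟨e1, -⟩, hreason⟩ := ex.precommit_origin hm
  rcases hreason with ⟨v', vr, hv, hprop, hpolka, hval, hl⟩ | ⟨h, -⟩ | ⟨h, -⟩
  · obtain rfl := Option.some.inj hv
    exact ⟨i, hi, hq, ⟨rfl, rfl, hph⟩, ⟨vr, hprop⟩, hpolka, hval, e1, hl⟩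
  · cases h
  · cases h

/-- `Cast` refers to no receiver, so quorums observed by different nodes become comparable. -/
theorem LockEvent.polka_cast {i : ℕ} {p : Fin N} {h r : ℕ} {v : Block Addr Cur Call}
    (hl : ex.LockEvent i p h r v) : IsQuorum (ex.Cast i (.prevote h r (some v))) :=
  hl.polka.mono (ex.senders_subset_cast i hl.honest _)

/-- After a quorum of precommits for `v`, no other block gets a quorum of prevotes. -/
theorem prevote_quorum_of_precommit_quorum (hbyz : 3 * byz.card < N) {j₀ : ℕ} {h r : ℕ}
    {v : Block Addr Cur Call} (hq : IsQuorum (ex.Cast j₀ (.precommit h r (some v)))) (r' : ℕ)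
    (hr : r ≤ r') {j : ℕ} {w : Block Addr Cur Call}
    (hw : IsQuorum (ex.Cast j (.prevote h r' (some w)))) : w = v := by
  induction r' using Nat.strong_induction_on generalizing j w with
  | _ r' ih =>
    -- The honest `q` precommitted `v` in round `r` and prevoted `w` in round `r'`.
    obtain ⟨q, h1, h2, hb⟩ := hq.exists_honest_mem_inter hbyz hw
    obtain ⟨i, hi, hl⟩ := ex.precommit_some_origin (h1.resolve_left hb)
    rcases hr.eq_or_lt with rfl | hlt
    · exact Option.some.inj (ex.prevote_quorum_unique hbyz hw (hl.polka_cast ex))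
    · obtain ⟨-, i', hi', ⟨a1, a2, a3⟩, -, hreason⟩ := ex.prevote_origin (h2.resolve_left hb)
      -- Positions are monotone, so the lock precedes the prevote.
      have hii : i + 1 ≤ i' := by
        by_contra hcon
        have hpos := ex.pos_mono (show i' ≤ i by omega) q
        rw [a1, a2, a3, hl.before.1, hl.before.2.1, hl.before.2.2] at hpos
        simp only [PosLE] at hpos
        omega
      -- When prevoting, `q` still holds a lock, of some round `k ≥ r`. A lock of the current round
      -- would mean phase `precommit`, so `k < r'`; as that lock had a quorum of prevotes, its block
      -- is `v` by induction.
      obtain ⟨k, b, hlk, hrk⟩ := (ex.lock_mono hii hb (hl.height_eq.trans a1.symm)).1 r v hl.locked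
      obtain ⟨hk1, hk2, -⟩ := (ex.inv i' hb).locked k b hlk
      rw [a2] at hk1 hk2
      rw [a3] at hk2
      have hklt : k < r' := lt_of_le_of_ne hk1 fun e => by cases hk2 e
      obtain ⟨i₂, -, hl₂⟩ := ex.lock_origin hb hlk
      rw [a1] at hl₂
      have hbv : b = v := ih k hklt hrk (hl₂.polka_cast ex)
      -- So either `w = b`, or `w` had a quorum of prevotes in a round between `k` and `r'`, to
      -- which the induction hypothesis applies again.
      rcases hreason with ⟨u, vr, -, hvr, hvote⟩ | ⟨h, -⟩
      · rcases hvote with ⟨⟨-, hok⟩, he⟩ | ⟨-, he⟩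
        · obtain rfl := Option.some.inj he
          rcases hok k b hlk with rfl | ⟨k', rfl, hkk⟩
          · exact hbv
          · obtain ⟨hk', hquo⟩ := hvr k' rfl
            rw [a2] at hk'
            rw [a1] at hquo
            exact ih k' hk' (hrk.trans hkk) (hquo.mono (ex.senders_subset_cast i' hb _))
        · cases he
      · cases h

/-- An honest precommit in the later round is backed by a quorum of prevotes there, which the
earlier quorum of precommits restricts to its own block. -/
theorem precommit_quorum_unique (hbyz : 3 * byz.card < N) {j j' : ℕ} {h r r' : ℕ}
    {v v' : Block Addr Cur Call} (hq : IsQuorum (ex.Cast j (.precommit h r (some v))))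
    (hq' : IsQuorum (ex.Cast j' (.precommit h r' (some v')))) : v = v' := by
  have key : ∀ {j j' r r' : ℕ} {v v' : Block Addr Cur Call}, r ≤ r' →
      IsQuorum (ex.Cast j (.precommit h r (some v))) →
      IsQuorum (ex.Cast j' (.precommit h r' (some v'))) → v' = v := by
    intro j j' r r' v v' hr hq hq'
    obtain ⟨q, h1, hb⟩ := hq'.exists_honest hbyz
    obtain ⟨i, hi, hl⟩ := ex.precommit_some_origin (h1.resolve_left hb)
    exact ex.prevote_quorum_of_precommit_quorum hbyz hq r' hr (hl.polka_cast ex)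
  rcases le_total r r' with hr | hr
  · exact (key hr hq hq').symm
  · exact key hr hq' hq

/-- Honest nodes decide the same block at the same height. -/
theorem decided_agree (hbyz : 3 * byz.card < N) {i j : ℕ} {p q : Fin N} (hp : p ∉ byz)
    (hq : q ∉ byz) {h : ℕ} {v w : Block Addr Cur Call} (hv : (ex.st i p).decided[h]? = some v)
    (hw : (ex.st j q).decided[h]? = some w) : v = w := by
  obtain ⟨r, hr⟩ := (ex.inv i hp).decided_quorum h v hv
  obtain ⟨r', hr'⟩ := (ex.inv j hq).decided_quorum h w hw
  exact ex.precommit_quorum_unique hbyz (hr.mono (ex.senders_subset_cast i hp _))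
    (hr'.mono (ex.senders_subset_cast j hq _))

theorem decided_prefix (hbyz : 3 * byz.card < N) {i j : ℕ} {p q : Fin N} (hp : p ∉ byz)
    (hq : q ∉ byz) (hle : (ex.st i p).height ≤ (ex.st j q).height) :
    (ex.st i p).decided <+: (ex.st j q).decided := by
  rw [List.prefix_iff_eq_take]
  apply List.ext_getElem?
  intro h
  rw [List.getElem?_take]
  split_ifs with hlt
  · obtain ⟨v, hv⟩ : ∃ v, (ex.st i p).decided[h]? = some v := ⟨_, List.getElem?_eq_getElem hlt⟩
    obtain ⟨w, hw⟩ : ∃ w, (ex.st j q).decided[h]? = some w :=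
      ⟨_, List.getElem?_eq_getElem (lt_of_lt_of_le hlt hle)⟩
    rw [hv, hw, ex.decided_agree hbyz hp hq hv hw]
  · exact List.getElem?_eq_none (not_lt.1 hlt)

/-- Honest nodes at the same height maintain the same ledger. -/
theorem ledger_eq (hbyz : 3 * byz.card < N) {i j : ℕ} {p q : Fin N} (hp : p ∉ byz)
    (hq : q ∉ byz) (hh : (ex.st i p).height = (ex.st j q).height) :
    (ex.st i p).ledger = (ex.st j q).ledger := by
  have h := (ex.decided_prefix hbyz hp hq hh.le).eq_of_length hh
  have h1 := (ex.inv i hp).replay_eq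
  rw [h, (ex.inv j hq).replay_eq] at h1
  exact (Option.some.inj h1).symm

/-- Validity depends only on the ledger, which is common to the honest nodes at one height. -/
theorem valid_iff (hbyz : 3 * byz.card < N) {i j : ℕ} {p q : Fin N} (hp : p ∉ byz)
    (hq : q ∉ byz) (hh : (ex.st i p).height = (ex.st j q).height) {v : Block Addr Cur Call} :
    (ex.st i p).Valid P v ↔ (ex.st j q).Valid P v := by
  unfold NodeState.Valid
  rw [ex.ledger_eq hbyz hp hq hh]

theorem safety (hbyz : 3 * byz.card < N) : ex.Safety := by
  refine ⟨fun i j p hp q hq => ?_, fun i j hij p hp => (ex.st_mono hij p).2.2.2.1,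
    fun i p hp => (ex.inv i hp).replay_eq⟩
  rcases le_total (ex.st i p).height (ex.st j q).height with h | h
  · exact Or.inl (ex.decided_prefix hbyz hp hq h)
  · exact Or.inr (ex.decided_prefix hbyz hq hp h)

/-! ## Validity of the chain -/

theorem pool_origin (i : ℕ) {p : Fin N} (hp : p ∉ byz) {tx : Tx Addr Cur Call}
    (htx : tx ∈ (ex.st i p).pool) :
    ∃ k < i, ex.event k = .submit tx.body tx.currency ∧
      ∀ rates, tx.body.sender = P.oracle → tx.body.payload = .oracleUpdate rates →
        rates = ex.externalRates (ex.time k) :=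
  ex.rpcLog_origin (ex.pool_rpcLog i hp htx)

/-- Acting on a block presupposes having its transactions in the pool, and whatever is in a pool was
submitted to an RPC node. -/
theorem transactionsAuthentic : ex.TransactionsAuthentic := by
  constructor
  · intro i p hp tx htx
    obtain ⟨k, hk, he, -⟩ := ex.pool_origin i hp ((ex.inv i hp).decided_pool tx htx)
    exact ⟨k, hk, he⟩
  · rintro i ⟨q, b⟩ hm h r v hb tx htx
    have : ∃ j < i, q ∉ byz ∧ tx ∈ (ex.st j q).pool := by
      rcases hb with rfl | rfl
      · obtain ⟨hq, j, hj, -, -, hreason⟩ := ex.prevote_origin hm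
        rcases hreason with ⟨u, vr, hprop, -, ⟨-, he⟩ | ⟨-, he⟩⟩ | ⟨he, -⟩
        · obtain rfl := Option.some.inj he
          exact ⟨j, hj, hq, hprop.2 tx htx⟩
        · cases he
        · cases he
      · obtain ⟨j, hj, hl⟩ := ex.precommit_some_origin hm
        obtain ⟨vr, hprop⟩ := hl.proposal
        exact ⟨j, hj, hl.honest, hprop.2 tx htx⟩
    obtain ⟨j, hj, hq, hpool⟩ := this
    obtain ⟨k, hk, he, -⟩ := ex.pool_origin j hq hpool
    exact ⟨k, hk.trans hj, he⟩

theorem settledInCurrency : ex.SettledInCurrency := by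
  rintro i p hp n prior σ tx σ' ⟨pre, post, b₁, b₂, σ₀, -, -, -, -, -, h⟩
  exact applyTx_settled h

theorem baseFeesCorrect : ex.BaseFeesCorrect := by
  intro i p hp
  constructor
  · rintro n prior σ tx σ' ⟨pre, post, b₁, b₂, σ₀, hc, rfl, -, hpre, hb, h⟩
    obtain ⟨-, hfee, -⟩ := applyTx_spec h
    rw [hfee, (replay_rates hpre hb).2.2, hc,
      List.take_append_of_le_length (Nat.div_mul_le_self _ _)]
  · intro tx htx rates hp'
    obtain ⟨n, prior, σ, σ', pre, post, b₁, b₂, σ₀, -, -, -, -, -, h⟩ :=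
      exists_executedAt (ex.inv i hp).replay_eq htx
    have ho := (applyTx_rates h).2.2.2 rates hp'
    obtain ⟨k, hk, he, hr⟩ := ex.pool_origin i hp ((ex.inv i hp).decided_pool tx htx)
    exact ⟨ho, k, hk, he, hr rates ho hp'⟩

theorem managementValid : ex.ManagementValid := by
  intro i p hp
  refine ⟨?_, fun c k pr hk => replay_proposals (ex.inv i hp).replay_eq hk⟩
  rintro n prior σ tx σ' ⟨pre, post, b₁, b₂, σ₀, -, -, rfl, hpre, hb, h⟩ c
  obtain ⟨h1, h2, h3, h4⟩ := applyTx_management h c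
  refine ⟨h1, h2, fun k pr hex => ?_, h4⟩
  obtain ⟨hq, had, hbal⟩ := h3 k pr hex
  -- The approving members are the recorded approvals plus the present voter, cut down to the
  -- committee; the recorded ones lead back to earlier votes, the last one is `tx`.
  refine ⟨⟨_, Finset.inter_subset_right, hq, fun a ha => ?_⟩, had, hbal⟩
  rcases Finset.mem_insert.1 (Finset.mem_inter.1 ha).1 with rfl | ha
  · exact ⟨tx, by simp, rfl, hex.1⟩
  · obtain ⟨tx', hm, h⟩ := replay_approvals hpre hb c k pr hex.2.1 a ha
    exact ⟨tx', List.mem_append_left _ hm, h⟩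

end Execution

end MStableChain

namespace MStableChain

theorem IsQuorum.exists_isThird {N : ℕ} {Addr Cur World Call : Type*}
    {st : NodeState N Addr Cur World Call} {S : Set (Fin N)} (h : IsQuorum S) {k r : ℕ}
    (hS : ∀ q ∈ S, ∃ b, q ∈ st.senders b ∧ b.height = k ∧ b.round = r) :
    IsThird {q | ∃ b, q ∈ st.senders b ∧ b.height = k ∧ b.round = r} :=
  h.isThird.mono hS

namespace Execution

variable {N : ℕ} [NeZero N] {Addr Cur World Call : Type*} [DecidableEq Addr] [DecidableEq Cur]
  {P : Params Addr Cur World Call} {byz : Finset (Fin N)} (ex : Execution P byz)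

/-! ## The system between events -/

theorem exists_lt_time (t : ℝ) : ∃ i, t < ex.time (i + 1) := by
  obtain ⟨i, hi⟩ := (ex.time_unbounded.eventually_gt_atTop t).exists
  exact ⟨i, hi.trans_le (ex.time_mono (Nat.le_succ i))⟩

open Classical in
/-- The number of the last event up to time `t`. -/
noncomputable def idx (t : ℝ) : ℕ := Nat.find (ex.exists_lt_time t)

theorem lt_time_idx (t : ℝ) : t < ex.time (ex.idx t + 1) := by
  classical
  exact Nat.find_spec (ex.exists_lt_time t)

theorem time_idx_le {t : ℝ} (h : ex.time 0 ≤ t) : ex.time (ex.idx t) ≤ t := by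
  classical
  rcases hi : ex.idx t with _ | i
  · exact h
  · by_contra hcon
    have := Nat.find_min' (ex.exists_lt_time t) (not_le.1 hcon)
    change ex.idx t ≤ i at this
    omega

theorem le_idx {t : ℝ} {k : ℕ} (h : ex.time k ≤ t) : k ≤ ex.idx t := by
  by_contra hcon
  have := ex.time_mono (show ex.idx t + 1 ≤ k by omega)
  linarith [ex.lt_time_idx t]

theorem idx_lt {t : ℝ} (h : ex.time 0 ≤ t) {k : ℕ} (hk : t < ex.time k) : ex.idx t < k := by
  by_contra hcon
  have := ex.time_mono (not_lt.1 hcon)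
  linarith [ex.time_idx_le h]

theorem idx_mono {t t' : ℝ} (h : ex.time 0 ≤ t) (ht : t ≤ t') : ex.idx t ≤ ex.idx t' :=
  ex.le_idx ((ex.time_idx_le h).trans ht)

/-- The state of node `p` at time `t`, after all events of that time. -/
noncomputable abbrev now (t : ℝ) (p : Fin N) : NodeState N Addr Cur World Call :=
  ex.st (ex.idx t + 1) p

variable {ex} {t : ℝ} {p q : Fin N}

/-- `now t` is the state after all events up to time `t`, and `prompt` forbids enabled rules until
the next event. Each rule thereby yields a fact valid at all times, since otherwise it would apply.
-/
theorem not_rule (h0 : ex.time 0 ≤ t) (hp : p ∉ byz) {st' : NodeState N Addr Cur World Call}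
    {out : Set (Msg N Addr Cur Call)} : ¬ Rule P p t (ex.now t p) st' out :=
  fun h => ex.prompt (ex.idx t) p hp t (ex.time_idx_le h0) (ex.lt_time_idx t) ⟨_, _, h⟩

/-! ### No rule is enabled between events -/

theorem le_round_now (h0 : ex.time 0 ≤ t) (hp : p ∉ byz) {r : ℕ}
    (h : IsThird {q | ∃ b, q ∈ (ex.now t p).senders b ∧ b.height = (ex.now t p).height ∧
      b.round = r}) : r ≤ (ex.now t p).round := by
  by_contra hcon
  obtain ⟨st', out, hs⟩ := StartRound.exists P p t (ex.now t p) r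
  exact not_rule h0 hp (.skip r st' out (not_le.1 hcon) h hs)

theorem prevoteTimerSet_now (h0 : ex.time 0 ≤ t) (hp : p ∉ byz)
    (hph : (ex.now t p).phase = .prevote)
    (h : IsQuorum {q | ∃ x, q ∈ (ex.now t p).senders
      (.prevote (ex.now t p).height (ex.now t p).round x)}) :
    (ex.now t p).prevoteTimerSet = true := by
  by_contra hcon
  exact not_rule h0 hp (.prevoteWait hph (Bool.eq_false_iff.2 hcon) h)

theorem precommitTimerSet_now (h0 : ex.time 0 ≤ t) (hp : p ∉ byz)
    (h : IsQuorum {q | ∃ x, q ∈ (ex.now t p).senders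
      (.precommit (ex.now t p).height (ex.now t p).round x)}) :
    (ex.now t p).precommitTimerSet = true := by
  by_contra hcon
  exact not_rule h0 hp (.precommitWait (Bool.eq_false_iff.2 hcon) h)

/-- A suitable proposal can always be answered, if need be by a vote for nil. -/
theorem phase_ne_propose_now (h0 : ex.time 0 ≤ t) (hp : p ∉ byz) {v : Block Addr Cur Call}
    {vr : Option ℕ} (h : (ex.now t p).HasProposal (ex.now t p).round v vr)
    (hvr : ∀ k, vr = some k → k < (ex.now t p).round ∧
      IsQuorum ((ex.now t p).senders (.prevote (ex.now t p).height k (some v)))) :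
    (ex.now t p).phase ≠ .propose := by
  intro hph
  cases vr with
  | none =>
    obtain ⟨vote, hv⟩ := exists_voteIf ((ex.now t p).Valid P v ∧
      ∀ k b, (ex.now t p).locked = some (k, b) → b = v) v
    exact not_rule h0 hp (.prevoteNew v vote hph h hv)
  | some k =>
    obtain ⟨vote, hv⟩ := exists_voteIf ((ex.now t p).Valid P v ∧
      ∀ k' b, (ex.now t p).locked = some (k', b) → k' ≤ k ∨ b = v) v
    obtain ⟨h1, h2⟩ := hvr k rfl
    exact not_rule h0 hp (.prevoteOld v k vote hph h h1 h2 hv)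

theorem polkaSeen_now (h0 : ex.time 0 ≤ t) (hp : p ∉ byz) {v : Block Addr Cur Call}
    {vr : Option ℕ} (h : (ex.now t p).HasProposal (ex.now t p).round v vr)
    (hpolka : IsQuorum ((ex.now t p).senders
      (.prevote (ex.now t p).height (ex.now t p).round (some v))))
    (hv : (ex.now t p).Valid P v) (hph : (ex.now t p).phase ≠ .propose) :
    (ex.now t p).polkaSeen = true := by
  by_contra hcon
  rcases hph' : (ex.now t p).phase
  · exact hph hph'
  · exact not_rule h0 hp (.lock v vr hph' (Bool.eq_false_iff.2 hcon) h hpolka hv)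
  · exact not_rule h0 hp (.markValid v vr hph' (Bool.eq_false_iff.2 hcon) h hpolka hv)

theorem not_decide_now (h0 : ex.time 0 ≤ t) (hp : p ∉ byz) {r : ℕ} {v : Block Addr Cur Call}
    {vr : Option ℕ} (h : (ex.now t p).HasProposal r v vr)
    (hquo : IsQuorum ((ex.now t p).senders (.precommit (ex.now t p).height r (some v))))
    (hv : (ex.now t p).Valid P v) : False := by
  obtain ⟨σ, hσ⟩ := hv
  obtain ⟨st', out, hs⟩ := StartRound.exists P p t { ex.now t p with
    ledger := σ, decided := (ex.now t p).decided ++ [v], locked := none, lastValid := none } 0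
  exact not_rule h0 hp (.decide r v vr σ st' out h hquo hσ hs)

theorem not_expired_propose_now (h0 : ex.time 0 ≤ t) (hp : p ∉ byz)
    (hph : (ex.now t p).phase = .propose) : ¬ (ex.now t p).Expired t .propose :=
  fun h => not_rule h0 hp (.timeoutPropose hph h)

theorem not_expired_prevote_now (h0 : ex.time 0 ≤ t) (hp : p ∉ byz)
    (hph : (ex.now t p).phase = .prevote) : ¬ (ex.now t p).Expired t .prevote :=
  fun h => not_rule h0 hp (.timeoutPrevote hph h)

theorem not_expired_precommit_now (h0 : ex.time 0 ≤ t) (hp : p ∉ byz) :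
    ¬ (ex.now t p).Expired t .precommit := by
  intro h
  obtain ⟨st', out, hs⟩ := StartRound.exists P p t (ex.now t p) ((ex.now t p).round + 1)
  exact not_rule h0 hp (.timeoutPrecommit st' out h hs)

/-! ### Delivery -/

variable (ex) in
/-- What honest nodes or RPC nodes know or send at event `k` has reached everybody by time `t`. -/
def Reached (k : ℕ) (t : ℝ) : Prop := max (ex.time k) ex.gst + ex.delay ≤ t

theorem Reached.time_le {k : ℕ} (h : ex.Reached k t) : ex.time k ≤ t := by
  have := le_max_left (ex.time k) ex.gst
  have := ex.delay_pos
  unfold Reached at h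
  linarith

theorem Reached.time_zero_le {k : ℕ} (h : ex.Reached k t) : ex.time 0 ≤ t :=
  (ex.time_mono (Nat.zero_le k)).trans h.time_le

theorem Reached.mono {k k' : ℕ} (h : ex.Reached k t) (hk : k' ≤ k) : ex.Reached k' t := by
  have := ex.time_mono hk
  unfold Reached at *
  exact le_trans (by gcongr) h

theorem Reached.of_gst_le {k : ℕ} (hg : ex.gst ≤ ex.time k) (h : ex.time k + ex.delay ≤ t) :
    ex.Reached k t := by
  unfold Reached
  rwa [max_eq_left hg]

theorem Reached.sent {k : ℕ} (h : ex.Reached k t) {m : Msg N Addr Cur Call}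
    (hm : m ∈ (ex.cfg (k + 1)).sent) (hq : q ∉ byz) : m ∈ (ex.now t q).inbox :=
  ex.sent_delivered k _ m hm (h.trans (ex.lt_time_idx t).le) q hq

theorem Reached.inbox {k : ℕ} (h : ex.Reached k t) (hp : p ∉ byz) (hq : q ∉ byz) :
    (ex.st (k + 1) p).inbox ⊆ (ex.now t q).inbox :=
  fun m hm => ex.relayed k _ m p hp hm (h.trans (ex.lt_time_idx t).le) q hq

theorem Reached.pool {k : ℕ} (h : ex.Reached k t) (hp : p ∉ byz) (hq : q ∉ byz) :
    (ex.st (k + 1) p).pool ⊆ (ex.now t q).pool :=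
  fun tx htx => ex.tx_delivered k _ tx (ex.pool_rpcLog _ hp htx)
    (h.trans (ex.lt_time_idx t).le) q hq

theorem Reached.senders {k : ℕ} (h : ex.Reached k t) (hp : p ∉ byz) (hq : q ∉ byz)
    (b : MsgBody Addr Cur Call) : (ex.st k p).senders b ⊆ (ex.now t q).senders b :=
  fun _ hx => h.inbox hp hq ((ex.st_mono (Nat.le_succ k) p).2.1 hx)

theorem Reached.hasProposal {k : ℕ} (h : ex.Reached k t) (hp : p ∉ byz) (hq : q ∉ byz)
    {r : ℕ} {v : Block Addr Cur Call} {vr : Option ℕ}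
    (hh : (ex.now t q).height = (ex.st k p).height) (hprop : (ex.st k p).HasProposal r v vr) :
    (ex.now t q).HasProposal r v vr := by
  unfold NodeState.HasProposal at *
  rw [hh]
  have hm := ex.st_mono (Nat.le_succ k) p
  exact ⟨h.inbox hp hq (hm.2.1 hprop.1), fun tx htx => h.pool hp hq (hm.1 (hprop.2 tx htx))⟩

/-- Once a prevote for a block has reached everybody, nobody waits for a proposal any more. -/
theorem Reached.phase_ne_propose {k : ℕ} (h : ex.Reached k t) (hp : p ∉ byz)
    {v : Block Addr Cur Call}
    (hm : (⟨q, .prevote (ex.now t p).height (ex.now t p).round (some v)⟩ :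
      Msg N Addr Cur Call) ∈ (ex.cfg k).sent) : (ex.now t p).phase ≠ .propose := by
  obtain ⟨hq, i, hi, ⟨e1, e2, -⟩, -, hreason⟩ := ex.prevote_origin hm
  have h := h.mono hi.le
  rcases hreason with ⟨u, vr, hprop, hvr, -⟩ | ⟨he, -⟩
  · rw [e2] at hprop hvr
    refine phase_ne_propose_now h.time_zero_le hp (h.hasProposal hq hp e1.symm hprop) ?_
    intro k hk
    obtain ⟨h1, h2⟩ := hvr k hk
    rw [e1] at h2
    exact ⟨h1, h2.mono (h.senders hq hp _)⟩
  · cases he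

/-! ## Liveness -/

/-- A height is left only by deciding, so a node above `h` once held, at height `h`, all the
evidence for a decision. -/
theorem exists_height_step {h j : ℕ} (hq : q ∉ byz) (hj : h < (ex.st j q).height) :
    ∃ i < j, (ex.st i q).height = h ∧ ∃ r v vr, (ex.st i q).HasProposal r v vr ∧
      IsQuorum ((ex.st i q).senders (.precommit h r (some v))) ∧ (ex.st i q).Valid P v := by
  rcases exists_crossing (Q := fun j => h < (ex.st j q).height) hj with h0 | ⟨i, hi, h1, h2⟩
  · obtain ⟨out, hst, -⟩ := ex.init
    rw [st, (hst q hq).spec.height_eq] at h0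
    simp [NodeState.height, blank] at h0
  · refine ⟨i, hi, ?_⟩
    rcases ex.step_cases i q with ⟨pool, inbox, he, -⟩ | ⟨out, hr, -⟩
    · rw [he] at h2
      exact absurd h2 h1
    · rcases hr.round_cases with ⟨e, -⟩ | ⟨e, -, -, r, v, vr, h3, h4, h5⟩ | ⟨e, -⟩ | ⟨e, -⟩
      · omega
      · have hh : (ex.st i q).height = h := by omega
        rw [hh] at h4
        exact ⟨hh, r, v, vr, h3, h4, h5⟩
      · omega
      · omega

/-- Decisions spread. -/
theorem height_sync (hbyz : 3 * byz.card < N) {h j : ℕ} (hq : q ∉ byz)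
    (hj : h < (ex.st j q).height) (ht : ex.Reached j t) (hp : p ∉ byz) :
    h < (ex.now t p).height := by
  by_contra hcon
  -- The height at which `p` lags is at most `h`, so `q` decided there; the evidence has reached
  -- `p`, whose ledger agrees with that of `q`.
  obtain ⟨i, hi, hh, r, v, vr, h1, h2, h3⟩ :=
    exists_height_step (ex := ex) (h := (ex.now t p).height) (j := j) hq (by omega)
  have ht := ht.mono hi.le
  exact not_decide_now ht.time_zero_le hp (ht.hasProposal hq hp hh.symm h1)
    (h2.mono (ht.senders hq hp _)) ((ex.valid_iff hbyz hq hp hh).1 h3)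

variable (ex) in
/-- From event `I` on, after the stabilization, all honest nodes remain at height `H`. -/
structure Stuck (H I : ℕ) : Prop where
  eq : ∀ i ≥ I, ∀ q ∉ byz, (ex.st i q).height = H
  gst_le : ex.gst ≤ ex.time I

/-- As decisions spread, no honest node gets beyond the height that bounds one of them. The least
bound `H` on honest heights is attained, and by spreading again everybody attains it. -/
theorem exists_stuck (hbyz : 3 * byz.card < N) (hlive : ¬ ex.Liveness) :
    ∃ H I, ex.Stuck H I := by
  classical
  unfold Liveness at hlive
  push Not at hlive
  obtain ⟨p, hp, h, hh⟩ := hlive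
  have hbdd : ∃ H, ∀ i, ∀ q ∉ byz, (ex.st i q).height ≤ H := by
    refine ⟨h, fun i q hq => ?_⟩
    by_contra hcon
    have := height_sync hbyz hq (not_le.1 hcon) (t := max (ex.time i) ex.gst + ex.delay)
      (le_refl _) hp
    exact absurd this (not_lt.2 (hh _))
  set H := Nat.find hbdd with hH
  have hle : ∀ i, ∀ q ∉ byz, (ex.st i q).height ≤ H := Nat.find_spec hbdd
  have key : ∃ T, ex.gst ≤ T ∧ ex.time 0 ≤ T ∧ ∀ q ∉ byz, H ≤ (ex.now T q).height := by
    rcases hH0 : H with _ | H'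
    · exact ⟨max ex.gst (ex.time 0), le_max_left _ _, le_max_right _ _, fun q _ => Nat.zero_le _⟩
    · have := Nat.find_min hbdd (m := H') (by omega)
      push Not at this
      obtain ⟨j, q, hq, hj⟩ := this
      have hr : ex.Reached j (max (ex.time j) ex.gst + ex.delay) := le_refl _
      refine ⟨_, ?_, hr.time_zero_le, fun q' hq' => height_sync hbyz hq hj hr hq'⟩
      have := le_max_right (ex.time j) ex.gst
      have := ex.delay_pos
      linarith
  obtain ⟨T, hT1, hT2, hT3⟩ := key
  refine ⟨H, ex.idx T + 1, fun i hi q hq => le_antisymm (hle i q hq) ?_,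
    hT1.trans (ex.lt_time_idx T).le⟩
  have h1 := ex.pos_mono hi q
  have h2 : H ≤ (ex.st (ex.idx T + 1) q).height := hT3 q hq
  simp only [PosLE] at h1
  omega

variable (ex) in
/-- Some honest node has entered a round from `r` on of height `H`. -/
def Entered (H r i : ℕ) : Prop := ∃ q, q ∉ byz ∧ (ex.st i q).height = H ∧ r ≤ (ex.st i q).round

theorem exists_sent_pos {j : ℕ} {m : Msg N Addr Cur Call} (hm : m ∈ (ex.cfg j).sent) :
    m.sender ∉ byz ∧ ∃ i ≤ j, (ex.st i m.sender).height = m.body.height ∧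
      (ex.st i m.sender).round = m.body.round := by
  obtain ⟨x, b⟩ := m
  cases b with
  | proposal h r v vr =>
    obtain ⟨hx, i, hi, h1, h2, -⟩ := ex.proposal_origin hm
    exact ⟨hx, i, hi, h1, h2⟩
  | prevote h r y =>
    obtain ⟨hx, i, hi, ⟨h1, h2, -⟩, -⟩ := ex.prevote_origin hm
    exact ⟨hx, i, hi.le, h1, h2⟩
  | precommit h r y =>
    obtain ⟨hx, i, hi, ⟨h1, h2, -⟩, -⟩ := ex.precommit_origin hm
    exact ⟨hx, i, hi.le, h1, h2⟩

theorem not_entered_zero {H r : ℕ} : ¬ ex.Entered H (r + 1) 0 := by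
  rintro ⟨q, hq, -, h⟩
  obtain ⟨out, hst, -⟩ := ex.init
  rw [st, (hst q hq).spec.round] at h
  omega

/-- The first honest node to enter round `r + 1` does so when its timeout in round `r` expires. -/
theorem first_entry (hbyz : 3 * byz.card < N) {H r j : ℕ} (hj : ex.Entered H (r + 1) j) :
    ∃ b c q, q ∉ byz ∧ c < b ∧ b < j ∧ (∀ i ≤ b, ¬ ex.Entered H (r + 1) i) ∧
      (ex.st c q).height = H ∧ (ex.st c q).round = r ∧
      IsQuorum {x | ∃ y, x ∈ (ex.st c q).senders (.precommit H r y)} ∧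
      ex.time c + P.timeout .precommit r ≤ ex.time b := by
  classical
  have hex : ∃ j, ex.Entered H (r + 1) j := ⟨j, hj⟩
  obtain ⟨j₀, hj₀⟩ : ∃ j₀, j₀ = Nat.find hex := ⟨_, rfl⟩
  have hmin : ∀ i < j₀, ¬ ex.Entered H (r + 1) i := fun i hi => Nat.find_min hex (hj₀ ▸ hi)
  have hent : ex.Entered H (r + 1) j₀ := hj₀ ▸ Nat.find_spec hex
  have hle : j₀ ≤ j := hj₀ ▸ Nat.find_min' hex hj
  rcases j₀ with _ | b
  · exact absurd hent not_entered_zero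
  obtain ⟨q, hq, hh, hr⟩ := hent
  have hnb : ¬ ex.Entered H (r + 1) b := hmin b (Nat.lt_succ_self b)
  rcases ex.step_cases b q with ⟨pool, inbox, he, -⟩ | ⟨out, hrule, -⟩
  · rw [he] at hh hr
    exact absurd ⟨q, hq, hh, hr⟩ hnb
  -- A decision leads to round `0`, and skipping requires an honest node that was in the new round
  -- before; both are excluded for the first entry.
  · rcases hrule.round_cases with ⟨e1, e2⟩ | ⟨-, e, -⟩ | ⟨e1, e2, h3⟩ | ⟨e1, e2, d, hd, htm⟩
    · exact absurd ⟨q, hq, e1 ▸ hh, e2 ▸ hr⟩ hnb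
    · omega
    · obtain ⟨x, ⟨body, hx, hb1, hb2⟩, hxb⟩ := h3.exists_honest hbyz
      obtain ⟨-, i, hi, f1, f2⟩ := exists_sent_pos ((ex.inbox_sent b hq hx).resolve_left hxb)
      refine absurd ⟨x, hxb, ?_, ?_⟩ (hmin i (by omega))
      · rw [f1]; dsimp only; rw [hb1, ← e1, hh]
      · rw [f2]; dsimp only; rw [hb2]; exact hr
    · have hhb : (ex.st b q).height = H := e1 ▸ hh
      have hrb : (ex.st b q).round = r := by
        have : ¬ r + 1 ≤ (ex.st b q).round := fun h => hnb ⟨q, hq, hhb, h⟩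
        omega
      rcases ex.timer_origin hq htm with ⟨c, hc, h1, -, -, h4, -, h6⟩ | ⟨-, h, -⟩
      · obtain ⟨g1, g2⟩ := h4 (by simp)
        have g3 := h6 rfl
        dsimp only at h1 g1 g2 g3
        rw [hhb, hrb] at g3
        rw [hrb] at h1
        exact ⟨b, c, q, hq, hc, hle, fun i hi => hmin i (by omega), g1.trans hhb, g2.trans hrb,
          g3, h1 ▸ hd⟩
      · cases h

end Execution

end MStableChain

/-! ### Progress through the rounds -/

namespace MStableChain

namespace Execution

variable {N : ℕ} [NeZero N] {Addr Cur World Call : Type*} [DecidableEq Addr] [DecidableEq Cur]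
  {P : Params Addr Cur World Call} {byz : Finset (Fin N)} {ex : Execution P byz} {t : ℝ}
  {p q : Fin N} {H I : ℕ}

theorem timeout_pos {A C W K : Type*} (P : Params A C W K) (ph : Phase) (r : ℕ) :
    0 < P.timeout ph r := by
  have h : 0 ≤ (r : ℝ) * P.timeoutDelta := mul_nonneg (Nat.cast_nonneg r) P.timeoutDelta_pos.le
  cases ph
  · exact add_pos_of_pos_of_nonneg P.initPropose_pos h
  · exact add_pos_of_pos_of_nonneg P.initPrevote_pos h
  · exact add_pos_of_pos_of_nonneg P.initPrecommit_pos h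

theorem Stuck.height_now (S : ex.Stuck H I) (hq : q ∉ byz) (ht : ex.time I ≤ t) :
    (ex.now t q).height = H :=
  S.eq _ ((ex.le_idx ht).trans (Nat.le_succ _)) q hq

theorem Stuck.time_zero_le (_ : ex.Stuck H I) (ht : ex.time I ≤ t) : ex.time 0 ≤ t :=
  (ex.time_mono (Nat.zero_le I)).trans ht

theorem now_mono (h0 : ex.time 0 ≤ t) {t' : ℝ} (ht : t ≤ t') (p : Fin N) :
    (ex.now t p).timers ⊆ (ex.now t' p).timers ∧
    PosLE (ex.now t p).height (ex.now t p).round (ex.now t p).phase.num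
      (ex.now t' p).height (ex.now t' p).round (ex.now t' p).phase.num :=
  have h := (ex.st_mono (Nat.succ_le_succ (ex.idx_mono h0 ht)) p).2.2
  ⟨h.1, h.2.2⟩

/-- A scheduled timeout was scheduled in the past. -/
theorem exists_timer_deadline (h0 : ex.time 0 ≤ t) {ph : Phase} {h r : ℕ}
    {s : ℝ} (hs : s ∈ {s | ∃ k < ex.idx t + 1, s = ex.time k})
    (htm : (⟨ph, h, r, s + P.timeout ph r⟩ : Timer) ∈ (ex.now t p).timers) :
    ∃ d ≤ t + P.timeout ph r, (⟨ph, h, r, d⟩ : Timer) ∈ (ex.now t p).timers := by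
  obtain ⟨k, hk, rfl⟩ := hs
  refine ⟨_, ?_, htm⟩
  have := ex.time_mono (Nat.lt_succ_iff.1 hk)
  linarith [ex.time_idx_le h0]

/-- If a quorum of prevotes was seen before `t`, then a node that is still in the phase `prevote`
at time `t` leaves this phase before its timeout. -/
theorem not_prevote_of_timer (h0 : ex.time 0 ≤ t) (hp : p ∉ byz) {h r : ℕ}
    (hat : (ex.now t p).height = h ∧ (ex.now t p).round = r ∧ (ex.now t p).phase = .prevote)
    (hquo : IsQuorum {q | ∃ x, q ∈ (ex.now t p).senders (.prevote h r x)}) {t' : ℝ}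
    (ht : t + P.timeout .prevote r ≤ t') :
    ¬ ((ex.now t' p).height = h ∧ (ex.now t' p).round = r ∧ (ex.now t' p).phase = .prevote) := by
  rintro ⟨e1, e2, e3⟩
  obtain ⟨rfl, rfl, hph⟩ := hat
  obtain ⟨s, hs, htm⟩ := (ex.inv _ hp).prevoteTimer (prevoteTimerSet_now h0 hp hph hquo)
  obtain ⟨d, hd, htm⟩ := exists_timer_deadline h0 hs htm
  have htt : t ≤ t' := by linarith [timeout_pos P .prevote (ex.now t p).round]
  refine not_expired_prevote_now (h0.trans htt) hp e3 ⟨d, hd.trans ht, ?_⟩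
  rw [e1, e2]
  exact (now_mono h0 htt p).1 htm

/-- A node that has seen a quorum of precommits leaves the round at the latest when the timeout
expires. -/
theorem not_round_of_timer (h0 : ex.time 0 ≤ t) (hp : p ∉ byz) {h r : ℕ}
    (hat : (ex.now t p).height = h ∧ (ex.now t p).round = r)
    (hquo : IsQuorum {q | ∃ x, q ∈ (ex.now t p).senders (.precommit h r x)}) {t' : ℝ}
    (ht : t + P.timeout .precommit r ≤ t') :
    ¬ ((ex.now t' p).height = h ∧ (ex.now t' p).round = r) := by
  rintro ⟨e1, e2⟩
  obtain ⟨rfl, rfl⟩ := hat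
  obtain ⟨s, hs, htm⟩ := (ex.inv _ hp).precommitTimer (precommitTimerSet_now h0 hp hquo)
  obtain ⟨d, hd, htm⟩ := exists_timer_deadline h0 hs htm
  have htt : t ≤ t' := by linarith [timeout_pos P .precommit (ex.now t p).round]
  refine not_expired_precommit_now (h0.trans htt) hp ⟨d, hd.trans ht, ?_⟩
  rw [e1, e2]
  exact (now_mono h0 htt p).1 htm

/-- After a quorum of precommits in round `r`, all honest nodes proceed to the next round. -/
theorem Stuck.round_sync (S : ex.Stuck H I) {r c : ℕ} (hq : q ∉ byz)
    (hquo : IsQuorum {x | ∃ y, x ∈ (ex.st c q).senders (.precommit H r y)})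
    (h1 : ex.Reached c t) (h2 : ex.time I ≤ t) {t' : ℝ} (ht : t + P.timeout .precommit r ≤ t')
    (hp : p ∉ byz) : r + 1 ≤ (ex.now t' p).round := by
  have h0 := h1.time_zero_le
  have hh := S.height_now hp h2
  have hquo' : IsQuorum {x | ∃ y, x ∈ (ex.now t p).senders (.precommit H r y)} :=
    hquo.mono fun x ⟨y, hy⟩ => ⟨y, h1.senders hq hp _ hy⟩
  -- A quorum is more than a third, so nodes in earlier rounds have skipped to `r`.
  have hr : r ≤ (ex.now t p).round := le_round_now h0 hp
    (hquo'.exists_isThird fun x ⟨y, hy⟩ => ⟨_, hy, hh.symm, rfl⟩)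
  have htt : t ≤ t' := by linarith [timeout_pos P .precommit r]
  have hpos := (now_mono h0 htt p).2
  have hh' := S.height_now hp (h2.trans htt)
  by_contra hcon
  have e1 : (ex.now t p).round = r := by
    simp only [PosLE] at hpos; omega
  have e2 : (ex.now t' p).round = r := by
    simp only [PosLE] at hpos; omega
  exact not_round_of_timer h0 hp ⟨hh, e1⟩ hquo' ht ⟨hh', e2⟩

open Filter in
/-- As long as nothing is decided, rounds follow one another. -/
theorem Stuck.exists_entered (hbyz : 3 * byz.card < N) (S : ex.Stuck H I) (r : ℕ) :
    ∃ j, ex.Entered H r j := by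
  obtain ⟨p₀, -, hp₀⟩ := (isQuorum_of_honest hbyz (A := Set.univ) (by simp)).exists_honest hbyz
  induction r with
  | zero => exact ⟨I, p₀, hp₀, S.eq I le_rfl p₀ hp₀, Nat.zero_le _⟩
  | succ r ih =>
    -- Otherwise all honest nodes eventually remain in round `r`, and the successive phases with
    -- their timeouts drive them out of it.
    by_contra hno
    push Not at hno
    have hlate : ∀ᶠ t in atTop, ex.time I ≤ t := eventually_ge_atTop _
    have hreach : ∀ k, ∀ᶠ t in atTop, ex.Reached k t := fun k => eventually_ge_atTop _
    have hround_le : ∀ t, ex.time I ≤ t → ∀ p ∉ byz, (ex.now t p).round ≤ r := by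
      intro t ht p hp
      by_contra hcon
      exact hno _ ⟨p, hp, S.height_now hp ht, not_le.1 hcon⟩
    -- For a positive round, the quorum of precommits behind its first entry takes everybody along.
    have hround : ∀ᶠ t in atTop, ∀ p ∉ byz, (ex.now t p).round = r := by
      obtain ⟨j, hj⟩ := ih
      rcases r with _ | r
      · filter_upwards [hlate] with t ht p hp
        exact Nat.le_zero.1 (hround_le t ht p hp)
      · obtain ⟨b, c, q, hq, -, -, -, -, -, hquo, -⟩ := first_entry hbyz hj
        obtain ⟨t₀, h1, h2⟩ := ((hreach c).and hlate).exists
        filter_upwards [eventually_ge_atTop (t₀ + P.timeout .precommit r), hlate] with t ht hI p hp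
        exact le_antisymm (hround_le t hI p hp) (S.round_sync hq hquo h1 h2 ht hp)
    obtain ⟨T, hT⟩ := eventually_atTop.1 (hlate.and hround)
    have hI : ∀ t ≥ T, ex.time I ≤ t := fun t ht => (hT t ht).1
    have h0 : ∀ t ≥ T, ex.time 0 ≤ t := fun t ht => S.time_zero_le (hI t ht)
    have hH : ∀ t ≥ T, ∀ p ∉ byz, (ex.now t p).height = H :=
      fun t ht p hp => S.height_now hp (hI t ht)
    have hR : ∀ t ≥ T, ∀ p ∉ byz, (ex.now t p).round = r := fun t ht => (hT t ht).2
    have hph : ∀ t ≥ T, ∀ t' ≥ t, ∀ p ∉ byz,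
        (ex.now t p).phase.num ≤ (ex.now t' p).phase.num := by
      intro t ht t' ht' p hp
      have := (now_mono (h0 t ht) ht' p).2
      rw [hH t ht p hp, hH t' (ht.le.trans ht') p hp, hR t ht p hp,
        hR t' (ht.le.trans ht') p hp] at this
      simp only [PosLE] at this
      omega
    have hnum : ∀ {ph : Phase}, ph ≠ .propose ↔ 1 ≤ ph.num := by
      intro ph; cases ph <;> simp [Phase.num]
    have hnum2 : ∀ {ph : Phase}, ph = .precommit ↔ 2 ≤ ph.num := by
      intro ph; cases ph <;> simp [Phase.num]
    have hle : ∀ᶠ t in atTop, T ≤ t := eventually_ge_atTop _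
    -- everybody leaves the phase `propose`
    have hpropose : ∀ᶠ t in atTop, ∀ p, p ∉ byz → (ex.now t p).phase ≠ .propose := by
      refine eventually_all.2 fun p => ?_
      by_cases hp : p ∈ byz
      · exact Eventually.of_forall fun t h => absurd hp h
      suffices ∃ t ≥ T, (ex.now t p).phase ≠ .propose by
        obtain ⟨t, ht, hne⟩ := this
        filter_upwards [eventually_ge_atTop t] with t' ht' _
        exact hnum.2 ((hnum.1 hne).trans (hph t ht t' ht' p hp))
      by_contra hcon
      push Not at hcon
      have hinv := ex.inv (ex.idx T + 1) hp
      -- The proposer has no timer in this phase; it receives its own proposal instead.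
      by_cases hpr : proposer N (ex.now T p).height (ex.now T p).round = p
      · obtain ⟨v, vr, hm, hpool, hvr⟩ := hinv.proposed hpr
        obtain ⟨t, ht, hle⟩ := ((hreach (ex.idx T + 1)).and hle).exists
        have hm' := ht.sent (ex.sent_mono (Nat.le_succ _) hm) hp
        change ∀ k, vr = some k → k < (ex.now T p).round ∧
          IsQuorum ((ex.now T p).senders (.prevote (ex.now T p).height k (some v))) at hvr
        change (⟨p, .proposal (ex.now T p).height (ex.now T p).round v vr⟩ :
          Msg N Addr Cur Call) ∈ _ at hm'
        rw [hH T le_rfl p hp, hR T le_rfl p hp] at hm' hvr hpr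
        refine phase_ne_propose_now ht.time_zero_le hp (v := v) (vr := vr) ⟨?_, ?_⟩ ?_ (hcon t hle)
        · rw [hH t hle p hp, hR t hle p hp, hpr]
          exact hm'
        · exact fun tx htx => ht.pool hp hp ((ex.st_mono (Nat.le_succ _) p).1 (hpool tx htx))
        · intro k hk
          rw [hH t hle p hp, hR t hle p hp]
          exact ⟨(hvr k hk).1, (hvr k hk).2.mono (ht.senders hp hp _)⟩
      · obtain ⟨d, hd⟩ := hinv.proposeTimer (hcon T le_rfl) hpr
        have hTd : T ≤ max T d := le_max_left _ _
        refine not_expired_propose_now (h0 _ hTd) hp (hcon _ hTd) ⟨d, le_max_right _ _, ?_⟩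
        have := (now_mono (h0 T le_rfl) hTd p).1 hd
        change (⟨_, (ex.now T p).height, (ex.now T p).round, d⟩ : Timer) ∈ _ at this
        rwa [hH T le_rfl p hp, hR T le_rfl p hp, ← hH _ hTd p hp, ← hR _ hTd p hp] at this
    -- All honest nodes have prevoted something; a quorum of arbitrary prevotes suffices to start
    -- the timeout.
    have hprevotes : ∀ᶠ t in atTop, ∀ p, p ∉ byz →
        IsQuorum {q | ∃ x, q ∈ (ex.now t p).senders (.prevote H r x)} := by
      obtain ⟨t₀, h1, h2⟩ := (hpropose.and hle).exists
      filter_upwards [hreach (ex.idx t₀)] with t ht p hp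
      refine isQuorum_of_honest hbyz fun q hq => ?_
      obtain ⟨x, hx⟩ := (ex.inv _ hq).prevoted (h1 q hq)
      rw [show (ex.st (ex.idx t₀ + 1) q).height = H from hH t₀ h2 q hq,
        show (ex.st (ex.idx t₀ + 1) q).round = r from hR t₀ h2 q hq] at hx
      exact ⟨x, ht.sent hx hp⟩
    have hprecommit : ∀ᶠ t in atTop, ∀ p, p ∉ byz → (ex.now t p).phase = .precommit := by
      refine eventually_all.2 fun p => ?_
      by_cases hp : p ∈ byz
      · exact Eventually.of_forall fun t h => absurd hp h
      obtain ⟨t₀, h1, h2, h3⟩ := (hprevotes.and (hle.and hpropose)).exists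
      filter_upwards [eventually_ge_atTop (t₀ + P.timeout .prevote r)] with t ht _
      have htt : t₀ ≤ t := by linarith [timeout_pos P .prevote r]
      have hTt : T ≤ t := h2.trans htt
      have hmono := hph t₀ h2 t htt p hp
      rcases hp0 : (ex.now t₀ p).phase
      · exact absurd hp0 (h3 p hp)
      · have := not_prevote_of_timer (h0 t₀ h2) hp ⟨hH t₀ h2 p hp, hR t₀ h2 p hp, hp0⟩ (h1 p hp) ht
        rcases hp1 : (ex.now t p).phase
        · rw [hp0, hp1] at hmono; simp [Phase.num] at hmono
        · exact absurd ⟨hH t hTt p hp, hR t hTt p hp, hp1⟩ this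
        · rfl
      · rw [hp0] at hmono
        exact hnum2.2 hmono
    -- The precommits of all honest nodes reach `p₀`, start its timeout and force it out of the
    -- round.
    obtain ⟨t₀, h1, h2⟩ := (hprecommit.and hle).exists
    obtain ⟨t₁, h3, h4⟩ := ((hreach (ex.idx t₀)).and hle).exists
    have hquo : IsQuorum {q | ∃ x, q ∈ (ex.now t₁ p₀).senders (.precommit H r x)} := by
      refine isQuorum_of_honest hbyz fun q hq => ?_
      obtain ⟨x, hx⟩ := (ex.inv _ hq).precommitted (h1 q hq)
      rw [show (ex.st (ex.idx t₀ + 1) q).height = H from hH t₀ h2 q hq,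
        show (ex.st (ex.idx t₀ + 1) q).round = r from hR t₀ h2 q hq] at hx
      exact ⟨x, h3.sent hx hp₀⟩
    have hlast : T ≤ t₁ + P.timeout .precommit r := by linarith [timeout_pos P .precommit r]
    exact not_round_of_timer (h0 t₁ h4) hp₀ ⟨hH t₁ h4 p₀ hp₀, hR t₁ h4 p₀ hp₀⟩ hquo le_rfl
      ⟨hH _ hlast p₀ hp₀, hR _ hlast p₀ hp₀⟩

end Execution

end MStableChain

/-! ### Late rounds: a lock becomes known to everybody before the round ends -/

namespace MStableChain

namespace Execution

variable {N : ℕ} [NeZero N] {Addr Cur World Call : Type*} [DecidableEq Addr] [DecidableEq Cur]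
  {P : Params Addr Cur World Call} {byz : Finset (Fin N)} {ex : Execution P byz} {t : ℝ}
  {p q : Fin N} {H I R : ℕ}

variable (ex) in
/-- `R` exceeds all rounds that honest nodes have reached by event `I`, and the timeouts from round
`R` on exceed four times the message delay. -/
structure LateRound (I R : ℕ) : Prop where
  round_lt : ∀ q ∉ byz, (ex.st I q).round < R
  timeout_gt : ∀ ph, ∀ r ≥ R, 4 * ex.delay < P.timeout ph r

/-- Timeouts grow linearly while the delay, though unknown to the protocol, is fixed; and the
finitely many nodes are in bounded rounds at event `I`. -/
theorem exists_lateRound (I : ℕ) : ∃ R, ex.LateRound I R := by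
  obtain ⟨n, hn⟩ := exists_nat_gt (4 * ex.delay / P.timeoutDelta)
  rw [div_lt_iff₀ P.timeoutDelta_pos] at hn
  refine ⟨max n ((Finset.univ.sup fun q => (ex.st I q).round) + 1), ?_, ?_⟩
  · intro q _
    have := Finset.le_sup (f := fun q => (ex.st I q).round) (Finset.mem_univ q)
    exact lt_max_of_lt_right (by omega)
  · intro ph r hr
    have h1 : (n : ℝ) ≤ r := by exact_mod_cast (le_max_left _ _).trans hr
    have h2 := mul_le_mul_of_nonneg_right h1 P.timeoutDelta_pos.le
    have := P.initPropose_pos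
    have := P.initPrevote_pos
    have := P.initPrecommit_pos
    cases ph <;> simp only [Params.timeout] <;> linarith

/-- Before event `I` honest nodes at height `H` are in rounds below `R`, so whatever happens in a
late round happens after the stabilization. -/
theorem LateRound.le_of_round (L : ex.LateRound I R) (S : ex.Stuck H I) {i : ℕ} (hq : q ∉ byz)
    (hh : (ex.st i q).height = H) (hr : R ≤ (ex.st i q).round) : I ≤ i := by
  by_contra hcon
  have hpos := ex.pos_mono (not_le.1 hcon).le q
  rw [S.eq I le_rfl q hq, hh] at hpos
  have := L.round_lt q hq
  simp only [PosLE] at hpos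
  omega

/-- An event of a late round takes place after the stabilization. -/
theorem LateRound.time_le (L : ex.LateRound I R) (S : ex.Stuck H I) {i : ℕ} (hq : q ∉ byz)
    (hh : (ex.st i q).height = H) (hr : R ≤ (ex.st i q).round) :
    ex.time I ≤ ex.time i ∧ ex.gst ≤ ex.time i :=
  have h := ex.time_mono (L.le_of_round S hq hh hr)
  ⟨h, S.gst_le.trans h⟩

/-- If some honest node locks a block in a late round, then the first such node does so early
enough before the first honest node leaves the round. -/
theorem Stuck.lock_time (hbyz : 3 * byz.card < N) (S : ex.Stuck H I) (L : ex.LateRound I R)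
    {r : ℕ} (hr : R ≤ r) {a : ℕ} {v : Block Addr Cur Call} (hl : ex.LockEvent a p H r v)
    (hmin : ∀ e p v, ex.LockEvent e p H r v → a ≤ e) {b c : ℕ} (hq : q ∉ byz)
    (hquo : IsQuorum {x | ∃ y, x ∈ (ex.st c q).senders (.precommit H r y)})
    (hb : ex.time c + P.timeout .precommit r ≤ ex.time b) :
    ex.time a + ex.delay < ex.time b := by
  have hΔ := ex.delay_pos
  have hT := L.timeout_gt .precommit r hr
  -- If an honest `x` among these senders precommitted a block, it locked at or after event `a` and
  -- before `c`, and the timeout exceeds the delay.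
  obtain ⟨x, ⟨y, hy⟩, hx⟩ := hquo.exists_honest hbyz
  have hsent := (ex.inbox_sent c hq hy).resolve_left hx
  cases y with
  | some w =>
    obtain ⟨e, he, hle⟩ := ex.precommit_some_origin hsent
    have h1 := ex.time_mono (hmin e x w hle)
    have h2 := ex.time_mono he.le
    linarith
  | none =>
    obtain ⟨-, e, he, ⟨f1, f2, f3⟩, -, hreason⟩ := ex.precommit_origin hsent
    -- A quorum of nil prevotes contradicts that for `v`, so a nil precommit came from the prevote
    -- timeout of `x`, scheduled at `g` on a quorum of arbitrary prevotes.
    rcases hreason with ⟨_, _, h, -⟩ | ⟨-, hnil⟩ | ⟨-, d, hd, htm⟩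
    · cases h
    · rw [f1, f2] at hnil
      cases ex.prevote_quorum_unique hbyz (hnil.mono (ex.senders_subset_cast e hx _))
        (hl.polka_cast ex)
    rcases ex.timer_origin hx htm with ⟨g, hg, g1, -, -, g4, g5, -⟩ | ⟨-, h, -⟩
    swap
    · cases h
    have g4 := g4 (by simp)
    have g5 := g5 rfl
    dsimp only at g1 g4 g5
    rw [f1, f2] at g4 g5
    rw [f2] at g1
    by_contra hcon
    have hge := ex.time_mono hg.le
    have hec := ex.time_mono he.le
    have hpv := timeout_pos P .prevote r
    -- If `p` locked too late, then `time a` exceeds `time g` by the prevote timeout plus three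
    -- delays. By `t` the quorum seen at `g` has reached `p`, whose own prevote timeout therefore
    -- expires before `a`, although `p` is still in phase `prevote` then.
    obtain ⟨t, ht⟩ : ∃ t, t = ex.time g + ex.delay := ⟨_, rfl⟩
    have hta : t + P.timeout .prevote r < ex.time a := by linarith
    obtain ⟨hIg, hgst⟩ := L.time_le S hx g4.1 (hr.trans g4.2.ge)
    have hreach : ex.Reached g t := .of_gst_le hgst ht.ge
    have h0 := hreach.time_zero_le
    have hIt : ex.time I ≤ t := by linarith
    have hp := hl.honest
    have hh := S.height_now hp hIt
    have hquo' : IsQuorum {z | ∃ y, z ∈ (ex.now t p).senders (.prevote H r y)} :=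
      g5.mono fun z ⟨y, hy⟩ => ⟨y, hreach.senders hx hp _ hy⟩
    have hrt : r ≤ (ex.now t p).round := le_round_now h0 hp
      (hquo'.exists_isThird fun z ⟨y, hy⟩ => ⟨_, hy, hh.symm, rfl⟩)
    have before : ∀ t', t ≤ t' → t' < ex.time a → (ex.now t' p).height = H ∧
        PosLE H (ex.now t' p).round (ex.now t' p).phase.num H r 1 := by
      intro t' h1 h2
      have hh' := S.height_now hp (hIt.trans h1)
      have := ex.pos_mono (Nat.succ_le_of_lt (ex.idx_lt (h0.trans h1) h2)) p
      rw [hl.before.1, hl.before.2.1, hl.before.2.2] at this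
      refine ⟨hh', ?_⟩
      change PosLE (ex.now t' p).height (ex.now t' p).round (ex.now t' p).phase.num H r 1 at this
      rwa [hh'] at this
    have hround : (ex.now t p).round = r := by
      have := (before t le_rfl (by linarith)).2
      simp only [PosLE] at this
      omega
    -- The quorum seen at `g` shares an honest node with the one for `v`, so a prevote for `v`, and
    -- with it the proposal, has reached `p`.
    have hne : (ex.now t p).phase ≠ .propose := by
      obtain ⟨z, ⟨y, hz1⟩, hz2, hz⟩ := g5.exists_honest_mem_inter hbyz (hl.polka_cast ex)
      have hz1 := (ex.inbox_sent g hx hz1).resolve_left hz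
      obtain rfl := ex.prevote_unique hz1 (hz2.resolve_left hz)
      refine hreach.phase_ne_propose (q := z) (v := v) hp ?_
      rwa [hh, hround]
    have hph : ∀ t', t ≤ t' → t' < ex.time a → (ex.now t' p).height = H ∧
        (ex.now t' p).round = r ∧ (ex.now t' p).phase = .prevote := by
      intro t' h1 h2
      obtain ⟨b1, b2⟩ := before t' h1 h2
      have b3 := (now_mono h0 h1 p).2
      rw [hh, b1, hround] at b3
      have b4 : 1 ≤ (ex.now t p).phase.num := by
        cases h : (ex.now t p).phase <;> simp_all [Phase.num]
      have b5 : (ex.now t' p).round = r := by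
        simp only [PosLE] at b2 b3; omega
      refine ⟨b1, b5, ?_⟩
      have b6 : (ex.now t' p).phase.num = 1 := by
        simp only [PosLE] at b2 b3; omega
      cases h : (ex.now t' p).phase <;> simp_all [Phase.num]
    exact not_prevote_of_timer h0 hp (hph t le_rfl (by linarith)) hquo' le_rfl
      (hph _ (by linarith) hta)

/-- If an honest node locks a block in a late round, then all honest nodes take over a valid block
of that round or a later one before they enter later rounds. -/
theorem Stuck.lastValid_of_lock (hbyz : 3 * byz.card < N) (S : ex.Stuck H I)
    (L : ex.LateRound I R) {r : ℕ} (hr : R ≤ r) {i : ℕ} {v : Block Addr Cur Call}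
    (hl : ex.LockEvent i q H r v) {j : ℕ} (hp : p ∉ byz) (hh : (ex.st j p).height = H)
    (hj : r < (ex.st j p).round) : ∃ k b, (ex.st j p).lastValid = some (k, b) ∧ r ≤ k := by
  classical
  -- The timing estimate concerns the earliest lock of the round by any honest node, which replaces
  -- the given one.
  have hex : ∃ a, ∃ p v, ex.LockEvent a p H r v := ⟨i, q, v, hl⟩
  obtain ⟨x, w, ha⟩ := Nat.find_spec hex
  have hmin : ∀ e p v, ex.LockEvent e p H r v → Nat.find hex ≤ e :=
    fun e p v h => Nat.find_min' hex ⟨p, v, h⟩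
  generalize Nat.find hex = a at ha hmin
  obtain ⟨b, c, z, hz, -, hbj, hnot, -, -, hquo, htime⟩ :=
    first_entry hbyz (⟨p, hp, hh, hj⟩ : ex.Entered H (r + 1) j)
  have hlt := S.lock_time hbyz L hr ha hmin hz hquo htime
  obtain ⟨hIa, hgst⟩ := L.time_le S ha.honest ha.before.1 (hr.trans ha.before.2.1.ge)
  -- One delay after the lock its evidence is known to all, and nobody has entered round `r + 1`
  -- yet.
  obtain ⟨t, ht⟩ : ∃ t, t = ex.time a + ex.delay := ⟨_, rfl⟩
  have hreach : ex.Reached a t := .of_gst_le hgst ht.ge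
  have h0 := hreach.time_zero_le
  have hIt : ex.time I ≤ t := hIa.trans hreach.time_le
  have hht := S.height_now hp hIt
  have hib : ex.idx t + 1 ≤ b := ex.idx_lt h0 (by linarith)
  have hpolka : IsQuorum ((ex.now t p).senders (.prevote H r (some w))) :=
    ha.polka.mono (hreach.senders ha.honest hp _)
  have hround : (ex.now t p).round = r := by
    refine le_antisymm ?_ (le_round_now h0 hp
      (hpolka.exists_isThird fun z hz => ⟨_, hz, hht.symm, rfl⟩))
    by_contra hcon
    exact hnot _ hib ⟨p, hp, hht, not_le.1 hcon⟩
  obtain ⟨vr, hprop⟩ := ha.proposal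
  have hprop' := hreach.hasProposal ha.honest hp (hht.trans ha.before.1.symm) hprop
  have hne : (ex.now t p).phase ≠ .propose := by
    obtain ⟨y, hy, hyb⟩ := ha.polka.exists_honest hbyz
    refine hreach.phase_ne_propose (q := y) (v := w) hp ?_
    rw [hht, hround]
    exact (ex.inbox_sent a ha.honest hy).resolve_left hyb
  have hseen := polkaSeen_now h0 hp (v := w) (vr := vr) (by rwa [hround])
    (by rwa [hht, hround])
    ((ex.valid_iff hbyz ha.honest hp (ha.before.1.trans hht.symm)).1 ha.valid) hne
  -- The flag certifies a valid block of this very round, and valid rounds do not decrease within a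
  -- height.
  obtain ⟨-, u, hu⟩ := (ex.inv _ hp).polkaSeen hseen
  change (ex.now t p).lastValid = some ((ex.now t p).round, u) at hu
  rw [hround] at hu
  exact (ex.lock_mono (hib.trans hbj.le) hp (hht.trans hh.symm)).2 r u hu

end Execution

end MStableChain

/-! ### A good round, and the conclusion of liveness -/

namespace MStableChain

namespace Execution

variable {N : ℕ} [NeZero N] {Addr Cur World Call : Type*} [DecidableEq Addr] [DecidableEq Cur]
  {P : Params Addr Cur World Call} {byz : Finset (Fin N)} {ex : Execution P byz} {t : ℝ}
  {p q : Fin N} {H I R : ℕ}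

/-- A timeout of a round expires no earlier than its duration after the round was first entered. -/
theorem timer_late {r b : ℕ} (hnot : ∀ i ≤ b, ¬ ex.Entered H (r + 1) i) {j : ℕ} (hq : q ∉ byz)
    {ph : Phase} {d : ℝ} (htm : (⟨ph, H, r + 1, d⟩ : Timer) ∈ (ex.st j q).timers) :
    ex.time b + P.timeout ph (r + 1) ≤ d := by
  rcases ex.timer_origin hq htm with ⟨i, -, h1, h2, h3, -⟩ | ⟨-, -, h2, h3⟩
  · have hb : b ≤ i := by
      by_contra hcon
      exact hnot (i + 1) (by omega) ⟨q, hq, h2, h3.ge⟩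
    have := ex.time_mono hb
    dsimp only at h1
    linarith
  · exact absurd ⟨q, hq, h2, h3.ge⟩ (hnot 0 (Nat.zero_le _))

/-- In a late round with an honest proposer whose valid block is at least as recent as all locks,
a block is decided. -/
theorem Stuck.false_of_good_round (hbyz : 3 * byz.card < N) (S : ex.Stuck H I)
    (L : ex.LateRound I R) {r : ℕ} (hr : R ≤ r) (hp : p ∉ byz) (hprop : proposer N H (r + 1) = p)
    (hlock : ∀ i, (ex.st i p).height = H → (ex.st i p).round = r + 1 → ∀ j, ∀ q ∉ byz,
      ex.At j q H (r + 1) .propose → ∀ k b, (ex.st j q).locked = some (k, b) →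
        ∃ k' b', (ex.st i p).lastValid = some (k', b') ∧ k ≤ k') : False := by
  have hΔ := ex.delay_pos
  obtain ⟨j, hj⟩ := S.exists_entered hbyz (r + 1 + 1)
  obtain ⟨b', c', z', hz', -, -, hnot', hc1, hc2, -, htime'⟩ := first_entry hbyz hj
  obtain ⟨b, c, z, hz, -, hbc, hnot, hd1, hd2, hquo, htime⟩ :=
    first_entry hbyz (⟨z', hz', hc1, hc2.ge⟩ : ex.Entered H (r + 1) c')
  obtain ⟨hIc, hgst⟩ := L.time_le S hz hd1 (hr.trans hd2.ge)
  have hbc' := ex.time_mono hbc.le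
  have hTr := timeout_pos P .precommit r
  obtain ⟨s, hs⟩ : ∃ s, s = ex.time b := ⟨_, rfl⟩
  have hIs : ex.time I ≤ s := by linarith
  -- The node of event `c'` is already in round `r + 1`, so `c'` comes after `b`; the precommit
  -- timeout follows before anyone enters round `r + 2`.
  have hend : s + 4 * ex.delay < ex.time b' := by
    linarith [L.timeout_gt .precommit (r + 1) (by omega)]
  -- from `s + delay` to `s + 4 * delay`, everybody is in the round
  have hat : ∀ t, s + ex.delay ≤ t → t ≤ s + 4 * ex.delay → ∀ q ∉ byz,
      (ex.now t q).height = H ∧ (ex.now t q).round = r + 1 := by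
    intro t h1 h2 q hq
    have hIt : ex.time I ≤ t := by linarith
    have hh := S.height_now hq hIt
    refine ⟨hh, le_antisymm ?_ ?_⟩
    · by_contra hcon
      have hib : ex.idx t + 1 ≤ b' := ex.idx_lt (S.time_zero_le hIt) (by linarith)
      exact hnot' _ hib ⟨q, hq, hh, not_le.1 hcon⟩
    -- The quorum seen at `c` reaches everybody one delay later, so everybody's timeout has expired
    -- by `s + delay`.
    · exact S.round_sync hz hquo (t := ex.time c + ex.delay) (.of_gst_le hgst le_rfl)
        (by linarith) (by linarith) hq
  have hreach : ∀ t t', s + ex.delay ≤ t → t + ex.delay ≤ t' → ex.Reached (ex.idx t) t' := by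
    intro t t' h1 h2
    have hIt : ex.time I ≤ t := by linarith
    have := ex.time_idx_le (S.time_zero_le hIt)
    exact .of_gst_le (S.gst_le.trans (ex.time_mono (ex.le_idx hIt))) (by linarith)
  -- One delay each for entering the round, for the proposal, for the prevotes and for the
  -- precommits.
  obtain ⟨t₁, ht₁⟩ : ∃ t, t = s + ex.delay := ⟨_, rfl⟩
  obtain ⟨t₂, ht₂⟩ : ∃ t, t = s + 2 * ex.delay := ⟨_, rfl⟩
  obtain ⟨t₃, ht₃⟩ : ∃ t, t = s + 3 * ex.delay := ⟨_, rfl⟩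
  obtain ⟨t₄, ht₄⟩ : ∃ t, t = s + 4 * ex.delay := ⟨_, rfl⟩
  have h0 : ∀ t, s ≤ t → ex.time 0 ≤ t := fun t ht => S.time_zero_le (hIs.trans ht)
  -- the proposal
  obtain ⟨a1, a2⟩ := hat t₁ (by linarith) (by linarith) p hp
  obtain ⟨v, vr, hsent, hpool, hvr⟩ := (ex.inv (ex.idx t₁ + 1) hp).proposed
    (by rw [show (ex.st (ex.idx t₁ + 1) p).height = H from a1,
      show (ex.st (ex.idx t₁ + 1) p).round = r + 1 from a2]; exact hprop)
  rw [show (ex.st (ex.idx t₁ + 1) p).height = H from a1,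
    show (ex.st (ex.idx t₁ + 1) p).round = r + 1 from a2] at hsent hvr
  obtain ⟨-, i₀, -, o1, o2, -, o3⟩ := ex.proposal_origin hsent
  have hvalid : (ex.st i₀ p).Valid P v := by
    rcases o3 with ⟨k, -, h⟩ | ⟨-, -, h, -⟩
    · exact ((ex.inv i₀ hp).lastValid k v h).2.2.1
    · exact h
  have hprop_now : ∀ t, t₂ ≤ t → t ≤ t₄ → ∀ q ∉ byz,
      (ex.now t q).HasProposal (r + 1) v vr := by
    intro t h1 h2 q hq
    have hR := hreach t₁ t (by linarith) (by linarith)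
    refine ⟨?_, fun tx htx => hR.pool hp hq (hpool tx htx)⟩
    rw [(hat t (by linarith) (by linarith) q hq).1, hprop]
    exact hR.sent hsent hq
  have hphase : ∀ t, t₂ ≤ t → t ≤ t₄ → ∀ q ∉ byz, (ex.now t q).phase ≠ .propose := by
    intro t h1 h2 q hq
    have hR := hreach t₁ t (by linarith) (by linarith)
    obtain ⟨e1, e2⟩ := hat t (by linarith) (by linarith) q hq
    refine phase_ne_propose_now (h0 t (by linarith)) hq (v := v) (vr := vr)
      (by rw [e2]; exact hprop_now t h1 h2 q hq) fun k hk => ?_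
    rw [e1, e2]
    exact ⟨(hvr k hk).1, (hvr k hk).2.mono fun _ hx => hR.inbox hp hq hx⟩
  -- the prevotes
  have hprevote : ∀ q ∉ byz,
      (⟨q, .prevote H (r + 1) (some v)⟩ : Msg N Addr Cur Call) ∈ (ex.cfg (ex.idx t₂ + 1)).sent := by
    intro q hq
    obtain ⟨e1, e2⟩ := hat t₂ (by linarith) (by linarith) q hq
    obtain ⟨x, hx⟩ := (ex.inv (ex.idx t₂ + 1) hq).prevoted
      (hphase t₂ le_rfl (by linarith) q hq)
    rw [show (ex.st (ex.idx t₂ + 1) q).height = H from e1,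
      show (ex.st (ex.idx t₂ + 1) q).round = r + 1 from e2] at hx
    suffices x = some v by rwa [this] at hx
    obtain ⟨-, i, hi, hati, -, hreason⟩ := ex.prevote_origin hx
    have hit : ex.time i ≤ t₂ :=
      (ex.time_mono (Nat.lt_succ_iff.1 hi)).trans (ex.time_idx_le (h0 t₂ (by linarith)))
    have hati' := hati
    obtain ⟨f1, f2, f3⟩ := hati'
    -- The honest `p` makes only one proposal, `hlock` satisfies the lock condition, and the propose
    -- timeout ends more than four delays after `s`, hence after `t₂`.
    rcases hreason with ⟨v', vr', hprop', -, hvote⟩ | ⟨-, d, hd, htm⟩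
    · have hm := hprop'.1
      rw [f1, f2, hprop] at hm
      have hm' := (ex.inbox_sent i hq hm).resolve_left hp
      obtain ⟨rfl, rfl⟩ := ex.proposal_unique (ex.sent_mono (le_max_left _ _) hsent)
        (ex.sent_mono (le_max_right _ _) hm')
      rcases hvote with ⟨-, h⟩ | ⟨hno, -⟩
      · exact h
      · refine absurd ⟨(ex.valid_iff hbyz hp hq (o1.trans f1.symm)).1 hvalid, ?_⟩ hno
        intro k b hkb
        obtain ⟨k', b', h1, h2⟩ := hlock i₀ o1 o2 i q hq hati k b hkb
        rcases o3 with ⟨k'', rfl, h⟩ | ⟨-, h, -⟩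
        · rw [h1] at h
          simp only [Option.some.injEq, Prod.mk.injEq] at h
          obtain ⟨rfl, -⟩ := h
          exact Or.inr ⟨k', rfl, h2⟩
        · rw [h1] at h; cases h
    · rw [f1, f2] at htm
      have := timer_late hnot hq htm
      have := L.timeout_gt .propose (r + 1) (by omega)
      linarith
  have hpolka : ∀ t, t₃ ≤ t → ∀ q ∉ byz,
      IsQuorum ((ex.now t q).senders (.prevote H (r + 1) (some v))) := fun t h1 q hq =>
    isQuorum_of_honest hbyz fun y hy =>
      (hreach t₂ t (by linarith) (by linarith)).sent (hprevote y hy) hq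
  have hvalid_now : ∀ t, t₂ ≤ t → t ≤ t₄ → ∀ q ∉ byz, (ex.now t q).Valid P v :=
    fun t h1 h2 q hq => (ex.valid_iff hbyz hp hq
      (o1.trans (hat t (by linarith) (by linarith) q hq).1.symm)).1 hvalid
  -- the precommits
  have hprecommit : ∀ q ∉ byz, (⟨q, .precommit H (r + 1) (some v)⟩ : Msg N Addr Cur Call) ∈
      (ex.cfg (ex.idx t₃ + 1)).sent := by
    intro q hq
    obtain ⟨e1, e2⟩ := hat t₃ (by linarith) (by linarith) q hq
    have hseen := polkaSeen_now (h0 t₃ (by linarith)) hq (v := v) (vr := vr)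
      (by rw [e2]; exact hprop_now t₃ (by linarith) (by linarith) q hq)
      (by rw [e1, e2]; exact hpolka t₃ le_rfl q hq)
      (hvalid_now t₃ (by linarith) (by linarith) q hq)
      (hphase t₃ (by linarith) (by linarith) q hq)
    have hinv := ex.inv (ex.idx t₃ + 1) hq
    obtain ⟨x, hx⟩ := hinv.precommitted (hinv.polkaSeen hseen).1
    rw [show (ex.st (ex.idx t₃ + 1) q).height = H from e1,
      show (ex.st (ex.idx t₃ + 1) q).round = r + 1 from e2] at hx
    suffices x = some v by rwa [this] at hx
    have hquo' := (hpolka t₃ le_rfl q hq).mono (ex.senders_subset_cast _ hq _)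
    obtain ⟨-, i, hi, ⟨f1, f2, f3⟩, -, hreason⟩ := ex.precommit_origin hx
    have hit : ex.time i ≤ t₃ :=
      (ex.time_mono (Nat.lt_succ_iff.1 hi)).trans (ex.time_idx_le (h0 t₃ (by linarith)))
    -- Quorums of prevotes of one round agree, and the prevote timeout cannot have expired by `t₃`.
    rcases hreason with ⟨w, _, rfl, -, hw, -⟩ | ⟨-, hnil⟩ | ⟨-, d, hd, htm⟩
    · rw [f1, f2] at hw
      exact ex.prevote_quorum_unique hbyz (hw.mono (ex.senders_subset_cast i hq _)) hquo'
    · rw [f1, f2] at hnil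
      cases ex.prevote_quorum_unique hbyz (hnil.mono (ex.senders_subset_cast i hq _)) hquo'
    · rw [f1, f2] at htm
      have := timer_late hnot hq htm
      have := L.timeout_gt .prevote (r + 1) (by omega)
      linarith
  -- the decision
  refine not_decide_now (h0 t₄ (by linarith)) hp
    (hprop_now t₄ (by linarith) le_rfl p hp) ?_ (hvalid_now t₄ (by linarith) le_rfl p hp)
  rw [(hat t₄ (by linarith) (by linarith) p hp).1]
  exact isQuorum_of_honest hbyz fun y hy =>
    (hreach t₃ t₄ (by linarith) (by linarith)).sent (hprecommit y hy) hp

/-- Every node is the proposer of infinitely many rounds. -/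
theorem exists_proposer_eq (p : Fin N) (H R : ℕ) : ∃ r ≥ R, proposer N H (r + 1) = p := by
  have hN : 0 < N := NeZero.pos N
  have h1 : R + H + 1 ≤ N * (R + H + 1) := Nat.le_mul_of_pos_left _ hN
  -- The witness solves `H + (r + 1) = p + N * (R + H + 1)`; the multiple of `N` is chosen large
  -- enough for `r ≥ R`.
  refine ⟨p + N * (R + H + 1) - H - 1, by omega, Fin.ext ?_⟩
  have h2 : H + (p + N * (R + H + 1) - H - 1 + 1) = p + N * (R + H + 1) := by omega
  simp [proposer, Fin.ofNat, h2, Nat.mod_eq_of_lt p.2]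

/-- Three cases provide the good round: a lock in some late round, after which any honest proposer
is suitable; locks in early rounds only, where the holder of a most recent one is; and no locks at
all. -/
theorem liveness (hbyz : 3 * byz.card < N) : ex.Liveness := by
  by_contra hlive
  obtain ⟨H, I, S⟩ := exists_stuck hbyz hlive
  obtain ⟨R, L⟩ := exists_lateRound (ex := ex) I
  obtain ⟨p₀, -, hp₀⟩ := (isQuorum_of_honest hbyz (A := Set.univ) (by simp)).exists_honest hbyz
  by_cases hlate : ∃ k ≥ R, ∃ j q, q ∉ byz ∧ (ex.st j q).height = H ∧
      ∃ b, (ex.st j q).locked = some (k, b)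
  · obtain ⟨k, hk, j, q, hq, hh, b, hl⟩ := hlate
    obtain ⟨e, -, he⟩ := ex.lock_origin hq hl
    rw [hh] at he
    obtain ⟨r, hr, hprop⟩ := exists_proposer_eq p₀ H (max R k)
    refine S.false_of_good_round hbyz L (le_of_max_le_left hr) hp₀ hprop ?_
    intro i hi1 hi2 j' q' hq' ⟨a1, a2, a3⟩ k' b' hl'
    have hk' : k' < r + 1 := by
      obtain ⟨h1, h2, -⟩ := (ex.inv j' hq').locked k' b' hl'
      rw [a2] at h1 h2
      rw [a3] at h2
      exact lt_of_le_of_ne h1 fun e => by cases h2 e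
    by_cases hk'R : R ≤ k'
    · obtain ⟨e', -, he'⟩ := ex.lock_origin hq' hl'
      rw [a1] at he'
      exact S.lastValid_of_lock hbyz L hk'R he' hp₀ hi1 (by omega)
    -- An early lock is older than the late round `k`, from which or later `p₀` has a valid block.
    · obtain ⟨k₁, b₁, h1, h2⟩ := S.lastValid_of_lock hbyz L hk he hp₀ hi1
        (by have := le_of_max_le_right hr; omega)
      exact ⟨k₁, b₁, h1, by omega⟩
  · push Not at hlate
    by_cases hany : ∃ k, ∃ j q, q ∉ byz ∧ (ex.st j q).height = H ∧
        ∃ b, (ex.st j q).locked = some (k, b)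
    · classical
      have hbound : ∀ k, (∃ j q, q ∉ byz ∧ (ex.st j q).height = H ∧
          ∃ b, (ex.st j q).locked = some (k, b)) → k ≤ R := by
        rintro k ⟨j, q, hq, hh, b, hl⟩
        by_contra hcon
        exact hlate k (not_le.1 hcon).le j q hq hh b hl
      obtain ⟨k₀, hk₀⟩ := hany
      obtain ⟨j, q, hq, hh, b, hl⟩ := Nat.findGreatest_spec (P := fun k => ∃ j q, q ∉ byz ∧
        (ex.st j q).height = H ∧ ∃ b, (ex.st j q).locked = some (k, b)) (hbound k₀ hk₀) hk₀
      have hmax := fun k hk => Nat.le_findGreatest (P := fun k => ∃ j q, q ∉ byz ∧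
        (ex.st j q).height = H ∧ ∃ b, (ex.st j q).locked = some (k, b)) (hbound k hk) hk
      obtain ⟨r, hr, hprop⟩ := exists_proposer_eq q H (max R (ex.st j q).round)
      refine S.false_of_good_round hbyz L (le_of_max_le_left hr) hq hprop ?_
      intro i hi1 hi2 j' q' hq' ⟨a1, a2, a3⟩ k' b' hl'
      have hji : j ≤ i := by
        by_contra hcon
        have hpos := ex.pos_mono (not_le.1 hcon).le q
        rw [hi1, hi2, hh] at hpos
        have := le_of_max_le_right hr
        simp only [PosLE] at hpos
        omega
      -- From event `j` on, the lock of `q` stays at least as recent, and its valid block is at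
      -- least as recent as its lock.
      obtain ⟨k₁, b₁, h1, h2⟩ := (ex.lock_mono hji hq (hh.trans hi1.symm)).1 _ b hl
      obtain ⟨-, -, k₂, b₂, h3, h4⟩ := (ex.inv i hq).locked k₁ b₁ h1
      exact ⟨k₂, b₂, h3, (hmax k' ⟨j', q', hq', a1, b', hl'⟩).trans (h2.trans h4)⟩
    · push Not at hany
      obtain ⟨r, hr, hprop⟩ := exists_proposer_eq p₀ H R
      refine S.false_of_good_round hbyz L hr hp₀ hprop ?_
      intro i _ _ j q hq ⟨a1, _, _⟩ k b hl
      exact absurd hl (hany k j q hq a1 b)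

end Execution

end MStableChain

theorem mainTheorem1 {Addr Cur World Call : Type*} [DecidableEq Addr] [DecidableEq Cur]
    (N : ℕ) [NeZero N] (P : MStableChain.Params Addr Cur World Call)
    (byz : Finset (Fin N)) (hbyz : (byz.card : ℝ) / (N : ℝ) < 1 / 3)
    (ex : MStableChain.Execution P byz) :
    ex.Safety ∧ ex.Liveness ∧
      ex.TransactionsAuthentic ∧ ex.SettledInCurrency ∧ ex.BaseFeesCorrect ∧
      ex.ManagementValid := by
  have h := MStableChain.three_mul_card_lt hbyz
  exact ⟨ex.safety h, MStableChain.Execution.liveness h, ex.transactionsAuthentic,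
    ex.settledInCurrency, ex.baseFeesCorrect, ex.managementValid⟩
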